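/- Let $\pi\colon E\to\mathbb R$ be a smooth bundle over the real line (it suffices that $\pi$ is a surjective submersion), $\dim E=n+1$, let $k\ge 1$, let $t$ be the standard coordinate of $\mathbb R$, and let $J^m\pi$ be the manifold of $m$-jets of local sections of $\pi$. Natural coordinates on $J^m\pi$, induced by coordinates $(t,q_0^A)$ on $E$ adapted to $\pi$, are written $(t,q_0^A,\dots,q_m^A)$, $1\le A\le n$; summation over repeated indices is understood. Let $\mathcal L=L\,dt$ be a Lagrangian density of order $k$, where $L\in C^\infty(J^k\pi)$. *The unified space.* Let $$\mathcal W=J^{2k-1}\pi\times_{J^{k-1}\pi}T^*(J^{k-1}\pi),$$ with projections $\rho_1\colon\mathcal W\to J^{2k-1}\pi$, $\rho_2\colon\mathcal W\to T^*(J^{k-1}\pi)$, $\rho_{\mathbb R}\colon\mathcal W\to\mathbb R$. Let $\Theta$ be the tautological one-form of $T^*(J^{k-1}\pi)$ and $\Omega=\rho_2^*(-d\Theta)$. Let $\hat L$ be the pull-back of $L$ to $\mathcal W$, and let $\hat C\in C^\infty(\mathcal W)$ be given by $$\hat C(j^{2k-1}_t\phi,\alpha)=\alpha\bigl(T_t(j^{k-1}\phi)(\partial/\partial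 t)\bigr).$$ Let $\mathcal W_o=\{\hat C-\hat L=0\}\subset\mathcal W$, and let $\Omega_o$ and $\rho_{\mathbb R}^o$ be the restrictions of $\Omega$ and $\rho_{\mathbb R}$ to the submanifold $\mathcal W_o$. *The Legendre–Ostrogradsky maps.* With $d_T=\partial_t+q_{i+1}^A\,\partial/\partial q_i^A$ the total time derivative, put, for $0\le r\le k-1$, $$\hat p^r_A=\sum_{i=0}^{k-r-1}(-1)^i d_T^i\Bigl(\frac{\partial L}{\partial q^A_{r+1+i}}\Bigr),\qquad \hat p=L-\sum_{r=0}^{k-1}q^A_{r+1}\hat p^r_A .$$ The extended map $\widetilde{\mathcal{FL}}\colon J^{2k-1}\pi\to T^*(J^{k-1}\pi)$ sends a point to the covector $\hat p\,dt+\hat p^r_A\,dq_r^A$ at its projection to $J^{k-1}\pi$. The restricted map $\mathcal{FL}$ is its composition with the quotient map $T^*(J^{k-1}\pi)\to J^{k-1}\pi^*=T^*(J^{k-1}\pi)/\langle dt\rangle$; in coordinates, $$(t,q_0,\dots,q_{2k-1})\mapsto(t,q_0,\dots,q_{k-1},\hat p^0,\dots,\hat p^{k-1}).$$ The density $\mathcal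 L$ is *regular* if $\mathcal{FL}$ is a local diffeomorphism (equivalently, the Hessian matrix $\bigl(\partial^2L/\partial q_k^A\partial q_k^B\bigr)$ is everywhere invertible). Let $\mathcal W_1=\{(y,\widetilde{\mathcal{FL}}(y)) : y\in J^{2k-1}\pi\}\subset\mathcal W_o$ be the graph of $\widetilde{\mathcal{FL}}$. *The equations.* A vector field on $\mathcal W_o$ along $\mathcal W_1$ assigns to each $w\in\mathcal W_1$ a vector $X_o(w)\in T_w\mathcal W_o$. The unified dynamical equations along $\mathcal W_1$ are $$i(X_o)\Omega_o\big|_{\mathcal W_1}=0,\qquad i(X_o)\,(\rho_{\mathbb R}^o)^*dt\,\big|_{\mathcal W_1}=1.\qquad(*)$$ Such an $X_o$ is a *semispray of type $1$* in $\mathcal W_o$ if every (local) integral section $\psi$ of $X_o$, that is, every local section of $\rho_{\mathbb R}^o$ that is an integral curve of $X_o$, is holonomic: $\rho_1\circ\psi=j^{2k-1}\phi$, where $\phi$ is the projection of $\psi$ to $E$. **Statement.** If $\mathcal L$ is regular, then there is a smooth vector field $X_o$ on $\mathcal W_o$ along $\mathcal W_1$ that solves $(*)$ and is tangent to $\mathcal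 W_1$; it is the unique solution of $(*)$ tangent to $\mathcal W_1$; and it is a semispray of type $1$ in $\mathcal W_o$. -/

import Mathlib

open Set Filter Topology Manifold
open scoped ContDiff
set_option linter.unusedSectionVars false

section
variable {V F : Type*} [NormedAddCommGroup V] [NormedSpace ℝ V] [NormedAddCommGroup F] [NormedSpace ℝ F]

theorem iteratedDeriv_comp_congr {g : ℝ × V → F} {c₁ c₂ : ℝ → V} {t : ℝ} {m : ℕ}
    (hg : ContDiffAt ℝ ∞ g (t, c₁ t)) (h₁ : ContDiffAt ℝ ∞ c₁ t) (h₂ : ContDiffAt ℝ ∞ c₂ t)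
    (h : ∀ j ≤ m, iteratedDeriv j c₁ t = iteratedDeriv j c₂ t) {i : ℕ} (hi : i ≤ m) :
    iteratedDeriv i (fun s => g (s, c₁ s)) t = iteratedDeriv i (fun s => g (s, c₂ s)) t := by
  have h0 : c₁ t = c₂ t := by simpa using h 0 (Nat.zero_le _)
  have key : ∀ j ≤ m, iteratedFDeriv ℝ j (fun s : ℝ => (s, c₁ s)) t
      = iteratedFDeriv ℝ j (fun s : ℝ => (s, c₂ s)) t := by
    intro j hj
    have e : iteratedFDeriv ℝ j c₁ t = iteratedFDeriv ℝ j c₂ t := by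
      rw [iteratedFDeriv_eq_equiv_comp, iteratedFDeriv_eq_equiv_comp]
      simp only [Function.comp_apply, h j hj]
    have a₁ := iteratedFDeriv_prodMk (𝕜 := ℝ) (f := fun s : ℝ => s) (n := ∞) (x := t)
      contDiffAt_id h₁ (i := j) (by exact_mod_cast le_top)
    have a₂ := iteratedFDeriv_prodMk (𝕜 := ℝ) (f := fun s : ℝ => s) (n := ∞) (x := t)
      contDiffAt_id h₂ (i := j) (by exact_mod_cast le_top)
    rw [a₁, a₂, e]
  have b₁ := iteratedFDeriv_comp (𝕜 := ℝ) (f := fun s : ℝ => (s, c₁ s)) (x := t) hg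
    (contDiffAt_id.prodMk h₁) (i := i) (by exact_mod_cast le_top)
  have b₂ := iteratedFDeriv_comp (𝕜 := ℝ) (f := fun s : ℝ => (s, c₂ s)) (x := t) (h0 ▸ hg)
    (contDiffAt_id.prodMk h₂) (i := i) (by exact_mod_cast le_top)
  have e : iteratedFDeriv ℝ i (g ∘ fun s : ℝ => (s, c₁ s)) t
      = iteratedFDeriv ℝ i (g ∘ fun s : ℝ => (s, c₂ s)) t := by
    rw [b₁, b₂, h0]
    unfold FormalMultilinearSeries.taylorComp FormalMultilinearSeries.compAlongOrderedFinpartition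
    refine Finset.sum_congr rfl fun c _ => ?_
    congr 1
    funext l
    exact key _ ((c.partSize_le l).trans hi)
  exact congrArg (fun M => M fun _ => 1) e

theorem contDiffOn_iteratedDeriv_partial {P : Type*} [NormedAddCommGroup P] [NormedSpace ℝ P]
    {G : P × ℝ → F} {Ω : Set (P × ℝ)} (hΩ : IsOpen Ω) (hG : ContDiffOn ℝ ∞ G Ω) (i : ℕ) :
    ContDiffOn ℝ ∞ (fun x : P × ℝ => iteratedDeriv i (fun s => G (x.1, s)) x.2) Ω := by
  induction i with
  | zero => simpa using hG
  | succ i ih =>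
    have hf := ih.fderiv_of_isOpen hΩ (m := ∞) (by simp)
    refine (hf.clm_apply (contDiffOn_const (c := ((0 : P), (1 : ℝ))))).congr fun x hx => ?_
    rw [iteratedDeriv_succ]
    have hd : DifferentiableAt ℝ
        (fun x : P × ℝ => iteratedDeriv i (fun s => G (x.1, s)) x.2) x :=
      (ih.contDiffAt (hΩ.mem_nhds hx)).differentiableAt (by simp)
    have hl : HasDerivAt (fun s : ℝ => (x.1, s)) ((0 : P), (1 : ℝ)) x.2 :=
      (hasDerivAt_const x.2 x.1).prodMk (hasDerivAt_id x.2)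
    exact (hd.hasFDerivAt.comp_hasDerivAt x.2 hl).deriv

theorem contDiffOn_iteratedDeriv_diag {P : Type*} [NormedAddCommGroup P] [NormedSpace ℝ P]
    {G : P × ℝ → F} {Ω : Set (P × ℝ)} (hΩ : IsOpen Ω) (hG : ContDiffOn ℝ ∞ G Ω) (i : ℕ)
    {τ : P → ℝ} (hτ : ContDiff ℝ ∞ τ) {S : Set P} (hS : ∀ z ∈ S, (z, τ z) ∈ Ω) :
    ContDiffOn ℝ ∞ (fun z => iteratedDeriv i (fun s => G (z, s)) (τ z)) S :=
  (contDiffOn_iteratedDeriv_partial hΩ hG i).comp (contDiff_id.prodMk hτ).contDiffOn hS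

theorem iteratedDeriv_taylor {m : ℕ} (t : ℝ) (q : Fin (m + 1) → V) (i : Fin (m + 1)) :
    iteratedDeriv i (fun s : ℝ => ∑ j : Fin (m + 1), ((s - t) ^ (j : ℕ) / (j : ℕ).factorial) • q j) t
      = q i := by
  have hs : ∀ j : Fin (m + 1), ContDiff ℝ ∞ (fun s : ℝ => (s - t) ^ (j : ℕ) / ((j : ℕ).factorial : ℝ)) :=
    fun j => by fun_prop
  have h1 : ∀ j : Fin (m + 1),
      iteratedDeriv i (fun s : ℝ => ((s - t) ^ (j : ℕ) / ((j : ℕ).factorial : ℝ)) • q j) t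
        = (if j = i then (1 : ℝ) else 0) • q j := by
    intro j
    have := (ContinuousLinearMap.smulRight (ContinuousLinearMap.id ℝ ℝ) (q j)).iteratedFDeriv_comp_left
      ((hs j).contDiffAt (x := t)) (i := i) (by exact_mod_cast le_top)
    have h2 := congrArg (fun M => M fun _ => 1) this
    have h3 : iteratedDeriv i (fun s : ℝ => ((s - t) ^ (j : ℕ) / ((j : ℕ).factorial : ℝ)) • q j) t
        = (iteratedDeriv i (fun s : ℝ => ((s - t) ^ (j : ℕ) / ((j : ℕ).factorial : ℝ))) t) • q j := h2
    rw [h3]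
    congr 1
    have h4 : (fun s : ℝ => ((s - t) ^ (j : ℕ) / ((j : ℕ).factorial : ℝ)))
        = fun s => (fun u : ℝ => ((j : ℕ).factorial : ℝ)⁻¹ * u ^ (j : ℕ)) (s - t) := by
      funext s; rw [div_eq_inv_mul]
    rw [h4, iteratedDeriv_comp_sub_const (f := fun u : ℝ => ((j : ℕ).factorial : ℝ)⁻¹ * u ^ (j : ℕ))]
    simp only [sub_self]
    rw [iteratedDeriv_const_mul_field, iteratedDeriv_fun_pow_zero]
    split_ifs with hji h h
    · have : ((j : ℕ).factorial : ℝ) ≠ 0 := by positivity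
      simp [this]
    · exact absurd (Fin.ext hji.symm) h
    · exact absurd (congrArg Fin.val h).symm hji
    · simp
  have := iteratedDeriv_fun_sum (𝕜 := ℝ) (n := i) (x := t) (I := Finset.univ)
    (f := fun (j : Fin (m + 1)) (s : ℝ) => ((s - t) ^ (j : ℕ) / ((j : ℕ).factorial : ℝ)) • q j)
    (fun j _ => by fun_prop)
  rw [this, Finset.sum_congr rfl fun j _ => h1 j]
  simp
end

noncomputable section

/-- Coordinates `(t, q_0, …, q_m)`, `q_i ∈ ℝⁿ`, of the `m`-th order jet space. -/
abbrev JetCoord (n m : ℕ) : Type := ℝ × (Fin (m + 1) → Fin n → ℝ)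


section Fibred

variable (n : ℕ) {E : Type*} [TopologicalSpace E] [ChartedSpace (EuclideanSpace ℝ (Fin (n + 1))) E]

/-- `π : E → ℝ` is a fibred manifold over the real line, `dim E = n + 1`: a smooth surjective
submersion. Every smooth fibre bundle over `ℝ` is one. -/
class IsFibredOverLine (π : E → ℝ) : Prop where
  isSubmersion : Manifold.IsSubmersion (𝓡 (n + 1)) 𝓘(ℝ, ℝ) ∞ π
  surjective : Function.Surjective π

/-- `e` is a system of local coordinates `(t, q^A)` on `E` adapted to `π`. -/
structure IsAdapted (π : E → ℝ) (e : OpenPartialHomeomorph E (ℝ × (Fin n → ℝ))) : Prop where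
  contMDiffOn : ContMDiffOn (𝓡 (n + 1)) 𝓘(ℝ, ℝ × (Fin n → ℝ)) ∞ e e.source
  contMDiffOn_symm : ContMDiffOn 𝓘(ℝ, ℝ × (Fin n → ℝ)) (𝓡 (n + 1)) ∞ e.symm e.target
  fst_eq : ∀ x ∈ e.source, (e x).1 = π x

theorem exists_isAdapted (π : E → ℝ) [hπ : IsFibredOverLine n π] (x : E) :
    ∃ e : OpenPartialHomeomorph E (ℝ × (Fin n → ℝ)), IsAdapted n π e ∧ x ∈ e.source := by
  obtain ⟨F, _, _, hF⟩ := hπ.isSubmersion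
  have h := hF x
  let L := h.equiv
  have hfin : FiniteDimensional ℝ (ℝ × F) := L.toLinearEquiv.finiteDimensional
  have hfinF : FiniteDimensional ℝ F :=
    FiniteDimensional.of_surjective (LinearMap.snd ℝ ℝ F) LinearMap.snd_surjective
  have hrank : Module.finrank ℝ F = Module.finrank ℝ (Fin n → ℝ) := by
    have h1 := L.toLinearEquiv.finrank_eq
    rw [Module.finrank_prod, finrank_euclideanSpace_fin, Module.finrank_self] at h1
    rw [Module.finrank_fin_fun]
    omega
  let κ : F ≃L[ℝ] (Fin n → ℝ) := ContinuousLinearEquiv.ofFinrankEq hrank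
  let φ := h.domChart
  let ψ := h.codChart
  let e : OpenPartialHomeomorph E (ℝ × (Fin n → ℝ)) :=
    (φ.trans L.toHomeomorph.toOpenPartialHomeomorph).trans
      (ψ.symm.prod κ.toHomeomorph.toOpenPartialHomeomorph)
  have he : ∀ y, e y = (ψ.symm (L (φ y)).1, κ (L (φ y)).2) := fun y => rfl
  have hsymm : ∀ z, e.symm z = φ.symm (L.symm (ψ z.1, κ.symm z.2)) := fun z => rfl
  have hsrc : ∀ y, y ∈ e.source → y ∈ φ.source ∧ (L (φ y)).1 ∈ ψ.target := by
    intro y hy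
    simpa [e] using hy
  have htgt : ∀ z, z ∈ e.target → z.1 ∈ ψ.source ∧ L.symm (ψ z.1, κ.symm z.2) ∈ φ.target := by
    intro z hz
    simpa [e] using hz
  have hψ : ∀ y ∈ φ.source, (L (φ y)).1 = ψ (π y) := by
    intro y hy
    have hy' : φ y ∈ (φ.extend (𝓡 (n + 1))).target := by simpa using φ.map_source hy
    have := h.writtenInCharts hy'
    simp only [Function.comp_apply] at this
    rw [← this]
    simp [φ, ψ, φ.left_inv hy]
  have hπψ : ∀ y ∈ φ.source, π y ∈ ψ.source := fun y hy => h.source_subset_preimage_source hy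
  refine ⟨e, ⟨?_, ?_, ?_⟩, ?_⟩
  · have h1 := contMDiffOn_of_mem_maximalAtlas h.domChart_mem_maximalAtlas
    have h2 := contMDiffOn_symm_of_mem_maximalAtlas h.codChart_mem_maximalAtlas
    have h3 : ContMDiffOn (𝓡 (n + 1)) 𝓘(ℝ, ℝ × F) ∞ (fun y => L (φ y)) φ.source :=
      L.contDiff.contMDiff.comp_contMDiffOn h1
    have h4 : ContMDiffOn (𝓡 (n + 1)) 𝓘(ℝ, ℝ) ∞ (fun y => (L (φ y)).1) φ.source :=
      contDiff_fst.contMDiff.comp_contMDiffOn h3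
    have h5 : ContMDiffOn (𝓡 (n + 1)) 𝓘(ℝ, Fin n → ℝ) ∞ (fun y => κ (L (φ y)).2) φ.source :=
      (κ.contDiff.comp contDiff_snd).contMDiff.comp_contMDiffOn h3
    have h6 : ContMDiffOn (𝓡 (n + 1)) 𝓘(ℝ, ℝ) ∞ (fun y => ψ.symm (L (φ y)).1) e.source :=
      h2.comp (h4.mono fun y hy => (hsrc y hy).1) fun y hy => (hsrc y hy).2
    exact (h6.prodMk_space (h5.mono fun y hy => (hsrc y hy).1))
  · have h1 := contMDiffOn_symm_of_mem_maximalAtlas h.domChart_mem_maximalAtlas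
    have h2 := contMDiffOn_of_mem_maximalAtlas h.codChart_mem_maximalAtlas
    have h3 : ContMDiffOn 𝓘(ℝ, ℝ × (Fin n → ℝ)) 𝓘(ℝ, ℝ) ∞
        (fun z : ℝ × (Fin n → ℝ) => ψ z.1) e.target :=
      h2.comp contDiff_fst.contMDiff.contMDiffOn fun z hz => (htgt z hz).1
    have h4 : ContMDiffOn 𝓘(ℝ, ℝ × (Fin n → ℝ)) 𝓘(ℝ, F) ∞
        (fun z : ℝ × (Fin n → ℝ) => κ.symm z.2) e.target :=
      (κ.symm.contDiff.comp contDiff_snd).contMDiff.contMDiffOn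
    have h5 := L.symm.contDiff.contMDiff.comp_contMDiffOn (h3.prodMk_space h4)
    exact h1.comp h5 fun z hz => (htgt z hz).2
  · intro y hy
    rw [he, hψ y (hsrc y hy).1]
    exact ψ.left_inv (hπψ y (hsrc y hy).1)
  · have hx := h.mem_domChart_source
    have : (L (φ x)).1 ∈ ψ.target := by
      rw [hψ x hx]; exact ψ.map_source (hπψ x hx)
    have h' : x ∈ φ.source ∧ (L (φ x)).1 ∈ ψ.target := ⟨hx, this⟩
    simpa [e] using h'

/-- A chosen system of adapted coordinates around `x`. -/
def adaptedChartAt (π : E → ℝ) [IsFibredOverLine n π] (x : E) :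
    OpenPartialHomeomorph E (ℝ × (Fin n → ℝ)) :=
  (exists_isAdapted n π x).choose

theorem isAdapted_adaptedChartAt (π : E → ℝ) [IsFibredOverLine n π] (x : E) :
    IsAdapted n π (adaptedChartAt n π x) :=
  (exists_isAdapted n π x).choose_spec.1

theorem mem_adaptedChartAt_source (π : E → ℝ) [IsFibredOverLine n π] (x : E) :
    x ∈ (adaptedChartAt n π x).source :=
  (exists_isAdapted n π x).choose_spec.2

/-! ### Jets of sections -/

/-- `φ` is a smooth section of `π` on a neighbourhood of `t`. -/
def IsLocalSection (π : E → ℝ) (φ : ℝ → E) (t : ℝ) : Prop :=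
  ∀ᶠ s in 𝓝 t, π (φ s) = s ∧ ContMDiffAt 𝓘(ℝ, ℝ) (𝓡 (n + 1)) ∞ φ s

/-- A time together with a local section of `π` defined around it. -/
structure PointedSection (π : E → ℝ) where
  time : ℝ
  toFun : ℝ → E
  isLocalSection : IsLocalSection n π toFun time

/-- Contact of order `m`: same time, same value, and for every function `f` that is smooth near
the common value, the derivatives of `f` along the two sections agree up to order `m`. -/
def SameJet (π : E → ℝ) (m : ℕ) (a b : PointedSection n π) : Prop :=
  a.time = b.time ∧ a.toFun a.time = b.toFun b.time ∧
    ∀ f : E → ℝ, ContMDiffAt (𝓡 (n + 1)) 𝓘(ℝ, ℝ) ∞ f (a.toFun a.time) →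
      ∀ i ≤ m, iteratedDeriv i (fun s => f (a.toFun s)) a.time
        = iteratedDeriv i (fun s => f (b.toFun s)) b.time

/-- Contact of order `m` as an equivalence relation. -/
def jetSetoid (π : E → ℝ) (m : ℕ) : Setoid (PointedSection n π) where
  r := SameJet n π m
  iseqv :=
    { refl := fun _ => ⟨rfl, rfl, fun _ _ _ _ => rfl⟩
      symm := fun h => ⟨h.1.symm, h.2.1.symm, fun f hf i hi =>
        (h.2.2 f (h.2.1 ▸ hf) i hi).symm⟩
      trans := fun h h' => ⟨h.1.trans h'.1, h.2.1.trans h'.2.1, fun f hf i hi =>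
        (h.2.2 f hf i hi).trans (h'.2.2 f (h.2.1 ▸ hf) i hi)⟩ }

/-- The `m`-th order jet space `J^m π`. -/
def Jet (π : E → ℝ) (m : ℕ) : Type _ := Quotient (jetSetoid n π m)

variable {n} {π : E → ℝ} {m : ℕ}

/-- The jet `j^m_t φ`. -/
def Jet.mk (m : ℕ) (φ : ℝ → E) (t : ℝ) (h : IsLocalSection n π φ t) : Jet n π m :=
  Quotient.mk (jetSetoid n π m) ⟨t, φ, h⟩

/-- The projection `J^m π → E`. -/
def Jet.base (y : Jet n π m) : E :=
  Quotient.lift (fun a : PointedSection n π => a.toFun a.time) (fun _ _ (h : SameJet n π m _ _) => h.2.1) y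

/-- The projection `J^m π → ℝ`. -/
def Jet.time (y : Jet n π m) : ℝ :=
  Quotient.lift (fun a : PointedSection n π => a.time) (fun _ _ (h : SameJet n π m _ _) => h.1) y

/-- The projection `J^m π → J^r π` for `r ≤ m`. -/
def Jet.proj {r : ℕ} (hr : r ≤ m) (y : Jet n π m) : Jet n π r :=
  Quotient.map' (s₁ := jetSetoid n π m) (s₂ := jetSetoid n π r) id
    (fun _ _ h => ⟨h.1, h.2.1, fun f hf i hi => h.2.2 f hf i (hi.trans hr)⟩) y

/-- A representative section of a jet. -/
def Jet.rep (y : Jet n π m) : ℝ → E := (Quotient.out (s := jetSetoid n π m) y).toFun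

/-- The natural coordinates `(t, q_0, …, q_m)` on `J^m π` induced by coordinates `e = (t, q)` on
`E` (meaningful over the domain of `e`): `q_i` is the `i`-th derivative at `t` of the component `q`
of a representative section. -/
def jetCoord (e : OpenPartialHomeomorph E (ℝ × (Fin n → ℝ))) (y : Jet n π m) : JetCoord n m :=
  (y.time, fun i => iteratedDeriv i (fun s => (e (y.rep s)).2) y.time)

theorem Jet.rep_isLocalSection (y : Jet n π m) : IsLocalSection n π y.rep y.time := by
  have h := (Quotient.out (s := jetSetoid n π m) y).isLocalSection
  have : y.time = (Quotient.out (s := jetSetoid n π m) y).time := by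
    conv_lhs => rw [← Quotient.out_eq (s := jetSetoid n π m) y]
    rfl
  rw [this]; exact h

theorem Jet.mk_rep (y : Jet n π m) : Jet.mk m y.rep y.time y.rep_isLocalSection = y := by
  have h := Quotient.out_eq (s := jetSetoid n π m) y
  have ht : y.time = (Quotient.out (s := jetSetoid n π m) y).time := by
    conv_lhs => rw [← h]
    rfl
  have key : ∀ (a : PointedSection n π) (t : ℝ) (_ : t = a.time)
      (hs : IsLocalSection n π a.toFun t), (⟨t, a.toFun, hs⟩ : PointedSection n π) = a := by
    rintro ⟨t', φ, h'⟩ t ht hs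
    cases ht
    rfl
  exact (congrArg (Quotient.mk (jetSetoid n π m)) (key _ _ ht y.rep_isLocalSection)).trans h

theorem Jet.mk_eq_mk_iff {φ ψ : ℝ → E} {t u : ℝ} {h : IsLocalSection n π φ t}
    {h' : IsLocalSection n π ψ u} :
    Jet.mk m φ t h = Jet.mk m ψ u h' ↔ t = u ∧ φ t = ψ u ∧
      ∀ f : E → ℝ, ContMDiffAt (𝓡 (n + 1)) 𝓘(ℝ, ℝ) ∞ f (φ t) →
        ∀ i ≤ m, iteratedDeriv i (fun s => f (φ s)) t = iteratedDeriv i (fun s => f (ψ s)) u :=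
  Quotient.eq (r := jetSetoid n π m)

theorem Jet.ind {p : Jet n π m → Prop} (h : ∀ φ t (hs : IsLocalSection n π φ t), p (.mk m φ t hs))
    (y : Jet n π m) : p y := by
  rw [← y.mk_rep]; exact h _ _ _

@[simp] theorem Jet.base_mk {φ : ℝ → E} {t : ℝ} (h : IsLocalSection n π φ t) :
    (Jet.mk m φ t h).base = φ t := rfl

@[simp] theorem Jet.time_mk {φ : ℝ → E} {t : ℝ} (h : IsLocalSection n π φ t) :
    (Jet.mk m φ t h).time = t := rfl

@[simp] theorem Jet.proj_mk {r : ℕ} (hr : r ≤ m) {φ : ℝ → E} {t : ℝ}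
    (h : IsLocalSection n π φ t) : (Jet.mk m φ t h).proj hr = Jet.mk r φ t h := rfl

@[simp] theorem Jet.base_proj {r : ℕ} (hr : r ≤ m) (y : Jet n π m) :
    (y.proj hr).base = y.base := by
  induction y using Jet.ind with | h φ t hs => rfl

theorem IsLocalSection.contMDiffAt {φ : ℝ → E} {t : ℝ} (h : IsLocalSection n π φ t) :
    ContMDiffAt 𝓘(ℝ, ℝ) (𝓡 (n + 1)) ∞ φ t := h.self_of_nhds.2

/-- The coordinate representation of a local section is smooth. -/
theorem IsLocalSection.contDiffAt_coord {φ : ℝ → E} {t : ℝ} (h : IsLocalSection n π φ t)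
    {e : OpenPartialHomeomorph E (ℝ × (Fin n → ℝ))} (he : IsAdapted n π e)
    (ht : φ t ∈ e.source) : ContDiffAt ℝ ∞ (fun s => (e (φ s)).2) t := by
  have h1 := (he.contMDiffOn.contMDiffAt (e.open_source.mem_nhds ht)).comp t h.contMDiffAt
  exact contDiffAt_snd.comp t h1.contDiffAt

theorem IsLocalSection.eventually_coord {φ : ℝ → E} {t : ℝ} (h : IsLocalSection n π φ t)
    {e : OpenPartialHomeomorph E (ℝ × (Fin n → ℝ))} (he : IsAdapted n π e)
    (ht : φ t ∈ e.source) : ∀ᶠ s in 𝓝 t, φ s = e.symm (s, (e (φ s)).2) := by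
  have h1 : ∀ᶠ s in 𝓝 t, φ s ∈ e.source :=
    h.contMDiffAt.continuousAt.eventually (e.open_source.mem_nhds ht)
  filter_upwards [h, h1] with s hs hs'
  have : (s, (e (φ s)).2) = e (φ s) := Prod.ext (by rw [he.fst_eq _ hs', hs.1]) rfl
  rw [this, e.left_inv hs']

theorem IsLocalSection.coord_eq {φ : ℝ → E} {t : ℝ} (h : IsLocalSection n π φ t)
    {e : OpenPartialHomeomorph E (ℝ × (Fin n → ℝ))} (he : IsAdapted n π e)
    (ht : φ t ∈ e.source) : e (φ t) = (t, (e (φ t)).2) :=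
  Prod.ext ((he.fst_eq _ ht).trans h.self_of_nhds.1) rfl

theorem iteratedDeriv_apply_pi {c : ℝ → Fin n → ℝ} {t : ℝ} (hc : ContDiffAt ℝ ∞ c t) (i : ℕ)
    (A : Fin n) : iteratedDeriv i c t A = iteratedDeriv i (fun s => c s A) t := by
  have := (ContinuousLinearMap.proj (R := ℝ) (φ := fun _ : Fin n => ℝ) A).iteratedFDeriv_comp_left
    hc (i := i) (by exact_mod_cast le_top)
  exact (congrArg (fun M => M fun _ => 1) this).symm

theorem jetCoord_mk {φ : ℝ → E} {t : ℝ} (h : IsLocalSection n π φ t)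
    {e : OpenPartialHomeomorph E (ℝ × (Fin n → ℝ))} (he : IsAdapted n π e)
    (ht : φ t ∈ e.source) :
    jetCoord e (Jet.mk m φ t h) = (t, fun i : Fin (m + 1) => iteratedDeriv i (fun s => (e (φ s)).2) t) := by
  set y := Jet.mk m φ t h with hy
  have hrep := Jet.mk_eq_mk_iff.1 (y.mk_rep.trans hy)
  have hbase : y.rep y.time ∈ e.source := by rw [hrep.2.1]; exact ht
  refine Prod.ext hrep.1 (funext fun i => funext fun A => ?_)
  change iteratedDeriv i (fun s => (e (y.rep s)).2) y.time A
    = iteratedDeriv i (fun s => (e (φ s)).2) t A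
  rw [iteratedDeriv_apply_pi (y.rep_isLocalSection.contDiffAt_coord he hbase),
    iteratedDeriv_apply_pi (h.contDiffAt_coord he ht)]
  refine hrep.2.2 (fun x => (e x).2 A) ?_ i (by omega)
  have h1 := he.contMDiffOn.contMDiffAt (e.open_source.mem_nhds hbase)
  have h2 : ContDiff ℝ ∞ (fun z : ℝ × (Fin n → ℝ) => z.2 A) := by fun_prop
  exact h2.contMDiff.contMDiffAt.comp _ h1

theorem jetCoord_injOn {e : OpenPartialHomeomorph E (ℝ × (Fin n → ℝ))} (he : IsAdapted n π e)
    {y y' : Jet n π m} (hy : y.base ∈ e.source) (hy' : y'.base ∈ e.source)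
    (h : jetCoord e y = jetCoord e y') : y = y' := by
  induction y using Jet.ind with | h φ t hs =>
  induction y' using Jet.ind with | h ψ u hu =>
  rw [jetCoord_mk hs he hy, jetCoord_mk hu he hy'] at h
  obtain ⟨rfl, h2⟩ := Prod.mk.inj h
  have hd : ∀ j ≤ m, iteratedDeriv j (fun s => (e (φ s)).2) t
      = iteratedDeriv j (fun s => (e (ψ s)).2) t := fun j hj =>
    congrFun h2 ⟨j, by omega⟩
  have e1 := hs.eventually_coord he hy
  have e2 := hu.eventually_coord he hy'
  have h0 : (e (φ t)).2 = (e (ψ t)).2 := by simpa using hd 0 (Nat.zero_le _)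
  have hval : φ t = ψ t := by rw [e1.self_of_nhds, e2.self_of_nhds, h0]
  refine Jet.mk_eq_mk_iff.2 ⟨rfl, hval, fun f hf i hi => ?_⟩
  have hmem : (t, (e (φ t)).2) = e (φ t) := (hs.coord_eq he hy).symm
  have hg : ContDiffAt ℝ ∞ (fun z => f (e.symm z)) (t, (e (φ t)).2) := by
    rw [hmem]
    have h1 := he.contMDiffOn_symm.contMDiffAt (e.open_target.mem_nhds (e.map_source hy))
    have h2 : ContMDiffAt (𝓡 (n + 1)) 𝓘(ℝ, ℝ) ∞ f (e.symm (e (φ t))) := by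
      rw [e.left_inv (x := φ t) hy]; exact hf
    exact (h2.comp _ h1).contDiffAt
  have := iteratedDeriv_comp_congr hg (hs.contDiffAt_coord he hy) (hu.contDiffAt_coord he hy') hd hi
  rw [Filter.EventuallyEq.iteratedDeriv_eq (f := fun s => f (φ s)) i
      (e1.mono fun s hs' => congrArg f hs'),
    Filter.EventuallyEq.iteratedDeriv_eq (f := fun s => f (ψ s)) i
      (e2.mono fun s hs' => congrArg f hs')]
  exact this

/-- The polynomial curve with prescribed derivatives `q_0, …, q_m` at time `t`. -/
def taylorCurve (z : JetCoord n m) (s : ℝ) : Fin n → ℝ :=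
  ∑ j : Fin (m + 1), ((s - z.1) ^ (j : ℕ) / ((j : ℕ).factorial : ℝ)) • z.2 j

theorem iteratedDeriv_taylorCurve (z : JetCoord n m) (i : Fin (m + 1)) :
    iteratedDeriv i (taylorCurve z) z.1 = z.2 i := iteratedDeriv_taylor z.1 z.2 i

theorem taylorCurve_self (z : JetCoord n m) : taylorCurve z z.1 = z.2 0 := by
  simpa using iteratedDeriv_taylorCurve z 0

theorem contDiff_taylorCurve :
    ContDiff ℝ ∞ (fun x : JetCoord n m × ℝ => taylorCurve x.1 x.2) := by
  unfold taylorCurve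
  fun_prop

theorem contDiff_taylorCurve_right (z : JetCoord n m) : ContDiff ℝ ∞ (taylorCurve z) :=
  contDiff_taylorCurve.comp (contDiff_const.prodMk contDiff_id)

theorem isLocalSection_taylor {e : OpenPartialHomeomorph E (ℝ × (Fin n → ℝ))}
    (he : IsAdapted n π e) (z : JetCoord n m) (hz : (z.1, z.2 0) ∈ e.target) :
    IsLocalSection n π (fun s => e.symm (s, taylorCurve z s)) z.1 := by
  have hc : ContDiff ℝ ∞ (fun s => (s, taylorCurve z s)) :=
    contDiff_id.prodMk (contDiff_taylorCurve_right z)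
  have h1 : ∀ᶠ s in 𝓝 z.1, (s, taylorCurve z s) ∈ e.target := by
    refine hc.continuous.continuousAt.eventually (e.open_target.mem_nhds ?_)
    simp only [taylorCurve_self]; exact hz
  filter_upwards [h1] with s hs
  refine ⟨?_, (he.contMDiffOn_symm.contMDiffAt (e.open_target.mem_nhds hs)).comp s
    hc.contMDiff.contMDiffAt⟩
  rw [← he.fst_eq _ (e.map_target hs), e.right_inv hs]

variable (n π) in
theorem nonempty_jet [IsFibredOverLine n π] (m : ℕ) : Nonempty (Jet n π m) := by
  obtain ⟨x, -⟩ := IsFibredOverLine.surjective (n := n) (π := π) 0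
  have hx := mem_adaptedChartAt_source n π x
  have he := isAdapted_adaptedChartAt n π x
  let z : JetCoord n m := ((adaptedChartAt n π x x).1, fun _ => (adaptedChartAt n π x x).2)
  exact ⟨Jet.mk m _ _ (isLocalSection_taylor he z ((adaptedChartAt n π x).map_source hx))⟩

open Classical in
/-- The jet with prescribed natural coordinates. -/
def jetOfCoord [IsFibredOverLine n π] {e : OpenPartialHomeomorph E (ℝ × (Fin n → ℝ))}
    (he : IsAdapted n π e) (z : JetCoord n m) : Jet n π m :=
  if hz : (z.1, z.2 0) ∈ e.target then Jet.mk m _ _ (isLocalSection_taylor he z hz)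
  else (nonempty_jet n π m).some

theorem jetOfCoord_of_mem [IsFibredOverLine n π] {e : OpenPartialHomeomorph E (ℝ × (Fin n → ℝ))}
    (he : IsAdapted n π e) {z : JetCoord n m} (hz : (z.1, z.2 0) ∈ e.target) :
    jetOfCoord he z = Jet.mk m _ _ (isLocalSection_taylor he z hz) := dif_pos hz

theorem base_jetOfCoord [IsFibredOverLine n π] {e : OpenPartialHomeomorph E (ℝ × (Fin n → ℝ))}
    (he : IsAdapted n π e) {z : JetCoord n m} (hz : (z.1, z.2 0) ∈ e.target) :
    (jetOfCoord he z).base = e.symm (z.1, z.2 0) := by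
  rw [jetOfCoord_of_mem he hz, Jet.base_mk, taylorCurve_self]

/-- In the coordinates `e'`, the jet with natural coordinates `z` for `e`. -/
theorem jetCoord_jetOfCoord [IsFibredOverLine n π]
    {e e' : OpenPartialHomeomorph E (ℝ × (Fin n → ℝ))}
    (he : IsAdapted n π e) (he' : IsAdapted n π e') {z : JetCoord n m}
    (hz : (z.1, z.2 0) ∈ e.target) (hz' : e.symm (z.1, z.2 0) ∈ e'.source) :
    jetCoord e' (jetOfCoord he z)
      = (z.1, fun i : Fin (m + 1) => iteratedDeriv i (fun s => (e' (e.symm (s, taylorCurve z s))).2) z.1) := by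
  rw [jetOfCoord_of_mem he hz]
  exact jetCoord_mk _ he' (by rw [taylorCurve_self]; exact hz')

theorem jetCoord_jetOfCoord_self [IsFibredOverLine n π]
    {e : OpenPartialHomeomorph E (ℝ × (Fin n → ℝ))}
    (he : IsAdapted n π e) {z : JetCoord n m}
    (hz : (z.1, z.2 0) ∈ e.target) : jetCoord e (jetOfCoord he z) = z := by
  rw [jetCoord_jetOfCoord he he hz (e.map_target hz)]
  refine Prod.ext rfl (funext fun i => ?_)
  have h1 : ∀ᶠ s in 𝓝 z.1, (s, taylorCurve z s) ∈ e.target := by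
    refine (continuous_id.prodMk (contDiff_taylorCurve_right z).continuous).continuousAt.eventually
      (e.open_target.mem_nhds ?_)
    simp only [id, taylorCurve_self]; exact hz
  have h2 : (fun s => (e (e.symm (s, taylorCurve z s))).2) =ᶠ[𝓝 z.1] taylorCurve z :=
    h1.mono fun s hs => by simp only [e.right_inv hs]
  exact (h2.iteratedDeriv_eq i).trans (iteratedDeriv_taylorCurve z i)

/-- The natural chart of `J^m π` induced by adapted coordinates on `E`. -/
def jetPartialEquiv [IsFibredOverLine n π] (m : ℕ)
    {e : OpenPartialHomeomorph E (ℝ × (Fin n → ℝ))}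
    (he : IsAdapted n π e) : PartialEquiv (Jet n π m) (JetCoord n m) where
  toFun := jetCoord e
  invFun := jetOfCoord he
  source := {y | y.base ∈ e.source}
  target := {z | (z.1, z.2 0) ∈ e.target}
  map_source' y hy := by
    induction y using Jet.ind with | h φ t hs =>
    rw [jetCoord_mk hs he hy]
    have := hs.coord_eq he hy
    have h2 := e.map_source hy
    rw [Jet.base_mk, this] at h2
    simpa using h2
  map_target' z hz := by
    change (jetOfCoord he z).base ∈ e.source
    rw [base_jetOfCoord he hz]; exact e.map_target hz
  left_inv' y hy := by
    have hz : ((jetCoord e y).1, (jetCoord e y).2 0) ∈ e.target := by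
      induction y using Jet.ind with | h φ t hs =>
      rw [jetCoord_mk hs he hy]
      have := hs.coord_eq he hy
      have h2 := e.map_source hy
      rw [Jet.base_mk, this] at h2
      simpa using h2
    refine jetCoord_injOn he ?_ hy (jetCoord_jetOfCoord_self he hz)
    rw [base_jetOfCoord he hz]; exact e.map_target hz
  right_inv' z hz := jetCoord_jetOfCoord_self he hz

theorem isOpen_jet_transition {e e' : OpenPartialHomeomorph E (ℝ × (Fin n → ℝ))} (m : ℕ) :
    IsOpen {z : JetCoord n m | (z.1, z.2 0) ∈ e.target ∧ e.symm (z.1, z.2 0) ∈ e'.source} := by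
  have h : Continuous (fun z : JetCoord n m => (z.1, z.2 0)) := by fun_prop
  exact (e.isOpen_inter_preimage_symm e'.open_source).preimage h

theorem jetPartialEquiv_trans_source [IsFibredOverLine n π]
    {e e' : OpenPartialHomeomorph E (ℝ × (Fin n → ℝ))}
    (he : IsAdapted n π e) (he' : IsAdapted n π e') :
    ((jetPartialEquiv m he).symm.trans (jetPartialEquiv m he')).source
      = {z : JetCoord n m | (z.1, z.2 0) ∈ e.target ∧ e.symm (z.1, z.2 0) ∈ e'.source} := by
  ext z
  rw [PartialEquiv.trans_source]
  refine and_congr_right fun hz => ?_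
  change (jetOfCoord he z).base ∈ e'.source ↔ _
  rw [base_jetOfCoord he hz]

theorem contDiffOn_jet_transition [IsFibredOverLine n π]
    {e e' : OpenPartialHomeomorph E (ℝ × (Fin n → ℝ))}
    (he : IsAdapted n π e) (he' : IsAdapted n π e') :
    ContDiffOn ℝ ∞ (fun z : JetCoord n m => jetCoord e' (jetOfCoord he z))
      {z | (z.1, z.2 0) ∈ e.target ∧ e.symm (z.1, z.2 0) ∈ e'.source} := by
  have hD : IsOpen (e.target ∩ e.symm ⁻¹' e'.source) :=
    e.isOpen_inter_preimage_symm e'.open_source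
  have hτ0 : ContMDiffOn 𝓘(ℝ, ℝ × (Fin n → ℝ)) 𝓘(ℝ, ℝ × (Fin n → ℝ)) ∞ (e' ∘ e.symm)
      (e.target ∩ e.symm ⁻¹' e'.source) :=
    he'.contMDiffOn.comp (he.contMDiffOn_symm.mono inter_subset_left) fun z hz => hz.2
  have hτ : ContDiffOn ℝ ∞ (fun z => (e' (e.symm z)).2) (e.target ∩ e.symm ⁻¹' e'.source) :=
    contDiff_snd.comp_contDiffOn hτ0.contDiffOn
  have hc : ContDiff ℝ ∞ (fun x : JetCoord n m × ℝ => (x.2, taylorCurve x.1 x.2)) :=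
    contDiff_snd.prodMk contDiff_taylorCurve
  have hG : ContDiffOn ℝ ∞
      (fun x : JetCoord n m × ℝ => (e' (e.symm (x.2, taylorCurve x.1 x.2))).2)
      ((fun x : JetCoord n m × ℝ => (x.2, taylorCurve x.1 x.2)) ⁻¹'
        (e.target ∩ e.symm ⁻¹' e'.source)) :=
    hτ.comp hc.contDiffOn fun x hx => hx
  have hi : ∀ i : Fin (m + 1), ContDiffOn ℝ ∞ (fun z : JetCoord n m =>
      iteratedDeriv i (fun s => (e' (e.symm (s, taylorCurve z s))).2) z.1)
      {z | (z.1, z.2 0) ∈ e.target ∧ e.symm (z.1, z.2 0) ∈ e'.source} := by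
    intro i
    refine contDiffOn_iteratedDeriv_diag
      (G := fun x : JetCoord n m × ℝ => (e' (e.symm (x.2, taylorCurve x.1 x.2))).2)
      (hD.preimage hc.continuous) hG i contDiff_fst fun z hz => ?_
    simp only [mem_preimage, taylorCurve_self]
    exact hz
  refine (contDiffOn_fst.prodMk (contDiffOn_pi.2 hi)).congr fun z hz => ?_
  exact jetCoord_jetOfCoord he he' hz.1 hz.2

variable (n π) in
/-- The natural atlas of `J^m π`. -/
def jetChartedSpaceCore [IsFibredOverLine n π] (m : ℕ) :
    ChartedSpaceCore (JetCoord n m) (Jet n π m) where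
  atlas := {f | ∃ (e : OpenPartialHomeomorph E (ℝ × (Fin n → ℝ))) (he : IsAdapted n π e),
    f = jetPartialEquiv m he}
  chartAt y := jetPartialEquiv m (isAdapted_adaptedChartAt n π y.base)
  mem_chart_source y := mem_adaptedChartAt_source n π y.base
  chart_mem_atlas _ := ⟨_, _, rfl⟩
  open_source := by
    rintro _ _ ⟨e, he, rfl⟩ ⟨e', he', rfl⟩
    rw [jetPartialEquiv_trans_source]
    exact isOpen_jet_transition m
  continuousOn_toFun := by
    rintro _ _ ⟨e, he, rfl⟩ ⟨e', he', rfl⟩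
    rw [jetPartialEquiv_trans_source]
    exact (contDiffOn_jet_transition he he').continuousOn

instance [IsFibredOverLine n π] : TopologicalSpace (Jet n π m) :=
  (jetChartedSpaceCore n π m).toTopologicalSpace

instance [IsFibredOverLine n π] : ChartedSpace (JetCoord n m) (Jet n π m) :=
  (jetChartedSpaceCore n π m).toChartedSpace

/-- The natural chart of `J^m π`, as an open partial homeomorphism. -/
def jetChart [IsFibredOverLine n π] (m : ℕ) {e : OpenPartialHomeomorph E (ℝ × (Fin n → ℝ))}
    (he : IsAdapted n π e) : OpenPartialHomeomorph (Jet n π m) (JetCoord n m) :=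
  (jetChartedSpaceCore n π m).openPartialHomeomorph (jetPartialEquiv m he) ⟨e, he, rfl⟩

theorem jetChart_mem_atlas [IsFibredOverLine n π]
    {e : OpenPartialHomeomorph E (ℝ × (Fin n → ℝ))} (he : IsAdapted n π e) :
    jetChart m he ∈ atlas (JetCoord n m) (Jet n π m) :=
  mem_iUnion₂.2 ⟨jetPartialEquiv m he, ⟨e, he, rfl⟩, rfl⟩

theorem chartAt_jet [IsFibredOverLine n π] (y : Jet n π m) :
    chartAt (JetCoord n m) y = jetChart m (isAdapted_adaptedChartAt n π y.base) := rfl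

instance [IsFibredOverLine n π] : IsManifold 𝓘(ℝ, JetCoord n m) ∞ (Jet n π m) := by
  refine isManifold_of_contDiffOn _ _ _ fun f f' hf hf' => ?_
  obtain ⟨_, ⟨e, he, rfl⟩, h⟩ := mem_iUnion₂.1 hf
  obtain ⟨_, ⟨e', he', rfl⟩, h'⟩ := mem_iUnion₂.1 hf'
  rw [mem_singleton_iff] at h h'
  subst h h'
  refine (contDiffOn_jet_transition (m := m) he he').mono fun z hz => ?_
  have hz' : z ∈ ((jetPartialEquiv m he).symm.trans (jetPartialEquiv m he')).source := hz.1
  rwa [jetPartialEquiv_trans_source] at hz'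

theorem jetCoord_proj {r : ℕ} (hr : r ≤ m) {e : OpenPartialHomeomorph E (ℝ × (Fin n → ℝ))}
    (he : IsAdapted n π e) {y : Jet n π m} (hy : y.base ∈ e.source) :
    jetCoord e (y.proj hr)
      = ((jetCoord e y).1, fun i => (jetCoord e y).2 (i.castLE (Nat.succ_le_succ hr))) := by
  induction y using Jet.ind with | h φ t hs =>
  rw [Jet.proj_mk, jetCoord_mk hs he hy, jetCoord_mk hs he hy]
  rfl

theorem contMDiff_jetProj [IsFibredOverLine n π] {r : ℕ} (hr : r ≤ m) :
    ContMDiff 𝓘(ℝ, JetCoord n m) 𝓘(ℝ, JetCoord n r) ∞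
      (Jet.proj hr : Jet n π m → Jet n π r) := by
  intro y
  have he := isAdapted_adaptedChartAt n π y.base
  set e := adaptedChartAt n π y.base
  have hsrc : y ∈ (jetChart m he).source := mem_adaptedChartAt_source n π y.base
  have hsrc' : y.proj hr ∈ (jetChart r he).source := by
    change (y.proj hr).base ∈ e.source
    rw [Jet.base_proj]; exact hsrc
  have hT : ContDiff ℝ ∞ (fun z : JetCoord n m =>
      ((z.1, fun i => z.2 (i.castLE (Nat.succ_le_succ hr))) : JetCoord n r)) := by fun_prop
  have h1 := contMDiffOn_of_mem_maximalAtlas (I := 𝓘(ℝ, JetCoord n m)) (n := ∞)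
    (IsManifold.subset_maximalAtlas (jetChart_mem_atlas (m := m) he))
  have h2 := contMDiffOn_symm_of_mem_maximalAtlas (I := 𝓘(ℝ, JetCoord n r)) (n := ∞)
    (IsManifold.subset_maximalAtlas (jetChart_mem_atlas (m := r) he))
  have h3 := hT.contMDiff.comp_contMDiffOn h1
  have hmaps : ∀ x ∈ (jetChart m he).source, x.proj hr ∈ (jetChart r he).source := fun x hx => by
    change (x.proj hr).base ∈ e.source
    rw [Jet.base_proj]; exact hx
  have hcoord : ∀ x ∈ (jetChart m he).source, (jetChart r he) (x.proj hr)
      = ((jetCoord e x).1, fun i => (jetCoord e x).2 (i.castLE (Nat.succ_le_succ hr))) :=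
    fun x hx => jetCoord_proj hr he hx
  have h4 := h2.comp h3 fun x hx => by
    have := (jetChart r he).map_source (hmaps x hx)
    rw [hcoord x hx] at this
    exact this
  refine (h4.congr fun x hx => ?_).contMDiffAt ((jetChart m he).open_source.mem_nhds hsrc)
  change _ = (jetChart r he).symm _
  exact ((jetChart r he).left_inv (hmaps x hx)).symm.trans
    (congrArg (jetChart r he).symm (hcoord x hx))

end Fibred

/-! ### Canonical forms of a cotangent bundle -/

section Canonical

/-- The exterior derivative of a one-form, `dθ(u, v) = u(θ(v)) - v(θ(u))`, computed in the preferred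
chart at the point. -/
def extDerivOneForm {F H M : Type*} [NormedAddCommGroup F] [NormedSpace ℝ F] [TopologicalSpace H]
    (I : ModelWithCorners ℝ F H) [TopologicalSpace M] [ChartedSpace H M]
    (θ : ∀ x : M, TangentSpace I x →L[ℝ] ℝ) (x : M) (u v : TangentSpace I x) : ℝ :=
  let θc : F → F →L[ℝ] ℝ := fun z =>
    (θ ((extChartAt I x).symm z)).comp (mfderiv 𝓘(ℝ, F) I (extChartAt I x).symm z)
  let dc : TangentSpace I x →L[ℝ] F := mfderiv I 𝓘(ℝ, F) (extChartAt I x) x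
  fderiv ℝ θc (extChartAt I x x) (dc u) (dc v) - fderiv ℝ θc (extChartAt I x x) (dc v) (dc u)

variable (F M : Type*) [NormedAddCommGroup F] [NormedSpace ℝ F] [TopologicalSpace M]
  [ChartedSpace F M] [IsManifold 𝓘(ℝ, F) ∞ M]

/-- The cotangent bundle `T^*M`. -/
abbrev CotangentBundle : Type _ :=
  Bundle.TotalSpace (F →L[ℝ] ℝ) (fun x : M => TangentSpace 𝓘(ℝ, F) x →L[ℝ] ℝ)

/-- The tautological one-form `Θ` on `T^*M`: `Θ_α(u) = α(T(T^*M → M) u)`. -/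
def tautologicalForm (α : CotangentBundle F M) :
    TangentSpace (𝓘(ℝ, F).prod 𝓘(ℝ, F →L[ℝ] ℝ)) α →L[ℝ] ℝ :=
  α.2.comp (mfderiv (𝓘(ℝ, F).prod 𝓘(ℝ, F →L[ℝ] ℝ)) 𝓘(ℝ, F)
    (Bundle.TotalSpace.proj : CotangentBundle F M → M) α)

/-- The canonical symplectic form `-dΘ` on `T^*M`. -/
def canonicalSymplecticForm (α : CotangentBundle F M)
    (u v : TangentSpace (𝓘(ℝ, F).prod 𝓘(ℝ, F →L[ℝ] ℝ)) α) : ℝ :=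
  -extDerivOneForm (𝓘(ℝ, F).prod 𝓘(ℝ, F →L[ℝ] ℝ)) (tautologicalForm F M) α u v

end Canonical

section Unified

variable (n : ℕ) {E : Type*} [TopologicalSpace E] [ChartedSpace (EuclideanSpace ℝ (Fin (n + 1))) E]
  (π : E → ℝ) [IsFibredOverLine n π] (k : ℕ)

/-- The projection `J^{2k-1} π → J^{k-1} π` as a smooth map. -/
def jetProjMap : C^∞⟮𝓘(ℝ, JetCoord n (2 * k - 1)), Jet n π (2 * k - 1);
    𝓘(ℝ, JetCoord n (k - 1)), Jet n π (k - 1)⟯ :=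
  ⟨Jet.proj (by omega), contMDiff_jetProj (by omega)⟩

/-- `W = J^{2k-1} π ×_{J^{k-1} π} T^*(J^{k-1} π)`. -/
abbrev Unified : Type _ :=
  Bundle.TotalSpace (JetCoord n (k - 1) →L[ℝ] ℝ)
    (Bundle.Pullback (jetProjMap n π k) fun q : Jet n π (k - 1) =>
      TangentSpace 𝓘(ℝ, JetCoord n (k - 1)) q →L[ℝ] ℝ)

/-- The model with corners of `W`. -/
abbrev unifiedModel : ModelWithCorners ℝ (JetCoord n (2 * k - 1) × (JetCoord n (k - 1) →L[ℝ] ℝ))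
    (ModelProd (JetCoord n (2 * k - 1)) (JetCoord n (k - 1) →L[ℝ] ℝ)) :=
  𝓘(ℝ, JetCoord n (2 * k - 1)).prod 𝓘(ℝ, JetCoord n (k - 1) →L[ℝ] ℝ)

variable {n π k}

/-- The projection `ρ₂ : W → T^*(J^{k-1} π)`. -/
def rho2 (w : Unified n π k) : CotangentBundle (JetCoord n (k - 1)) (Jet n π (k - 1)) :=
  Bundle.Pullback.lift (jetProjMap n π k) w

/-- `Ω = ρ₂^* Ω_{k-1}`. -/
def unifiedForm (w : Unified n π k) (u v : TangentSpace (unifiedModel n k) w) : ℝ :=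
  canonicalSymplecticForm (JetCoord n (k - 1)) (Jet n π (k - 1)) (rho2 w)
    (mfderiv (unifiedModel n k) (𝓘(ℝ, JetCoord n (k - 1)).prod 𝓘(ℝ, JetCoord n (k - 1) →L[ℝ] ℝ))
      rho2 w u)
    (mfderiv (unifiedModel n k) (𝓘(ℝ, JetCoord n (k - 1)).prod 𝓘(ℝ, JetCoord n (k - 1) →L[ℝ] ℝ))
      rho2 w v)

/-! ### The coupling function and the Hamiltonian submanifold -/

open Classical in
/-- The lift `j^m φ : ℝ → J^m π` of a section `φ`, with the dummy value `y₀` at the times around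
which `φ` is not a section. -/
def jetLift (m : ℕ) (φ : ℝ → E) (y₀ : Jet n π m) (t : ℝ) : Jet n π m :=
  if h : IsLocalSection n π φ t then Jet.mk m φ t h else y₀

theorem jetLift_rep {m r : ℕ} (hr : r ≤ m) (y : Jet n π m) :
    jetLift r y.rep (y.proj hr) y.time = y.proj hr := by
  rw [jetLift, dif_pos y.rep_isLocalSection, ← Jet.proj_mk hr, Jet.mk_rep]

/-- The total time derivative at `y = j^m_t φ`: the vector `T_t(j^r φ)(∂/∂t)`, which is tangent to
`J^r π` at `j^r_t φ` (see `jetLift_rep`). -/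
def totalDerivative {m r : ℕ} (hr : r ≤ m) (y : Jet n π m) :
    TangentSpace 𝓘(ℝ, JetCoord n r) (y.proj hr) :=
  mfderiv 𝓘(ℝ, ℝ) 𝓘(ℝ, JetCoord n r) (jetLift r y.rep (y.proj hr)) y.time (1 : ℝ)

/-- The covector on `J^{k-1} π` that is the second component of a point of `W`. -/
def covector (w : Unified n π k) :
    TangentSpace 𝓘(ℝ, JetCoord n (k - 1)) (w.1.proj (by omega : k - 1 ≤ 2 * k - 1)) →L[ℝ] ℝ :=
  w.2

/-- The coefficient `Ĉ` of the coupling one-form `Ĉ dt`: at `w = (y, α)` with `y = j^{2k-1}_t φ`,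
`Ĉ(w) = α(T_t(j^{k-1} φ)(∂/∂t))`. -/
def couplingFunction (w : Unified n π k) : ℝ :=
  covector w (totalDerivative (by omega) w.1)

/-- The projection `ρ_ℝ : W → ℝ`. -/
def rhoR (w : Unified n π k) : ℝ := w.1.time

/-- The constraint function `Ĉ - L̂`, where `L̂` is the pull-back to `W` of the Lagrangian function
`L : J^k π → ℝ`, the Lagrangian density being `L dt`. -/
def constraint (hk : 1 ≤ k) (L : Jet n π k → ℝ) (w : Unified n π k) : ℝ :=
  couplingFunction w - L (w.1.proj (by omega))

/-- The tangent space at `w` of the Hamiltonian submanifold `W_o = {Ĉ - L̂ = 0}` of `W`. -/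
def tangentWo (hk : 1 ≤ k) (L : Jet n π k → ℝ) (w : Unified n π k) :
    Submodule ℝ (TangentSpace (unifiedModel n k) w) :=
  LinearMap.ker (mfderiv (unifiedModel n k) 𝓘(ℝ, ℝ) (constraint hk L) w).toLinearMap

/-! ### The Legendre-Ostrogradsky map -/

/-- The total time derivative `d_T f = ∂f/∂t + ∑ q_{i+1}^A ∂f/∂q_i^A` of a function of
`(t, q_0, …, q_m)` that does not depend on `q_m`. -/
def dT {m : ℕ} (f : JetCoord n m → ℝ) (z : JetCoord n m) : ℝ :=
  fderiv ℝ f z (1, fun j : Fin (m + 1) => if h : (j : ℕ) + 1 < m + 1 then z.2 ⟨j + 1, h⟩ else 0)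

/-- The partial derivative `∂f/∂q_i^A`. -/
def partialQ {m : ℕ} (i : ℕ) (A : Fin n) (f : JetCoord n m → ℝ) (z : JetCoord n m) : ℝ :=
  fderiv ℝ f z (0, fun j : Fin (m + 1) => if (j : ℕ) = i then Pi.single A 1 else 0)

/-- The Lagrangian function, pulled back to `J^{2k-1} π`, in natural coordinates. -/
def localLagrangian (hk : 1 ≤ k) (L : Jet n π k → ℝ)
    {e : OpenPartialHomeomorph E (ℝ × (Fin n → ℝ))} (he : IsAdapted n π e)
    (z : JetCoord n (2 * k - 1)) : ℝ :=
  L ((jetOfCoord (m := 2 * k - 1) he z).proj (by omega))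

/-- The Jacobi-Ostrogradsky momenta
`p̂_A^r = ∑_{i = 0}^{k - r - 1} (-1)^i d_T^i (∂L/∂q_{r+1+i}^A)`, `0 ≤ r ≤ k - 1`, in natural
coordinates. -/
def momentum (hk : 1 ≤ k) (L : Jet n π k → ℝ)
    {e : OpenPartialHomeomorph E (ℝ × (Fin n → ℝ))} (he : IsAdapted n π e)
    (r : ℕ) (A : Fin n) (z : JetCoord n (2 * k - 1)) : ℝ :=
  ∑ i ∈ Finset.range (k - r),
    (-1 : ℝ) ^ i * (dT^[i] (partialQ (r + 1 + i) A (localLagrangian hk L he))) z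

/-- The coordinate `p̂ = L - ∑_r q_{r+1}^A p̂_A^r` of the extended Legendre-Ostrogradsky map. -/
def energyMomentum (hk : 1 ≤ k) (L : Jet n π k → ℝ)
    {e : OpenPartialHomeomorph E (ℝ × (Fin n → ℝ))} (he : IsAdapted n π e)
    (z : JetCoord n (2 * k - 1)) : ℝ :=
  localLagrangian hk L he z
    - ∑ r : Fin (k - 1 + 1), ∑ A, z.2 ⟨r + 1, by omega⟩ A * momentum hk L he r A z

/-- The extended Legendre-Ostrogradsky map `J^{2k-1} π → T^*(J^{k-1} π)`:
the covector `p̂ dt + p̂_A^r dq_r^A` at the projection of `y` to `J^{k-1} π`, computed in a system of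
natural coordinates around `y` (it does not depend on the coordinates). -/
def legendre (hk : 1 ≤ k) (L : Jet n π k → ℝ) (y : Jet n π (2 * k - 1)) :
    TangentSpace 𝓘(ℝ, JetCoord n (k - 1)) (jetProjMap n π k y) →L[ℝ] ℝ :=
  let e := adaptedChartAt n π y.base
  let he := isAdapted_adaptedChartAt n π y.base
  let z : JetCoord n (2 * k - 1) := jetCoord e y
  let dt : TangentSpace 𝓘(ℝ, JetCoord n (k - 1)) (jetProjMap n π k y) →L[ℝ] ℝ :=
    mfderiv 𝓘(ℝ, JetCoord n (k - 1)) 𝓘(ℝ, ℝ) (fun x : Jet n π (k - 1) => (jetCoord e x).1)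
      (jetProjMap n π k y)
  let dq : Fin (k - 1 + 1) → Fin n →
      TangentSpace 𝓘(ℝ, JetCoord n (k - 1)) (jetProjMap n π k y) →L[ℝ] ℝ := fun r A =>
    mfderiv 𝓘(ℝ, JetCoord n (k - 1)) 𝓘(ℝ, ℝ) (fun x : Jet n π (k - 1) => (jetCoord e x).2 r A)
      (jetProjMap n π k y)
  energyMomentum hk L he z • dt + ∑ r : Fin (k - 1 + 1), ∑ A : Fin n, momentum hk L he r A z • dq r A

/-- The restricted Legendre-Ostrogradsky map `J^{2k-1} π → J^{k-1} π^*`,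
`(t, q_0, …, q_{2k-1}) ↦ (t, q_0, …, q_{k-1}, p̂^0, …, p̂^{k-1})`, in natural coordinates. -/
def restrictedLegendreCoord (hk : 1 ≤ k) (L : Jet n π k → ℝ)
    {e : OpenPartialHomeomorph E (ℝ × (Fin n → ℝ))} (he : IsAdapted n π e)
    (z : JetCoord n (2 * k - 1)) : JetCoord n (k - 1) × (Fin (k - 1 + 1) → Fin n → ℝ) :=
  ((z.1, fun i => z.2 ⟨i, by omega⟩), fun r A => momentum hk L he r A z)

/-- The Lagrangian density `L dt` is regular: the restricted Legendre-Ostrogradsky map is a local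
diffeomorphism. -/
def IsRegularLagrangian (hk : 1 ≤ k) (L : Jet n π k → ℝ) : Prop :=
  ∀ (e : OpenPartialHomeomorph E (ℝ × (Fin n → ℝ))) (he : IsAdapted n π e)
    (y : Jet n π (2 * k - 1)), y.base ∈ e.source →
      IsLocalDiffeomorphAt 𝓘(ℝ, JetCoord n (2 * k - 1))
        𝓘(ℝ, JetCoord n (k - 1) × (Fin (k - 1 + 1) → Fin n → ℝ)) ∞
        (restrictedLegendreCoord hk L he) (jetCoord e y)

/-! ### The submanifold `W_1` and vector fields along it -/

/-- The map `y ↦ (y, FL~(y))` whose image is the graph `W_1` of the extended Legendre-Ostrogradsky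
map. -/
def legendreGraph (hk : 1 ≤ k) (L : Jet n π k → ℝ) (y : Jet n π (2 * k - 1)) : Unified n π k :=
  ⟨y, legendre hk L y⟩

/-- The submanifold `W_1` of `W`. -/
def W1 (hk : 1 ≤ k) (L : Jet n π k → ℝ) : Set (Unified n π k) := range (legendreGraph hk L)

/-- Vector fields on `W` along `W_1`, without any smoothness condition. -/
abbrev FieldAlongW1 (hk : 1 ≤ k) (L : Jet n π k → ℝ) : Type _ :=
  ∀ w : W1 hk L, TangentSpace (unifiedModel n k) (w : Unified n π k)

variable {hk : 1 ≤ k} {L : Jet n π k → ℝ}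

/-- Smoothness of a vector field along `W_1`; the submanifold `W_1` is parametrized by
`J^{2k-1} π`. -/
def FieldAlongW1.IsSmooth (X : FieldAlongW1 hk L) : Prop :=
  ContMDiff 𝓘(ℝ, JetCoord n (2 * k - 1)) (unifiedModel n k).tangent ∞
    (fun y => (⟨legendreGraph hk L y, X ⟨legendreGraph hk L y, mem_range_self y⟩⟩ :
      TangentBundle (unifiedModel n k) (Unified n π k)))

/-- `X` is a vector field on `W_o` (along `W_1`). -/
def FieldAlongW1.IsFieldOnWo (X : FieldAlongW1 hk L) : Prop :=
  ∀ w : W1 hk L, X w ∈ tangentWo hk L w.1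

/-- The dynamical equations along `W_1`: `i(X) Ω_o = 0`, where `Ω_o` is the restriction of `Ω` to
`W_o`, and `i(X) ρ_ℝ^* dt = 1`. -/
def FieldAlongW1.SolvesDynamicalEquations (X : FieldAlongW1 hk L) : Prop :=
  (∀ w : W1 hk L, ∀ u ∈ tangentWo hk L w.1, unifiedForm w.1 (X w) u = 0) ∧
  ∀ w : W1 hk L, mfderiv (unifiedModel n k) 𝓘(ℝ, ℝ) rhoR w.1 (X w) = (1 : ℝ)

/-- `X` is tangent to `W_1`. -/
def FieldAlongW1.IsTangentToW1 (X : FieldAlongW1 hk L) : Prop :=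
  ∀ y, ∃ v : TangentSpace 𝓘(ℝ, JetCoord n (2 * k - 1)) y,
    mfderiv 𝓘(ℝ, JetCoord n (2 * k - 1)) (unifiedModel n k) (legendreGraph hk L) y v
      = X ⟨legendreGraph hk L y, mem_range_self y⟩

/-- `ψ` is, on the open set `U ⊆ ℝ`, a section of `ρ_ℝ` that is an integral curve of `X`. -/
def FieldAlongW1.IsIntegralSection (X : FieldAlongW1 hk L) (ψ : ℝ → Unified n π k) (U : Set ℝ) :
    Prop :=
  ContMDiffOn 𝓘(ℝ, ℝ) (unifiedModel n k) ∞ ψ U ∧ (∀ t ∈ U, rhoR (ψ t) = t) ∧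
    ∀ t ∈ U, ∃ h : ψ t ∈ W1 hk L,
      mfderiv 𝓘(ℝ, ℝ) (unifiedModel n k) ψ t (1 : ℝ) = X ⟨ψ t, h⟩

/-- The section `ρ_1 ∘ ψ` of `J^{2k-1} π` is holonomic on `U`: it is the lift `j^{2k-1} φ` of its
projection `φ` to `E`. -/
def IsHolonomic (ψ : ℝ → Unified n π k) (U : Set ℝ) : Prop :=
  ∀ t ∈ U, ∃ h : IsLocalSection n π (fun s => (ψ s).1.base) t,
    (ψ t).1 = Jet.mk (2 * k - 1) (fun s => (ψ s).1.base) t h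

/-- `X` is a semispray of type `1`: all its (local) integral sections are holonomic. -/
def FieldAlongW1.IsSemisprayOfTypeOne (X : FieldAlongW1 hk L) : Prop :=
  ∀ (ψ : ℝ → Unified n π k) (U : Set ℝ), IsOpen U → X.IsIntegralSection ψ U → IsHolonomic ψ U

end Unified

end

/-! In natural coordinates let λ(z) = p̂ dt + p̂_A^r dq_r^A (`legendreCoord`), a form on J^{2k-1}π
with values in covectors of J^{k-1}π, and let h(z) be the total time derivative (`holonomicVector`).
Two identities carry the proof. The coefficient p̂ is chosen so that λ(h) = L
(`legendreCoord_holonomicVector`); this says that W_1 lies in W_o, and its derivative says that TW_1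
lies in TW_o. The momenta satisfy p̂^r + d_T p̂^{r+1} = ∂L/∂q_{r+1}, with p̂^k = 0
(`momentum_add_dT`).

A vector tangent to W_1 is (v, Dλ(v)), and Ω is dq ∧ dp in the chart of W. Pairing with all of TW_o
forces v to agree with h up to order k-1 and to annihilate dλ (`isDynamical_iff_constraint`). By the
recursion for the momenta this is a linear system for v whose matrix is the derivative of the
restricted Legendre map: q_r' = q_{r+1} for r < k, (p̂^0)' = ∂L/∂q_0, and (p̂^r)' = d_T p̂^r for r ≥
1 (`isDynamical_iff`). Regularity makes the matrix invertible, hence a unique, smooth solution.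

For the semispray property, h already solves every equation except the one for p̂^0. As p̂^r with r
≥ 1 does not involve q_{2k-1}, and the block ∂p̂^0/∂q_{2k-1} is invertible, a correction of h along
q_{2k-1} alone repairs that equation. By uniqueness this is v (`dynamicalField_holonomic`), so q_i'
= q_{i+1} for all i < 2k-1 along integral sections.

To pass from coordinates to the manifold, λ must not depend on the chart
(`legendreCoord_jetTransition`). By the first variation formula, the derivative of λ(j ξ) along a
section is dL(j ξ) plus a term of order zero in ξ. The difference of the forms λ of two charts
therefore has a derivative of order zero in ξ, which forces it to vanish on vertical vectors; on h
both forms give L. The solution v then transforms as a vector field because it is characterized by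
invariant conditions. -/

/-! ### Calculus in natural coordinates -/

section JetCoordCalculus

variable {n m : ℕ}

/-- The projection `(t, q_0, …, q_m) ↦ (t, q_0, …, q_r)`. -/
noncomputable def jetTrunc {r : ℕ} (hr : r ≤ m) : JetCoord n m →L[ℝ] JetCoord n r :=
  (ContinuousLinearMap.fst ℝ ℝ _).prod (ContinuousLinearMap.pi fun i : Fin (r + 1) =>
    (ContinuousLinearMap.proj (i.castLE (Nat.succ_le_succ hr))).comp (ContinuousLinearMap.snd ℝ ℝ _))

theorem jetTrunc_apply {r : ℕ} (hr : r ≤ m) (z : JetCoord n m) :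
    jetTrunc hr z = (z.1, fun i => z.2 (i.castLE (Nat.succ_le_succ hr))) := rfl

/-- The linear map `(t, q_0, …, q_m) ↦ (0, q_1, …, q_m, 0)`. -/
noncomputable def jetShift : JetCoord n m →L[ℝ] JetCoord n m :=
  (0 : JetCoord n m →L[ℝ] ℝ).prod (ContinuousLinearMap.pi fun j : Fin (m + 1) =>
    if h : (j : ℕ) + 1 < m + 1 then
      (ContinuousLinearMap.proj (⟨j + 1, h⟩ : Fin (m + 1))).comp (ContinuousLinearMap.snd ℝ ℝ _)
    else 0)

theorem jetShift_apply (z : JetCoord n m) : jetShift z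
    = (0, fun j : Fin (m + 1) => if h : (j : ℕ) + 1 < m + 1 then z.2 ⟨j + 1, h⟩ else 0) := by
  refine Prod.ext rfl (funext fun j => ?_)
  simp only [jetShift, ContinuousLinearMap.prod_apply, ContinuousLinearMap.pi_apply]
  split_ifs <;> rfl

/-- The vector `(1, q_1, …, q_m, 0)`: the total time derivative, up to order `m - 1`. -/
noncomputable def holonomicVector (z : JetCoord n m) : JetCoord n m :=
  (1, fun j : Fin (m + 1) => if h : (j : ℕ) + 1 < m + 1 then z.2 ⟨j + 1, h⟩ else 0)

/-- As an affine function of z the total derivative has `jetShift` as its derivative everywhere. -/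
theorem holonomicVector_eq (z : JetCoord n m) :
    holonomicVector z = ((1, 0) : JetCoord n m) + jetShift z := by
  rw [jetShift_apply]
  refine Prod.ext ?_ ?_ <;> simp [holonomicVector]

theorem hasFDerivAt_holonomicVector (z : JetCoord n m) :
    HasFDerivAt (holonomicVector : JetCoord n m → JetCoord n m) jetShift z := by
  have : (holonomicVector : JetCoord n m → JetCoord n m)
      = fun z => ((1, 0) : JetCoord n m) + jetShift z := funext holonomicVector_eq
  rw [this]
  exact jetShift.hasFDerivAt.const_add _

theorem contDiff_holonomicVector :
    ContDiff ℝ ∞ (holonomicVector : JetCoord n m → JetCoord n m) := by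
  have : (holonomicVector : JetCoord n m → JetCoord n m)
      = fun z => ((1, 0) : JetCoord n m) + jetShift z := funext holonomicVector_eq
  rw [this]
  exact contDiff_const.add jetShift.contDiff

theorem dT_eq (f : JetCoord n m → ℝ) (z : JetCoord n m) :
    dT f z = fderiv ℝ f z (holonomicVector z) := rfl

/-- The coordinate vector `∂/∂q_i^A`. -/
noncomputable def qDir (i : ℕ) (A : Fin n) : JetCoord n m :=
  (0, fun j : Fin (m + 1) => if (j : ℕ) = i then Pi.single A 1 else 0)

theorem partialQ_eq (i : ℕ) (A : Fin n) (f : JetCoord n m → ℝ) (z : JetCoord n m) :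
    partialQ i A f z = fderiv ℝ f z (qDir i A) := rfl

/-- Components are indexed by ℕ instead of `Fin (m + 1)`, so that shifts such as v (i + 1) and
changes of the order m need no casts. -/
theorem vertical_eq_sum (v : ℕ → Fin n → ℝ) :
    ((0, fun i => v i) : JetCoord n m)
      = ∑ i ∈ Finset.range (m + 1), ∑ A, v i A • qDir i A := by
  refine Prod.ext ?_ ?_
  · simp [Prod.fst_sum, qDir]
  · funext j B
    simp only [Prod.snd_sum, Finset.sum_apply, Prod.smul_snd, Pi.smul_apply, smul_eq_mul, qDir]
    rw [Finset.sum_eq_single (j : ℕ)]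
    · simp [Pi.single_apply]
    · intro i _ hi
      simp [Ne.symm hi]
    · intro h
      exact absurd (Finset.mem_range.2 j.2) h

theorem clm_vertical {G : Type*} [NormedAddCommGroup G] [NormedSpace ℝ G]
    (φ : JetCoord n m →L[ℝ] G) (v : ℕ → Fin n → ℝ) :
    φ (0, fun i => v i) = ∑ i ∈ Finset.range (m + 1), ∑ A, v i A • φ (qDir i A) := by
  rw [vertical_eq_sum]
  simp

theorem exists_nat_extension (v : Fin (m + 1) → Fin n → ℝ) :
    ∃ v' : ℕ → Fin n → ℝ, (fun i : Fin (m + 1) => v' i) = v :=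
  ⟨fun i => if h : i < m + 1 then v ⟨i, h⟩ else 0, funext fun i => dif_pos i.2⟩

theorem contDiffOn_partialQ {f : JetCoord n m → ℝ} {U : Set (JetCoord n m)} (hU : IsOpen U)
    (hf : ContDiffOn ℝ ∞ f U) (i : ℕ) (A : Fin n) : ContDiffOn ℝ ∞ (partialQ i A f) U :=
  (hf.fderiv_of_isOpen hU (m := ∞) (by simp)).clm_apply contDiffOn_const

theorem contDiffOn_dT {f : JetCoord n m → ℝ} {U : Set (JetCoord n m)} (hU : IsOpen U)
    (hf : ContDiffOn ℝ ∞ f U) : ContDiffOn ℝ ∞ (dT f) U :=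
  (hf.fderiv_of_isOpen hU (m := ∞) (by simp)).clm_apply contDiff_holonomicVector.contDiffOn

theorem contDiffOn_dT_iterate {f : JetCoord n m → ℝ} {U : Set (JetCoord n m)} (hU : IsOpen U)
    (hf : ContDiffOn ℝ ∞ f U) (i : ℕ) : ContDiffOn ℝ ∞ (dT^[i] f) U := by
  induction i with
  | zero => exact hf
  | succ i ih => rw [Function.iterate_succ_apply']; exact contDiffOn_dT hU ih

/-- `z` and `z'` have the same coordinates `(t, q_0, …, q_j)`. -/
def AgreeUpTo (j : ℕ) (z z' : JetCoord n m) : Prop :=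
  z.1 = z'.1 ∧ ∀ i : Fin (m + 1), (i : ℕ) ≤ j → z.2 i = z'.2 i

/-- The function `f` of `(t, q_0, …, q_m)` only depends on `(t, q_0, …, q_j)`. -/
def DependsUpTo (j : ℕ) (f : JetCoord n m → ℝ) : Prop :=
  ∀ z z', AgreeUpTo j z z' → f z = f z'

theorem DependsUpTo.mono {j j' : ℕ} {f : JetCoord n m → ℝ} (hf : DependsUpTo j f) (h : j ≤ j') :
    DependsUpTo j' f :=
  fun z z' hz => hf z z' ⟨hz.1, fun i hi => hz.2 i (hi.trans h)⟩

/-- f is invariant under the translation by z' - z, hence so is its derivative; no differentiability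
is needed. -/
theorem DependsUpTo.fderiv_eq {j : ℕ} {f : JetCoord n m → ℝ} (hf : DependsUpTo j f)
    {z z' : JetCoord n m} (h : AgreeUpTo j z z') : fderiv ℝ f z = fderiv ℝ f z' := by
  have h1 : (fun x => f (x + (z' - z))) = f := by
    funext x
    refine hf _ _ ⟨by simp [h.1], fun i hi => by simp [h.2 i hi]⟩
  have h2 := fderiv_comp_add_right (𝕜 := ℝ) (f := f) (x := z) (z' - z)
  rw [h1] at h2
  rw [h2]; congr 1; abel

/-- f is constant on the line through z in the direction v - v'. -/
theorem DependsUpTo.fderiv_apply_eq {j : ℕ} {f : JetCoord n m → ℝ} (hf : DependsUpTo j f)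
    (z : JetCoord n m) {v v' : JetCoord n m} (h : AgreeUpTo j v v') :
    fderiv ℝ f z v = fderiv ℝ f z v' := by
  by_cases hd : DifferentiableAt ℝ f z
  · rw [← sub_eq_zero, ← map_sub]
    have h1 : HasDerivAt (fun s : ℝ => f (z + s • (v - v'))) (fderiv ℝ f z (v - v')) 0 := by
      have hl : HasDerivAt (fun s : ℝ => z + s • (v - v')) (v - v') 0 := by
        simpa using ((hasDerivAt_id (0 : ℝ)).smul_const (v - v')).const_add z
      have hd' : HasFDerivAt f (fderiv ℝ f z) (z + (0 : ℝ) • (v - v')) := by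
        simpa using hd.hasFDerivAt
      exact hd'.comp_hasDerivAt (0 : ℝ) hl
    have h2 : (fun s : ℝ => f (z + s • (v - v'))) = fun _ => f z := by
      funext s
      refine hf _ _ ⟨by simp [h.1], fun i hi => by simp [h.2 i hi]⟩
    rw [h2] at h1
    exact h1.unique (hasDerivAt_const _ _)
  · simp [fderiv_zero_of_not_differentiableAt hd]

theorem DependsUpTo.partialQ {j : ℕ} {f : JetCoord n m → ℝ} (hf : DependsUpTo j f) (i : ℕ)
    (A : Fin n) : DependsUpTo j (partialQ i A f) := fun z z' h => by
  rw [partialQ_eq, partialQ_eq, hf.fderiv_eq h]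

theorem DependsUpTo.partialQ_eq_zero {j : ℕ} {f : JetCoord n m → ℝ} (hf : DependsUpTo j f) {i : ℕ}
    (hi : j < i) (A : Fin n) (z : JetCoord n m) : _root_.partialQ i A f z = 0 := by
  rw [partialQ_eq, hf.fderiv_apply_eq z (v' := 0), map_zero]
  exact ⟨rfl, fun l hl => by simp [qDir, show (l : ℕ) ≠ i by omega]⟩

theorem DependsUpTo.dT {j : ℕ} {f : JetCoord n m → ℝ} (hf : DependsUpTo j f) :
    DependsUpTo (j + 1) (dT f) := fun z z' h => by
  rw [dT_eq, dT_eq, hf.fderiv_eq (z := z) (z' := z') ⟨h.1, fun i hi => h.2 i (by omega)⟩]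
  refine hf.fderiv_apply_eq z' ⟨rfl, fun i hi => ?_⟩
  simp only [holonomicVector]
  -- In the last slot both vectors have entry 0 by convention, so no bound on j in terms of m is
  -- required.
  split_ifs with h1
  · exact h.2 ⟨i + 1, h1⟩ (by simpa using hi)
  · rfl

theorem DependsUpTo.dT_iterate {j : ℕ} {f : JetCoord n m → ℝ} (hf : DependsUpTo j f) (i : ℕ) :
    DependsUpTo (j + i) (_root_.dT^[i] f) := by
  induction i with
  | zero => exact hf
  | succ i ih => rw [Function.iterate_succ_apply']; exact ih.dT

theorem jetTrunc_eq_iff {r : ℕ} (hr : r ≤ m) {z z' : JetCoord n m} :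
    jetTrunc hr z = jetTrunc hr z' ↔ AgreeUpTo r z z' := by
  rw [jetTrunc_apply, jetTrunc_apply, Prod.mk.injEq]
  refine and_congr_right fun _ => ⟨fun h i hi => ?_, fun h => funext fun i => h _ ?_⟩
  · exact congrFun h ⟨i, by omega⟩
  · exact Nat.lt_succ_iff.1 i.2

/-- The curve `s ↦ (s, q(s), q'(s), …, q^(m)(s))`. -/
noncomputable def jetCurve (m : ℕ) (q : ℝ → Fin n → ℝ) (s : ℝ) : JetCoord n m :=
  (s, fun i => iteratedDeriv i q s)

theorem hasDerivAt_iteratedDeriv {F : Type*} [NormedAddCommGroup F] [NormedSpace ℝ F]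
    {q : ℝ → F} {s : ℝ} (hq : ContDiffAt ℝ ∞ q s) (i : ℕ) :
    HasDerivAt (iteratedDeriv i q) (iteratedDeriv (i + 1) q s) s := by
  rw [iteratedDeriv_succ]
  refine DifferentiableAt.hasDerivAt ?_
  have h := hq.differentiableAt_iteratedFDeriv (m := i)
    (by exact_mod_cast WithTop.coe_lt_top i)
  exact h.continuousMultilinear_apply_const fun _ => 1

theorem hasDerivAt_jetCurve {q : ℝ → Fin n → ℝ} {s : ℝ} (hq : ContDiffAt ℝ ∞ q s) :
    HasDerivAt (jetCurve m q) (1, fun i => iteratedDeriv (i + 1) q s) s :=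
  (hasDerivAt_id s).prodMk (hasDerivAt_pi.2 fun i => hasDerivAt_iteratedDeriv hq i)

/-- The velocity of the prolonged curve and `holonomicVector` differ only in the last slot, where
the latter has 0 in place of q^(m+1); since j < m, f does not see that slot. -/
theorem DependsUpTo.hasDerivAt_comp_jetCurve {j : ℕ} {f : JetCoord n m → ℝ} (hf : DependsUpTo j f)
    (hj : j < m) {q : ℝ → Fin n → ℝ} {s : ℝ} (hq : ContDiffAt ℝ ∞ q s)
    (hd : DifferentiableAt ℝ f (jetCurve m q s)) :
    HasDerivAt (fun s => f (jetCurve m q s)) (_root_.dT f (jetCurve m q s)) s := by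
  have := hd.hasFDerivAt.comp_hasDerivAt s (hasDerivAt_jetCurve hq)
  rw [dT_eq, hf.fderiv_apply_eq _ (v' := (1, fun i => iteratedDeriv (i + 1) q s))]
  · exact this
  · refine ⟨rfl, fun i hi => ?_⟩
    simp only [holonomicVector, jetCurve]
    rw [dif_pos (by omega)]

theorem jetTrunc_holonomicVector {m r : ℕ} (hr : r < m) (z : JetCoord n m) :
    jetTrunc hr.le (holonomicVector z) = ((1, fun i => z.2 ⟨i + 1, by omega⟩) : JetCoord n r) := by
  refine Prod.ext rfl (funext fun i => ?_)
  simp only [jetTrunc_apply, holonomicVector]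
  rw [dif_pos (by rw [Fin.val_castLE]; omega)]
  rfl

end JetCoordCalculus

/-! ### Momenta, Cartan form and first variation in one natural chart -/

section LocalMomenta

variable {n : ℕ} {E : Type*} [TopologicalSpace E] [ChartedSpace (EuclideanSpace ℝ (Fin (n + 1))) E]
  {π : E → ℝ} [IsFibredOverLine n π] {k : ℕ} {hk : 1 ≤ k} {L : Jet n π k → ℝ}
  {e : OpenPartialHomeomorph E (ℝ × (Fin n → ℝ))} (he : IsAdapted n π e)

/-- The range of the natural coordinates induced by `e`. -/
noncomputable def jetDomain (m : ℕ)
    (e : OpenPartialHomeomorph E (ℝ × (Fin n → ℝ))) : Set (JetCoord n m) :=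
  {z | (z.1, z.2 0) ∈ e.target}

theorem isOpen_jetDomain (m : ℕ) (e : OpenPartialHomeomorph E (ℝ × (Fin n → ℝ))) :
    IsOpen (jetDomain m e) := by
  have h : Continuous (fun z : JetCoord n m => (z.1, z.2 0)) := by fun_prop
  exact e.open_target.preimage h

theorem contMDiffOn_jetOfCoord {m : ℕ} :
    ContMDiffOn 𝓘(ℝ, JetCoord n m) 𝓘(ℝ, JetCoord n m) ∞ (jetOfCoord (m := m) he)
      (jetDomain m e) :=
  contMDiffOn_symm_of_mem_maximalAtlas (I := 𝓘(ℝ, JetCoord n m)) (n := ∞)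
    (IsManifold.subset_maximalAtlas (jetChart_mem_atlas (m := m) he))

theorem contDiffOn_localLagrangian (hL : ContMDiff 𝓘(ℝ, JetCoord n k) 𝓘(ℝ, ℝ) ∞ L) :
    ContDiffOn ℝ ∞ (localLagrangian hk L he) (jetDomain (2 * k - 1) e) :=
  ((hL.comp (contMDiff_jetProj (by omega))).comp_contMDiffOn
    (contMDiffOn_jetOfCoord he)).contDiffOn

theorem jetOfCoord_proj {m r : ℕ} (hr : r ≤ m) {z : JetCoord n m} (hz : z ∈ jetDomain m e) :
    (jetOfCoord he z).proj hr = jetOfCoord he (jetTrunc hr z) := by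
  have hz' : jetTrunc hr z ∈ jetDomain r e := hz
  have hb : (jetOfCoord he z).base ∈ e.source := by
    rw [base_jetOfCoord he hz]; exact e.map_target hz
  refine jetCoord_injOn he ?_ ?_ ?_
  · rw [Jet.base_proj]; exact hb
  · rw [base_jetOfCoord he hz']; exact e.map_target hz'
  · rw [jetCoord_proj hr he hb, jetCoord_jetOfCoord_self he hz', jetCoord_jetOfCoord_self he hz]
    rfl

/-- This is needed on the whole coordinate space, not only on the range of the chart, because the
derivative lemmas for `DependsUpTo` translate points freely. -/
theorem dependsUpTo_localLagrangian : DependsUpTo k (localLagrangian hk L he) := by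
  intro z z' h
  have h0 : z.2 0 = z'.2 0 := h.2 0 (Nat.zero_le _)
  unfold localLagrangian
  by_cases hz : z ∈ jetDomain (2 * k - 1) e
  · have hz' : z' ∈ jetDomain (2 * k - 1) e := by
      change (z'.1, z'.2 0) ∈ e.target; rw [← h.1, ← h0]; exact hz
    rw [jetOfCoord_proj he _ hz, jetOfCoord_proj he _ hz', (jetTrunc_eq_iff _).2 h]
  · have hz' : z' ∉ jetDomain (2 * k - 1) e := by
      change (z'.1, z'.2 0) ∉ e.target; rw [← h.1, ← h0]; exact hz
    have e1 : jetOfCoord (m := 2 * k - 1) he z = (nonempty_jet n π _).some := dif_neg hz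
    have e2 : jetOfCoord (m := 2 * k - 1) he z' = (nonempty_jet n π _).some := dif_neg hz'
    rw [e1, e2]

/-- The i-th summand has order at most k + i with i ≤ k - r - 1. In particular p̂^r with r ≥ 1 does
not involve the top coordinate q_{2k-1}. -/
theorem dependsUpTo_momentum (r : ℕ) (A : Fin n) :
    DependsUpTo (2 * k - 1 - r) (momentum hk L he r A) := by
  intro z z' h
  unfold momentum
  refine Finset.sum_congr rfl fun i hi => ?_
  congr 1
  refine (((dependsUpTo_localLagrangian he).partialQ _ A).dT_iterate i).mono ?_ z z' h
  have := Finset.mem_range.1 hi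
  omega

theorem contDiffOn_momentum (hL : ContMDiff 𝓘(ℝ, JetCoord n k) 𝓘(ℝ, ℝ) ∞ L) (r : ℕ) (A : Fin n) :
    ContDiffOn ℝ ∞ (momentum hk L he r A) (jetDomain (2 * k - 1) e) := by
  unfold momentum
  refine ContDiffOn.sum fun i _ => contDiffOn_const.mul ?_
  exact contDiffOn_dT_iterate (isOpen_jetDomain _ e)
    (contDiffOn_partialQ (isOpen_jetDomain _ e) (contDiffOn_localLagrangian he hL) _ A) i

/-- The convention p̂^k = 0 closes the recursion of `momentum_add_dT` at its top step r = k - 1. -/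
theorem momentum_eq_zero {r : ℕ} (hr : k ≤ r) (A : Fin n) : momentum hk L he r A = 0 := by
  funext z
  simp [momentum, Nat.sub_eq_zero_of_le hr]

/-- Applying d_T to p̂^{r+1} reproduces, with the opposite sign, all the terms of p̂^r except the
one with i = 0. -/
theorem momentum_add_dT (hL : ContMDiff 𝓘(ℝ, JetCoord n k) 𝓘(ℝ, ℝ) ∞ L) {r : ℕ} (hr : r < k)
    (A : Fin n) {z : JetCoord n (2 * k - 1)} (hz : z ∈ jetDomain (2 * k - 1) e) :
    momentum hk L he r A z + dT (momentum hk L he (r + 1) A) z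
      = partialQ (r + 1) A (localLagrangian hk L he) z := by
  have hU := isOpen_jetDomain (2 * k - 1) e
  have h1 : dT (momentum hk L he (r + 1) A) z = ∑ i ∈ Finset.range (k - (r + 1)),
      (-1 : ℝ) ^ i * (dT^[i + 1] (partialQ (r + 1 + 1 + i) A (localLagrangian hk L he))) z := by
    have hd : ∀ i, DifferentiableAt ℝ
        (dT^[i] (partialQ (r + 1 + 1 + i) A (localLagrangian hk L he))) z := fun i =>
      ((contDiffOn_dT_iterate hU (contDiffOn_partialQ hU
        (contDiffOn_localLagrangian he hL) _ A) i).contDiffAt (hU.mem_nhds hz)).differentiableAt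
          (by simp)
    have h2 : HasFDerivAt (momentum hk L he (r + 1) A) (∑ i ∈ Finset.range (k - (r + 1)),
        (-1 : ℝ) ^ i • fderiv ℝ (dT^[i] (partialQ (r + 1 + 1 + i) A (localLagrangian hk L he))) z)
        z := by
      unfold momentum
      exact HasFDerivAt.fun_sum fun i _ => (hd i).hasFDerivAt.const_mul _
    rw [dT_eq, h2.fderiv]
    simp only [sum_apply, smul_apply, smul_eq_mul]
    refine Finset.sum_congr rfl fun i _ => ?_
    rw [Function.iterate_succ_apply', dT_eq]
  rw [h1, momentum, show k - r = k - (r + 1) + 1 by omega, Finset.sum_range_succ']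
  simp only [pow_zero, one_mul, add_zero, Function.iterate_zero, id]
  rw [add_right_comm, ← Finset.sum_add_distrib, Finset.sum_eq_zero fun i _ => ?_, zero_add]
  rw [show r + 1 + (i + 1) = r + 1 + 1 + i by omega]
  ring

/-- The covector `p̂ dt + p̂_A^r dq_r^A` in natural coordinates. -/
noncomputable def legendreCoord (hk : 1 ≤ k) (L : Jet n π k → ℝ)
    {e : OpenPartialHomeomorph E (ℝ × (Fin n → ℝ))}
    (he : IsAdapted n π e) (z : JetCoord n (2 * k - 1)) : JetCoord n (k - 1) →L[ℝ] ℝ :=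
  energyMomentum hk L he z • ContinuousLinearMap.fst ℝ ℝ _
    + ∑ r : Fin (k - 1 + 1), ∑ A : Fin n, momentum hk L he r A z •
        (ContinuousLinearMap.proj A).comp
          ((ContinuousLinearMap.proj r).comp (ContinuousLinearMap.snd ℝ ℝ (Fin (k - 1 + 1) → Fin n → ℝ)))

theorem legendreCoord_apply (z : JetCoord n (2 * k - 1)) (v : JetCoord n (k - 1)) :
    legendreCoord hk L he z v = energyMomentum hk L he z * v.1
      + ∑ r : Fin (k - 1 + 1), ∑ A : Fin n, momentum hk L he r A z * v.2 r A := by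
  simp [legendreCoord]

theorem contDiffOn_legendreCoord (hL : ContMDiff 𝓘(ℝ, JetCoord n k) 𝓘(ℝ, ℝ) ∞ L) :
    ContDiffOn ℝ ∞ (legendreCoord hk L he) (jetDomain (2 * k - 1) e) := by
  unfold legendreCoord
  refine ContDiffOn.add (ContDiffOn.smul_const ?_ _)
    (ContDiffOn.sum fun r _ => ContDiffOn.sum fun A _ =>
      (contDiffOn_momentum he hL r A).smul_const _)
  unfold energyMomentum
  refine (contDiffOn_localLagrangian he hL).sub (ContDiffOn.sum fun r _ => ContDiffOn.sum fun A _ =>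
    ContDiffOn.mul ?_ (contDiffOn_momentum he hL r A))
  exact ContDiff.contDiffOn (by fun_prop)

theorem legendreCoord_vertical (z : JetCoord n (2 * k - 1)) (v : ℕ → Fin n → ℝ) :
    legendreCoord hk L he z (0, fun i => v i)
      = ∑ r ∈ Finset.range k, ∑ A, momentum hk L he r A z * v r A := by
  rw [legendreCoord_apply, Fin.sum_univ_eq_sum_range
    (fun r => ∑ A, momentum hk L he r A z * v r A), Nat.sub_add_cancel hk]
  simp

/-- The coefficient p̂ is defined precisely so that this holds; geometrically, Ĉ = L̂ on W_1. -/
theorem legendreCoord_holonomicVector (z : JetCoord n (2 * k - 1)) :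
    legendreCoord hk L he z (jetTrunc (by omega : k - 1 ≤ 2 * k - 1) (holonomicVector z))
      = localLagrangian hk L he z := by
  rw [jetTrunc_holonomicVector (by omega : k - 1 < 2 * k - 1), legendreCoord_apply, energyMomentum]
  simp only [mul_one]
  rw [sub_add_eq_add_sub, sub_eq_iff_eq_add]
  congr 1
  exact Finset.sum_congr rfl fun r _ => Finset.sum_congr rfl fun A _ => mul_comm _ _

/-- Only the derivatives with respect to q_0, …, q_k survive, and the recursion replaces each
∂L/∂q_{r+1} by p̂^r + d_T p̂^{r+1}. -/
theorem fderiv_localLagrangian_vertical (hL : ContMDiff 𝓘(ℝ, JetCoord n k) 𝓘(ℝ, ℝ) ∞ L)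
    {z : JetCoord n (2 * k - 1)} (hz : z ∈ jetDomain (2 * k - 1) e) (v : ℕ → Fin n → ℝ) :
    fderiv ℝ (localLagrangian hk L he) z (0, fun i => v i)
      = ∑ A, v 0 A * partialQ 0 A (localLagrangian hk L he) z
        + ∑ r ∈ Finset.range k, ∑ A, v (r + 1) A *
          (momentum hk L he r A z + dT (momentum hk L he (r + 1) A) z) := by
  rw [clm_vertical]
  have h1 : ∑ i ∈ Finset.range (2 * k - 1 + 1), ∑ A,
      v i A • fderiv ℝ (localLagrangian hk L he) z (qDir i A)
      = ∑ i ∈ Finset.range (k + 1), ∑ A,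
        v i A * partialQ i A (localLagrangian hk L he) z := by
    symm
    refine Finset.sum_subset (fun i hi => ?_) fun i _ hi => Finset.sum_eq_zero fun A _ => ?_
    · simp only [Finset.mem_range] at hi ⊢; omega
    · rw [(dependsUpTo_localLagrangian he).partialQ_eq_zero, mul_zero]
      simp only [Finset.mem_range] at hi; omega
  rw [h1, Finset.sum_range_succ', add_comm]
  congr 1
  refine Finset.sum_congr rfl fun r hr => Finset.sum_congr rfl fun A _ => ?_
  rw [momentum_add_dT he hL (Finset.mem_range.1 hr) A hz]

/-- First variation formula: along a section, the variation of the Lagrangian is, up to a term of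
order zero in the variation field, the time derivative of the contraction of the momenta with the
variation field. -/
theorem exists_firstVariation (hL : ContMDiff 𝓘(ℝ, JetCoord n k) 𝓘(ℝ, ℝ) ∞ L)
    {q : ℝ → Fin n → ℝ} {s : ℝ} (hq : ContDiffAt ℝ ∞ q s)
    (hs : jetCurve (2 * k - 1) q s ∈ jetDomain (2 * k - 1) e) :
    ∃ G : (Fin n → ℝ) →L[ℝ] ℝ, ∀ ξ : ℝ → Fin n → ℝ, ContDiffAt ℝ ∞ ξ s →
      HasDerivAt (fun s => legendreCoord hk L he (jetCurve (2 * k - 1) q s)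
          (0, fun i => iteratedDeriv i ξ s))
        (fderiv ℝ (localLagrangian hk L he) (jetCurve (2 * k - 1) q s)
          (0, fun i => iteratedDeriv i ξ s) + G (ξ s)) s := by
  have hU := isOpen_jetDomain (2 * k - 1) e
  set c := jetCurve (2 * k - 1) q
  have hd : ∀ r A, DifferentiableAt ℝ (momentum hk L he r A) (c s) := fun r A =>
    ((contDiffOn_momentum he hL r A).contDiffAt (hU.mem_nhds hs)).differentiableAt (by simp)
  have hp : ∀ r A, HasDerivAt (fun s => momentum hk L he (r + 1) A (c s))
      (dT (momentum hk L he (r + 1) A) (c s)) s := fun r A =>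
    (dependsUpTo_momentum he (r + 1) A).hasDerivAt_comp_jetCurve (by omega) hq (hd _ A)
  -- p̂^0 may depend on the top coordinate q_{2k-1}, so its derivative along the curve can involve
  -- q^(2k) and is not given by `dT`. It only enters the coefficient of ξ itself, where its value is
  -- irrelevant.
  have hp0 : ∀ A, HasDerivAt (fun s => momentum hk L he 0 A (c s))
      (deriv (fun s => momentum hk L he 0 A (c s)) s) s := fun A =>
    ((hd 0 A).comp s (hasDerivAt_jetCurve hq).differentiableAt).hasDerivAt
  -- G is minus the Euler-Lagrange expression along q.
  refine ⟨∑ A, (deriv (fun s => momentum hk L he 0 A (c s)) s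
    - partialQ 0 A (localLagrangian hk L he) (c s)) • ContinuousLinearMap.proj A, fun ξ hξ => ?_⟩
  have hξd : ∀ i A, HasDerivAt (fun s => iteratedDeriv i ξ s A) (iteratedDeriv (i + 1) ξ s A) s :=
    fun i A => hasDerivAt_pi.1 (hasDerivAt_iteratedDeriv hξ i) A
  -- The term r = 0 is split off, since only for r ≥ 1 is the derivative of p̂^r a total derivative.
  obtain ⟨K, rfl⟩ : ∃ K, k = K + 1 := ⟨k - 1, by omega⟩
  have hfun : (fun s => legendreCoord hk L he (c s) (0, fun i => iteratedDeriv i ξ s))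
      = fun s => (∑ r ∈ Finset.range K, ∑ A, momentum hk L he (r + 1) A (c s)
          * iteratedDeriv (r + 1) ξ s A)
        + ∑ A, momentum hk L he 0 A (c s) * iteratedDeriv 0 ξ s A := by
    funext s
    rw [legendreCoord_vertical he (c s) fun i => iteratedDeriv i ξ s, Finset.sum_range_succ']
  rw [hfun]
  have hder := (HasDerivAt.fun_sum fun r (_ : r ∈ Finset.range K) => HasDerivAt.fun_sum
    fun A (_ : A ∈ Finset.univ) => (hp r A).mul (hξd (r + 1) A)).add
    (HasDerivAt.fun_sum fun A (_ : A ∈ Finset.univ) => (hp0 A).mul (hξd 0 A))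
  refine hder.congr_deriv ?_
  rw [fderiv_localLagrangian_vertical he hL hs fun i => iteratedDeriv i ξ s]
  simp only [mul_add, Finset.sum_add_distrib]
  rw [Finset.sum_range_succ', Finset.sum_range_succ _ K]
  simp only [momentum_eq_zero he (le_refl (K + 1))]
  have h0 : ∀ z : JetCoord n (2 * (K + 1) - 1), dT (0 : JetCoord n (2 * (K + 1) - 1) → ℝ) z = 0 := by
    intro z; rw [dT_eq]; simp
  simp only [h0, mul_zero, Finset.sum_const_zero, add_zero]
  simp only [iteratedDeriv_zero, sum_apply,
    smul_apply, ContinuousLinearMap.proj_apply, smul_eq_mul, zero_add, mul_comm, mul_sub,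
    Finset.sum_sub_distrib]
  ring

end LocalMomenta

/-! ### Change of natural coordinates -/

section MixedPartials

variable {F : Type*} [NormedAddCommGroup F] [NormedSpace ℝ F]

theorem hasDerivAt_slice_right {G : ℝ × ℝ → F} {x : ℝ × ℝ} (h : DifferentiableAt ℝ G x) :
    HasDerivAt (fun s => G (x.1, s)) (fderiv ℝ G x (0, 1)) x.2 :=
  h.hasFDerivAt.comp_hasDerivAt x.2 ((hasDerivAt_const x.2 x.1).prodMk (hasDerivAt_id x.2))

theorem hasDerivAt_slice_left {G : ℝ × ℝ → F} {x : ℝ × ℝ} (h : DifferentiableAt ℝ G x) :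
    HasDerivAt (fun u => G (u, x.2)) (fderiv ℝ G x (1, 0)) x.1 :=
  h.hasFDerivAt.comp_hasDerivAt x.1 ((hasDerivAt_id x.1).prodMk (hasDerivAt_const x.1 x.2))

theorem fderiv_fderiv_apply_comm {V : Type*} [NormedAddCommGroup V] [NormedSpace ℝ V]
    {G : V → F} {x : V} (h : ContDiffAt ℝ ∞ G x) (v w : V) :
    fderiv ℝ (fun y => fderiv ℝ G y v) x w = fderiv ℝ (fun y => fderiv ℝ G y w) x v := by
  have hd : DifferentiableAt ℝ (fderiv ℝ G) x :=
    (h.fderiv_right (m := ∞) (by simp)).differentiableAt (by simp)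
  have e : ∀ a b : V, fderiv ℝ (fun y => fderiv ℝ G y a) x b = fderiv ℝ (fderiv ℝ G) x b a := by
    intro a b
    have := hd.hasFDerivAt.clm_apply (hasFDerivAt_const a x)
    rw [this.fderiv]; simp
  rw [e, e]
  exact (h.isSymmSndFDerivAt (by simp only [minSmoothness_of_isRCLikeNormedField]; exact ENat.LEInfty.out)).eq w v

/-- Derivatives with respect to a parameter commute with iterated derivatives. -/
theorem hasDerivAt_iteratedDeriv_param {Ω : Set (ℝ × ℝ)} (hΩ : IsOpen Ω) (i : ℕ)
    {G : ℝ × ℝ → F} (hG : ContDiffOn ℝ ∞ G Ω) {x : ℝ × ℝ} (hx : x ∈ Ω) :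
    HasDerivAt (fun u => iteratedDeriv i (fun s => G (u, s)) x.2)
      (iteratedDeriv i (fun s => fderiv ℝ G (x.1, s) (1, 0)) x.2) x.1 := by
  have hcd : ∀ {H : ℝ × ℝ → F}, ContDiffOn ℝ ∞ H Ω → ∀ {y}, y ∈ Ω → ContDiffAt ℝ ∞ H y :=
    fun hH _ hy => hH.contDiffAt (hΩ.mem_nhds hy)
  have hpart : ∀ {H : ℝ × ℝ → F}, ContDiffOn ℝ ∞ H Ω → ∀ v,
      ContDiffOn ℝ ∞ (fun y => fderiv ℝ H y v) Ω := fun hH v =>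
    (hH.fderiv_of_isOpen hΩ (m := ∞) (by simp)).clm_apply contDiffOn_const
  have hright : ∀ᶠ s in 𝓝 x.2, (x.1, s) ∈ Ω := by
    have : Continuous fun s : ℝ => (x.1, s) := by fun_prop
    exact this.continuousAt.eventually (hΩ.mem_nhds hx)
  have hleft : ∀ᶠ u in 𝓝 x.1, (u, x.2) ∈ Ω := by
    have : Continuous fun u : ℝ => (u, x.2) := by fun_prop
    exact this.continuousAt.eventually (hΩ.mem_nhds hx)
  induction i generalizing G with
  | zero => simpa using hasDerivAt_slice_left ((hcd hG hx).differentiableAt (by simp))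
  | succ i ih =>
    -- The induction runs on ∂G/∂s: the innermost s-derivative is peeled off and exchanged with the
    -- parameter derivative by symmetry of second derivatives.
    have h1 := ih (hpart hG (0, 1))
    have e1 : ∀ u, (u, x.2) ∈ Ω → iteratedDeriv (i + 1) (fun s => G (u, s)) x.2
        = iteratedDeriv i (fun s => fderiv ℝ G (u, s) (0, 1)) x.2 := by
      intro u hu
      rw [iteratedDeriv_succ']
      refine Filter.EventuallyEq.iteratedDeriv_eq i ?_
      have : Continuous fun s : ℝ => (u, s) := by fun_prop
      filter_upwards [this.continuousAt.eventually (hΩ.mem_nhds hu)] with s hs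
      exact (hasDerivAt_slice_right ((hcd hG hs).differentiableAt (by simp))).deriv
    have e2 : iteratedDeriv (i + 1) (fun s => fderiv ℝ G (x.1, s) (1, 0)) x.2
        = iteratedDeriv i (fun s => fderiv ℝ (fun y => fderiv ℝ G y (0, 1)) (x.1, s) (1, 0)) x.2 := by
      rw [iteratedDeriv_succ']
      refine Filter.EventuallyEq.iteratedDeriv_eq i ?_
      filter_upwards [hright] with s hs
      rw [fderiv_fderiv_apply_comm (hcd hG hs)]
      exact (hasDerivAt_slice_right (G := fun y => fderiv ℝ G y (1, 0))
        ((hcd (hpart hG (1, 0)) hs).differentiableAt (by simp))).deriv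
    rw [e2]
    exact h1.congr_of_eventuallyEq (hleft.mono fun u hu => e1 u hu)

end MixedPartials

/-! ### Prolongation of coordinate changes on E to jets -/

section Transition

variable {n : ℕ} {E : Type*} [TopologicalSpace E] [ChartedSpace (EuclideanSpace ℝ (Fin (n + 1))) E]
  {π : E → ℝ} [IsFibredOverLine n π] {m : ℕ}
  {e e' : OpenPartialHomeomorph E (ℝ × (Fin n → ℝ))}

/-- The change of natural coordinates on `J^m π` induced by a change of coordinates on `E`. -/
noncomputable def jetTransition (m : ℕ) (he : IsAdapted n π e)
    (e' : OpenPartialHomeomorph E (ℝ × (Fin n → ℝ))) (z : JetCoord n m) : JetCoord n m :=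
  jetCoord e' (jetOfCoord he z)

/-- The domain of the change of natural coordinates. -/
def jetOverlap (m : ℕ) (e e' : OpenPartialHomeomorph E (ℝ × (Fin n → ℝ))) : Set (JetCoord n m) :=
  {z | (z.1, z.2 0) ∈ e.target ∧ e.symm (z.1, z.2 0) ∈ e'.source}

theorem isOpen_jetOverlap (m : ℕ) (e e' : OpenPartialHomeomorph E (ℝ × (Fin n → ℝ))) :
    IsOpen (jetOverlap m e e') := isOpen_jet_transition m

/-- The fibre part of the change of adapted coordinates on `E`. -/
def fibreTransition (e e' : OpenPartialHomeomorph E (ℝ × (Fin n → ℝ))) (x : ℝ × (Fin n → ℝ)) :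
    Fin n → ℝ := (e' (e.symm x)).2

/-- The domain of the change of adapted coordinates on `E`. -/
def fibreOverlap (e e' : OpenPartialHomeomorph E (ℝ × (Fin n → ℝ))) : Set (ℝ × (Fin n → ℝ)) :=
  e.target ∩ e.symm ⁻¹' e'.source

theorem isOpen_fibreOverlap (e e' : OpenPartialHomeomorph E (ℝ × (Fin n → ℝ))) :
    IsOpen (fibreOverlap e e') := e.isOpen_inter_preimage_symm e'.open_source

variable (he : IsAdapted n π e)

theorem contDiffOn_fibreTransition (he : IsAdapted n π e) (he' : IsAdapted n π e') :
    ContDiffOn ℝ ∞ (fibreTransition e e') (fibreOverlap e e') := by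
  have hτ0 : ContMDiffOn 𝓘(ℝ, ℝ × (Fin n → ℝ)) 𝓘(ℝ, ℝ × (Fin n → ℝ)) ∞ (e' ∘ e.symm)
      (e.target ∩ e.symm ⁻¹' e'.source) :=
    he'.contMDiffOn.comp (he.contMDiffOn_symm.mono inter_subset_left) fun z hz => hz.2
  exact contDiff_snd.comp_contDiffOn hτ0.contDiffOn

theorem contDiffOn_jetTransition (he' : IsAdapted n π e') :
    ContDiffOn ℝ ∞ (jetTransition m he e') (jetOverlap m e e') := contDiffOn_jet_transition he he'

theorem base_jetOfCoord_mem {z : JetCoord n m} (hz : z ∈ jetOverlap m e e') :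
    (jetOfCoord he z).base ∈ e'.source := by
  rw [base_jetOfCoord he hz.1]; exact hz.2

theorem jetOfCoord_jetCoord {y : Jet n π m} (hy : y.base ∈ e.source) :
    jetOfCoord he (jetCoord e y) = y := (jetPartialEquiv m he).left_inv hy

theorem jetCoord_mem_jetDomain (he : IsAdapted n π e) {y : Jet n π m} (hy : y.base ∈ e.source) :
    jetCoord e y ∈ jetDomain m e := (jetPartialEquiv m he).map_source hy

theorem jetTransition_mem (he' : IsAdapted n π e') {z : JetCoord n m} (hz : z ∈ jetOverlap m e e') :
    jetTransition m he e' z ∈ jetDomain m e' :=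
  jetCoord_mem_jetDomain he' (base_jetOfCoord_mem he hz)

theorem jetOfCoord_jetTransition (he' : IsAdapted n π e') {z : JetCoord n m}
    (hz : z ∈ jetOverlap m e e') :
    jetOfCoord he' (jetTransition m he e' z) = jetOfCoord he z :=
  jetOfCoord_jetCoord he' (base_jetOfCoord_mem he hz)

theorem jetTrunc_jetTransition (he' : IsAdapted n π e') {r : ℕ} (hr : r ≤ m) {z : JetCoord n m}
    (hz : z ∈ jetOverlap m e e') :
    jetTrunc hr (jetTransition m he e' z) = jetTransition r he e' (jetTrunc hr z) := by
  rw [jetTransition, jetTransition, ← jetOfCoord_proj he hr hz.1,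
    jetCoord_proj hr he' (base_jetOfCoord_mem he hz)]
  rfl

theorem localLagrangian_jetTransition (he' : IsAdapted n π e') {k : ℕ} {hk : 1 ≤ k}
    {L : Jet n π k → ℝ}
    {z : JetCoord n (2 * k - 1)} (hz : z ∈ jetOverlap (2 * k - 1) e e') :
    localLagrangian hk L he' (jetTransition _ he e' z) = localLagrangian hk L he z := by
  rw [localLagrangian, localLagrangian, jetOfCoord_jetTransition he he' hz]

theorem isLocalSection_of_coord (he : IsAdapted n π e) {q : ℝ → Fin n → ℝ} {s : ℝ}
    (hq : ContDiff ℝ ∞ q)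
    (hs : (s, q s) ∈ e.target) : IsLocalSection n π (fun u => e.symm (u, q u)) s := by
  have hc : ContDiff ℝ ∞ (fun u => (u, q u)) := contDiff_id.prodMk hq
  have h1 : ∀ᶠ u in 𝓝 s, (u, q u) ∈ e.target :=
    hc.continuous.continuousAt.eventually (e.open_target.mem_nhds hs)
  filter_upwards [h1] with u hu
  refine ⟨?_, (he.contMDiffOn_symm.contMDiffAt (e.open_target.mem_nhds hu)).comp u
    hc.contMDiff.contMDiffAt⟩
  rw [← he.fst_eq _ (e.map_target hu), e.right_inv hu]

theorem jetOfCoord_jetCurve {q : ℝ → Fin n → ℝ} {s : ℝ} (hq : ContDiff ℝ ∞ q)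
    (hs : (s, q s) ∈ e.target) :
    jetOfCoord he (jetCurve m q s) = Jet.mk m _ s (isLocalSection_of_coord he hq hs) := by
  have hz : ((jetCurve m q s).1, (jetCurve m q s).2 0) ∈ e.target := by
    simpa [jetCurve] using hs
  refine jetCoord_injOn he ?_ (e.map_target hs) ?_
  · rw [base_jetOfCoord he hz]; exact e.map_target hz
  · rw [jetCoord_jetOfCoord_self he hz, jetCoord_mk _ he (e.map_target hs)]
    refine Prod.ext rfl (funext fun i => Filter.EventuallyEq.iteratedDeriv_eq i ?_)
    have hc : ContDiff ℝ ∞ (fun u => (u, q u)) := contDiff_id.prodMk hq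
    filter_upwards [hc.continuous.continuousAt.eventually (e.open_target.mem_nhds hs)] with u hu
    rw [e.right_inv hu]

/-- Coordinate changes carry prolonged curves to prolonged curves. Derivatives of `jetTransition`
are read off by differentiating this identity along curves or in families of curves, without an
explicit higher chain rule. -/
theorem jetTransition_jetCurve (he' : IsAdapted n π e') {q : ℝ → Fin n → ℝ} {s : ℝ}
    (hq : ContDiff ℝ ∞ q) (hs : (s, q s) ∈ fibreOverlap e e') :
    jetTransition m he e' (jetCurve m q s)
      = jetCurve m (fun u => fibreTransition e e' (u, q u)) s := by
  rw [jetTransition, jetOfCoord_jetCurve he hq hs.1, jetCoord_mk _ he' hs.2]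
  rfl

theorem contDiffAt_fibreTransition_curve (he : IsAdapted n π e) (he' : IsAdapted n π e')
    {q : ℝ → Fin n → ℝ} {s : ℝ}
    (hq : ContDiffAt ℝ ∞ q s) (hs : (s, q s) ∈ fibreOverlap e e') :
    ContDiffAt ℝ ∞ (fun u => fibreTransition e e' (u, q u)) s :=
  ContDiffAt.comp (g := fibreTransition e e') s ((contDiffOn_fibreTransition he he').contDiffAt
    ((isOpen_fibreOverlap e e').mem_nhds hs)) (contDiffAt_id.prodMk hq)

/-- Every point of the coordinate space lies on a prolonged polynomial curve, so pointwise
identities can be proved along such curves. -/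
theorem jetCurve_taylorCurve (z : JetCoord n m) : jetCurve m (taylorCurve z) z.1 = z :=
  Prod.ext rfl (funext fun i => iteratedDeriv_taylorCurve z i)

theorem jetCurve_mem_jetOverlap {q : ℝ → Fin n → ℝ} {s : ℝ} :
    jetCurve m q s ∈ jetOverlap m e e' ↔ (s, q s) ∈ fibreOverlap e e' := by
  simp [jetCurve, jetOverlap, fibreOverlap]

theorem eventually_mem_fibreOverlap {q : ℝ → Fin n → ℝ} {s : ℝ} (hq : ContinuousAt q s)
    (hs : (s, q s) ∈ fibreOverlap e e') : ∀ᶠ u in 𝓝 s, (u, q u) ∈ fibreOverlap e e' :=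
  (continuousAt_id.prodMk hq).eventually ((isOpen_fibreOverlap e e').mem_nhds hs)

theorem mem_fibreOverlap_taylorCurve {z : JetCoord n m} (hz : z ∈ jetOverlap m e e') :
    (z.1, taylorCurve z z.1) ∈ fibreOverlap e e' := by
  rw [taylorCurve_self]; exact hz

/-- Changes of natural coordinates preserve the total time derivative. -/
theorem fderiv_jetTransition_holonomicVector (he' : IsAdapted n π e') {r : ℕ} (hr : r < m)
    {z : JetCoord n m} (hz : z ∈ jetOverlap m e e') :
    fderiv ℝ (jetTransition r he e') (jetTrunc hr.le z) (jetTrunc hr.le (holonomicVector z))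
      = jetTrunc hr.le (holonomicVector (jetTransition m he e' z)) := by
  set q := taylorCurve z with hq_def
  have hq : ContDiff ℝ ∞ q := contDiff_taylorCurve_right z
  have hs := mem_fibreOverlap_taylorCurve hz
  have hzq : jetCurve m q z.1 = z := jetCurve_taylorCurve z
  have hzr : jetCurve r q z.1 = jetTrunc hr.le z := by
    rw [← hzq]; rfl
  have hz' : jetTrunc hr.le z ∈ jetOverlap r e e' := hz
  have hd : DifferentiableAt ℝ (jetTransition r he e') (jetCurve r q z.1) := by
    rw [hzr]
    exact ((contDiffOn_jetTransition he he').contDiffAt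
      ((isOpen_jetOverlap r e e').mem_nhds hz')).differentiableAt (by simp)
  -- The velocity of the prolonged r-jet curve is computed before and after the coordinate change.
  -- It contains q^(r+1), which is a coordinate of z because r < m.
  have h1 := hd.hasFDerivAt.comp_hasDerivAt z.1 (hasDerivAt_jetCurve (m := r) hq.contDiffAt)
  have h2 : HasDerivAt (fun s => jetTransition r he e' (jetCurve r q s)) _ z.1 :=
    (hasDerivAt_jetCurve (m := r)
      (contDiffAt_fibreTransition_curve he he' hq.contDiffAt hs)).congr_of_eventuallyEq
      ((eventually_mem_fibreOverlap hq.continuous.continuousAt hs).mono fun s hs =>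
        jetTransition_jetCurve he he' hq hs)
  have h3 := h1.unique h2
  rw [hzr] at h3
  rw [jetTrunc_holonomicVector hr, jetTrunc_holonomicVector hr]
  have e1 : (fun i : Fin (r + 1) => z.2 ⟨i + 1, by omega⟩)
      = fun i : Fin (r + 1) => iteratedDeriv (i + 1) q z.1 :=
    funext fun i => (iteratedDeriv_taylorCurve z ⟨i + 1, by omega⟩).symm
  rw [e1, h3]
  have h4 := jetTransition_jetCurve (m := m) he he' hq hs
  rw [hzq] at h4
  rw [h4]
  rfl

/-- The prolongation of a vertical vector field to jets commutes with changes of coordinates. -/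
theorem fderiv_jetTransition_vertical (he' : IsAdapted n π e') {q ξ : ℝ → Fin n → ℝ}
    (hq : ContDiff ℝ ∞ q) (hξ : ContDiff ℝ ∞ ξ) {s : ℝ} (hs : (s, q s) ∈ fibreOverlap e e') :
    fderiv ℝ (jetTransition m he e') (jetCurve m q s) (0, fun i => iteratedDeriv i ξ s)
      = ((0, fun i => iteratedDeriv i
          (fun u => fderiv ℝ (fibreTransition e e') (u, q u) (0, ξ u)) s) : JetCoord n m) := by
  have hd : DifferentiableAt ℝ (jetTransition m he e') (jetCurve m q s) :=
    ((contDiffOn_jetTransition he he').contDiffAt ((isOpen_jetOverlap m e e').mem_nhds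
      (jetCurve_mem_jetOverlap.2 hs))).differentiableAt (by simp)
  -- The vertical vector is realized as the velocity, at u = 0, of the jets of the variation q + u
  -- ξ.
  have hcurve : ∀ u : ℝ, jetCurve m (fun σ => q σ + u • ξ σ) s
      = jetCurve m q s + u • ((0, fun i => iteratedDeriv i ξ s) : JetCoord n m) := by
    intro u
    refine Prod.ext (by simp [jetCurve]) (funext fun i => ?_)
    have h1 := iteratedDeriv_fun_add (n := i) (x := s) (f := q) (g := fun σ => u • ξ σ)
      (hq.contDiffAt.of_le (by exact_mod_cast le_top))
      ((hξ.const_smul u).contDiffAt.of_le (by exact_mod_cast le_top))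
    have h2 : iteratedDeriv i (fun σ => u • ξ σ) s = u • iteratedDeriv i ξ s :=
      iteratedDeriv_fun_const_smul (hξ.contDiffAt.of_le (by exact_mod_cast le_top)) u
    change iteratedDeriv i (fun σ => q σ + u • ξ σ) s
      = iteratedDeriv i q s + u • iteratedDeriv i ξ s
    rw [h1, h2]
  have hline : HasDerivAt (fun u : ℝ => jetCurve m (fun σ => q σ + u • ξ σ) s)
      ((0, fun i => iteratedDeriv i ξ s) : JetCoord n m) 0 := by
    simp only [hcurve]
    simpa using ((hasDerivAt_id (0 : ℝ)).smul_const
      ((0, fun i => iteratedDeriv i ξ s) : JetCoord n m)).const_add (jetCurve m q s)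
  have h1 : HasDerivAt (fun u : ℝ => jetTransition m he e' (jetCurve m (fun σ => q σ + u • ξ σ) s))
      (fderiv ℝ (jetTransition m he e') (jetCurve m q s) (0, fun i => iteratedDeriv i ξ s)) 0 := by
    refine HasFDerivAt.comp_hasDerivAt (l := jetTransition m he e') (0 : ℝ) ?_ hline
    simpa [hcurve] using hd.hasFDerivAt
  let c : ℝ × ℝ → ℝ × (Fin n → ℝ) := fun x => (x.2, q x.2 + x.1 • ξ x.2)
  have hc : ContDiff ℝ ∞ c := by
    refine contDiff_snd.prodMk ((hq.comp contDiff_snd).add (contDiff_fst.smul (hξ.comp contDiff_snd)))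
  have hΩ : IsOpen (c ⁻¹' fibreOverlap e e') := (isOpen_fibreOverlap e e').preimage hc.continuous
  have hG : ContDiffOn ℝ ∞ (fun x => fibreTransition e e' (c x)) (c ⁻¹' fibreOverlap e e') :=
    (contDiffOn_fibreTransition he he').comp hc.contDiffOn fun x hx => hx
  have hmem : ((0 : ℝ), s) ∈ c ⁻¹' fibreOverlap e e' := by simpa [c] using hs
  -- The transformed variation is differentiated in u under the s-derivatives.
  have h2 : HasDerivAt (fun u : ℝ => jetCurve m (fun σ => fibreTransition e e' (c (u, σ))) s)
      ((0, fun i => iteratedDeriv i (fun σ => fderiv ℝ (fun x => fibreTransition e e' (c x))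
        ((0 : ℝ), σ) (1, 0)) s) : JetCoord n m) 0 :=
    (hasDerivAt_const (0 : ℝ) s).prodMk (hasDerivAt_pi.2 fun i =>
      hasDerivAt_iteratedDeriv_param hΩ i hG hmem)
  have hev : ∀ᶠ u in 𝓝 (0 : ℝ), c (u, s) ∈ fibreOverlap e e' := by
    have : Continuous fun u : ℝ => c (u, s) := hc.continuous.comp (by fun_prop)
    exact this.continuousAt.eventually ((isOpen_fibreOverlap e e').mem_nhds hmem)
  have h3 := h1.unique (h2.congr_of_eventuallyEq (hev.mono fun u hu =>
    jetTransition_jetCurve he he' (hq.add (hξ.const_smul u)) hu))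
  rw [h3]
  refine Prod.ext rfl (funext fun i => Filter.EventuallyEq.iteratedDeriv_eq i ?_)
  filter_upwards [eventually_mem_fibreOverlap hq.continuous.continuousAt hs] with σ hσ
  have hcd : HasDerivAt (fun u : ℝ => c (u, σ)) (0, ξ σ) 0 := by
    refine (hasDerivAt_const (0 : ℝ) σ).prodMk ?_
    simpa using ((hasDerivAt_id (0 : ℝ)).smul_const (ξ σ)).const_add (q σ)
  have hτd : DifferentiableAt ℝ (fibreTransition e e') (c (0, σ)) := by
    refine ((contDiffOn_fibreTransition he he').contDiffAt
      ((isOpen_fibreOverlap e e').mem_nhds ?_)).differentiableAt (by simp)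
    simpa [c] using hσ
  have h4 := hτd.hasFDerivAt.comp_hasDerivAt (0 : ℝ) hcd
  have h5 := hasDerivAt_slice_left (x := ((0 : ℝ), σ)) (G := fun x => fibreTransition e e' (c x))
    (hτd.comp ((0 : ℝ), σ) (hc.differentiable (by simp) _))
  have h6 := h5.unique h4
  rw [h6]
  simp [c]

end Transition

/-! ### Vanishing of a covector field paired with prolonged variations -/

section Uniqueness

variable {n r : ℕ}

/-- A field of covectors whose contraction with every prolonged vertical vector field has a
derivative of order zero in that vector field vanishes on vertical vectors. -/
theorem vertical_eq_zero_of_hasDerivAt {N : Set ℝ} (hN : IsOpen N)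
    {Δ : ℝ → JetCoord n r →L[ℝ] ℝ} (hΔ : ∀ s ∈ N, DifferentiableAt ℝ Δ s)
    (H : ∀ s ∈ N, ∃ G : (Fin n → ℝ) →L[ℝ] ℝ, ∀ ξ : ℝ → Fin n → ℝ, ContDiff ℝ ∞ ξ →
      HasDerivAt (fun s => Δ s (0, fun i => iteratedDeriv i ξ s)) (G (ξ s)) s)
    {s : ℝ} (hs : s ∈ N) (v : Fin (r + 1) → Fin n → ℝ) : Δ s (0, v) = 0 := by
  -- Descending induction on i, measured by d. It starts at i = r + 1, where no slot has that index
  -- and `qDir i A` is the zero vector.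
  have key : ∀ d i, r + 1 ≤ i + d → ∀ s ∈ N, ∀ A, Δ s (qDir i A) = 0 := by
    intro d
    induction d with
    | zero =>
      intro i hi s _ A
      have : (qDir i A : JetCoord n r) = 0 :=
        Prod.ext rfl (funext fun j => if_neg (by omega))
      rw [this, map_zero]
    | succ d ih =>
      intro i hi s hs A
      rcases Nat.lt_or_ge r i with hri | hri
      · exact ih i (by omega) s hs A
      have hnext := ih (i + 1) (by omega)
      -- The test field is the polynomial whose only nonzero derivative at s, up to order r + 1, is
      -- the one of order i + 1. It vanishes at s, which removes G, and differentiating its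
      -- prolongation turns ∂/∂q_{i+1} into ∂/∂q_i. Order r + 1 is what the velocity of an r-jet
      -- requires.
      let z : JetCoord n (r + 1) := (s, fun j => if (j : ℕ) = i + 1 then Pi.single A 1 else 0)
      let ξ := taylorCurve z
      have hξ : ContDiff ℝ ∞ ξ := contDiff_taylorCurve_right z
      have hval : ∀ j ≤ r + 1, iteratedDeriv j ξ s = if j = i + 1 then Pi.single A 1 else 0 :=
        fun j hj => iteratedDeriv_taylorCurve z ⟨j, by omega⟩
      obtain ⟨G, hG⟩ := H s hs
      have hξ0 : ξ s = 0 := by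
        have := hval 0 (by omega)
        simpa using this
      have h1 := hG ξ hξ
      rw [hξ0, map_zero] at h1
      have hj : HasDerivAt (fun s => ((0, fun j => iteratedDeriv j ξ s) : JetCoord n r))
          (0, fun j => iteratedDeriv (j + 1) ξ s) s :=
        (hasDerivAt_const s (0 : ℝ)).prodMk
          (hasDerivAt_pi.2 fun j => hasDerivAt_iteratedDeriv hξ.contDiffAt j)
      have h2 := (hΔ s hs).hasDerivAt.clm_apply hj
      have e1 : ((0, fun j => iteratedDeriv j ξ s) : JetCoord n r) = qDir (i + 1) A :=
        Prod.ext rfl (funext fun j => hval j (by omega))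
      have e2 : ((0, fun j => iteratedDeriv (j + 1) ξ s) : JetCoord n r) = qDir i A :=
        Prod.ext rfl (funext fun j => (hval (j + 1) (by omega)).trans (by simp [qDir]))
      -- The coefficient of index i + 1 vanishes on all of N by induction, not just at s, so its
      -- derivative vanishes too.
      have e3 : deriv Δ s (qDir (i + 1) A) = 0 := by
        have h3 := (hΔ s hs).hasDerivAt.clm_apply (hasDerivAt_const s (qDir (i + 1) A))
        rw [map_zero, add_zero] at h3
        have h4 : HasDerivAt (fun s => Δ s (qDir (i + 1) A)) 0 s :=
          (hasDerivAt_const s (0 : ℝ)).congr_of_eventuallyEq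
            ((hN.eventually_mem hs).mono fun u hu => hnext u hu A)
        exact h3.unique h4
      have h5 := h2.unique h1
      rwa [e1, e2, e3, zero_add] at h5
  obtain ⟨v', rfl⟩ := exists_nat_extension v
  rw [clm_vertical]
  refine Finset.sum_eq_zero fun i _ => Finset.sum_eq_zero fun A _ => ?_
  rw [key (r + 1) i (by omega) s hs A, smul_zero]

end Uniqueness

/-! ### Coordinate independence of the Legendre-Ostrogradsky covector -/

section LegendreTransition

variable {n : ℕ} {E : Type*} [TopologicalSpace E] [ChartedSpace (EuclideanSpace ℝ (Fin (n + 1))) E]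
  {π : E → ℝ} [IsFibredOverLine n π] {k : ℕ} {hk : 1 ≤ k} {L : Jet n π k → ℝ}
  {e e' : OpenPartialHomeomorph E (ℝ × (Fin n → ℝ))} (he : IsAdapted n π e)
  (he' : IsAdapted n π e')

theorem fderiv_localLagrangian_jetTransition (hL : ContMDiff 𝓘(ℝ, JetCoord n k) 𝓘(ℝ, ℝ) ∞ L)
    {z : JetCoord n (2 * k - 1)} (hz : z ∈ jetOverlap (2 * k - 1) e e') (v) :
    fderiv ℝ (localLagrangian hk L he') (jetTransition _ he e' z)
      (fderiv ℝ (jetTransition _ he e') z v) = fderiv ℝ (localLagrangian hk L he) z v := by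
  have h1 : DifferentiableAt ℝ (localLagrangian hk L he') (jetTransition _ he e' z) :=
    ((contDiffOn_localLagrangian he' hL).contDiffAt ((isOpen_jetDomain _ e').mem_nhds
      (jetTransition_mem he he' hz))).differentiableAt (by simp)
  have h2 : DifferentiableAt ℝ (jetTransition (2 * k - 1) he e') z :=
    ((contDiffOn_jetTransition he he').contDiffAt
      ((isOpen_jetOverlap _ e e').mem_nhds hz)).differentiableAt (by simp)
  have h3 : localLagrangian hk L he =ᶠ[𝓝 z]
      localLagrangian hk L he' ∘ jetTransition (2 * k - 1) he e' :=
    ((isOpen_jetOverlap _ e e').eventually_mem hz).mono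
      fun x hx => (localLagrangian_jetTransition he he' hx).symm
  rw [h3.fderiv_eq, fderiv_comp z h1 h2]
  rfl

/-- The covector `p̂ dt + p̂_A^r dq_r^A` does not depend on the coordinates. -/
theorem legendreCoord_jetTransition (hL : ContMDiff 𝓘(ℝ, JetCoord n k) 𝓘(ℝ, ℝ) ∞ L)
    {z : JetCoord n (2 * k - 1)} (hz : z ∈ jetOverlap (2 * k - 1) e e') :
    (legendreCoord hk L he' (jetTransition _ he e' z)).comp
      (fderiv ℝ (jetTransition (k - 1) he e') (jetTrunc (by omega) z))
      = legendreCoord hk L he z := by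
  have hkk : k - 1 < 2 * k - 1 := by omega
  -- The covector of the chart e minus the pull-back of that of e'; it is shown to vanish on
  -- vertical vectors and on the total derivative.
  let g : JetCoord n (2 * k - 1) → JetCoord n (k - 1) →L[ℝ] ℝ := fun z =>
    legendreCoord hk L he z - (legendreCoord hk L he' (jetTransition _ he e' z)).comp
      (fderiv ℝ (jetTransition (k - 1) he e') (jetTrunc hkk.le z))
  have hopen := isOpen_jetOverlap (2 * k - 1) e e'
  have hg : ContDiffOn ℝ ∞ g (jetOverlap (2 * k - 1) e e') := by
    refine ((contDiffOn_legendreCoord he hL).mono fun z hz => hz.1).sub (ContDiffOn.clm_comp ?_ ?_)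
    · exact (contDiffOn_legendreCoord he' hL).comp (contDiffOn_jetTransition he he')
        fun z hz => jetTransition_mem he he' hz
    · exact ((contDiffOn_jetTransition he he').fderiv_of_isOpen (isOpen_jetOverlap (k - 1) e e')
        (m := ∞) (by simp)).comp (jetTrunc hkk.le).contDiff.contDiffOn fun z hz => hz
  set q := taylorCurve z with hq_def
  have hq : ContDiff ℝ ∞ q := contDiff_taylorCurve_right z
  have hzq : jetCurve (2 * k - 1) q z.1 = z := jetCurve_taylorCurve z
  let N : Set ℝ := {s | (s, q s) ∈ fibreOverlap e e'}
  have hN : IsOpen N := (isOpen_fibreOverlap e e').preimage (continuous_id.prodMk hq.continuous)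
  have hzN : z.1 ∈ N := mem_fibreOverlap_taylorCurve hz
  have hvert : ∀ v, g z (0, v) = 0 := by
    intro v
    have := vertical_eq_zero_of_hasDerivAt hN (Δ := fun s => g (jetCurve (2 * k - 1) q s))
      (fun s hs => ?_) (fun s hs => ?_) hzN v
    · simpa only [hzq] using this
    · have h1 := (hg.contDiffAt (hopen.mem_nhds (jetCurve_mem_jetOverlap.2 hs))).differentiableAt
        (by simp)
      exact h1.comp s (hasDerivAt_jetCurve hq.contDiffAt).differentiableAt
    · have hs' := jetCurve_mem_jetOverlap (m := 2 * k - 1).2 hs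
      obtain ⟨G, hG⟩ := exists_firstVariation (hk := hk) he hL hq.contDiffAt hs'.1
      have hQ := contDiffAt_fibreTransition_curve he he' hq.contDiffAt hs
      set Q : ℝ → Fin n → ℝ := fun u => fibreTransition e e' (u, q u) with hQ_def
      have hQs : ∀ m, ∀ u ∈ N, jetTransition m he e' (jetCurve m q u) = jetCurve m Q u :=
        fun m u hu => jetTransition_jetCurve he he' hq hu
      have hQmem : jetCurve (2 * k - 1) Q s ∈ jetDomain (2 * k - 1) e' := by
        rw [← hQs _ s hs]; exact jetTransition_mem he he' hs'
      obtain ⟨G', hG'⟩ := exists_firstVariation (hk := hk) he' hL hQ hQmem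
      refine ⟨G - G'.comp ((fderiv ℝ (fibreTransition e e') (s, q s)).comp
        (ContinuousLinearMap.inr ℝ ℝ _)), fun ξ hξ => ?_⟩
      -- η is the same variation field expressed in the coordinates e'.
      let η : ℝ → Fin n → ℝ := fun u => fderiv ℝ (fibreTransition e e') (u, q u) (0, ξ u)
      have hη : ContDiffAt ℝ ∞ η s := by
        have h1 := ((contDiffOn_fibreTransition he he').fderiv_of_isOpen (isOpen_fibreOverlap e e')
          (m := ∞) (by simp)).contDiffAt ((isOpen_fibreOverlap e e').mem_nhds hs)
        exact (h1.comp s (contDiffAt_id.prodMk hq.contDiffAt)).clm_apply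
          (contDiffAt_const.prodMk hξ.contDiffAt)
      have hpro : ∀ m, ∀ u ∈ N, fderiv ℝ (jetTransition m he e') (jetCurve m q u)
          (0, fun i => iteratedDeriv i ξ u) = ((0, fun i => iteratedDeriv i η u) : JetCoord n m) :=
        fun m u hu => fderiv_jetTransition_vertical he he' hq hξ hu
      have h1 := (hG ξ hξ.contDiffAt).sub (hG' η hη)
      have h2 := fderiv_localLagrangian_jetTransition (hk := hk) he he' hL hs'
        (0, fun i => iteratedDeriv i ξ s)
      rw [hpro _ s hs, hQs _ s hs] at h2
      have hval : (G - G'.comp ((fderiv ℝ (fibreTransition e e') (s, q s)).comp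
          (ContinuousLinearMap.inr ℝ ℝ _))) (ξ s) = G (ξ s) - G' (η s) := rfl
      -- Both first variations contain the same variation of L, since L is a function on the jet
      -- space. It cancels, and only the terms of order zero in ξ remain.
      rw [h2, add_sub_add_left_eq_sub, ← hval] at h1
      refine h1.congr_of_eventuallyEq ?_
      filter_upwards [hN.mem_nhds hs] with u hu
      have h3 := hpro (k - 1) u hu
      change legendreCoord hk L he (jetCurve (2 * k - 1) q u) _
        - legendreCoord hk L he' (jetTransition _ he e' (jetCurve (2 * k - 1) q u))
          (fderiv ℝ (jetTransition (k - 1) he e') (jetCurve (k - 1) q u) _) = _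
      rw [h3, hQs _ u hu]
      rfl
  have hhol : g z (jetTrunc hkk.le (holonomicVector z)) = 0 := by
    change legendreCoord hk L he z _ - legendreCoord hk L he' (jetTransition _ he e' z)
          (fderiv ℝ (jetTransition (k - 1) he e') (jetTrunc hkk.le z) _) = 0
    rw [fderiv_jetTransition_holonomicVector he he' hkk hz, legendreCoord_holonomicVector,
      legendreCoord_holonomicVector, localLagrangian_jetTransition he he' hz, sub_self]
  have hg0 : g z = 0 := by
    refine ContinuousLinearMap.ext fun v => ?_
    -- The total derivative has time component 1, so it spans a complement of the vertical vectors.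
    have hv : v = v.1 • jetTrunc hkk.le (holonomicVector z)
        + (0, (v - v.1 • jetTrunc hkk.le (holonomicVector z)).2) := by
      refine Prod.ext ?_ ?_
      · simp [jetTrunc_apply, holonomicVector]
      · simp
    rw [hv, map_add, map_smul, hhol, hvert]
    simp
  exact (sub_eq_zero.1 hg0).symm

end LegendreTransition

/-! ### The dynamics in natural coordinates -/

/-- The projection `(t, q_0, …, q_{2k-1}) ↦ (t, q_0, …, q_{k-1})`. -/
noncomputable def halfTrunc (n k : ℕ) : JetCoord n (2 * k - 1) →L[ℝ] JetCoord n (k - 1) :=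
  jetTrunc (by omega)

section LocalDynamics

variable {n : ℕ} {E : Type*} [TopologicalSpace E] [ChartedSpace (EuclideanSpace ℝ (Fin (n + 1))) E]
  {π : E → ℝ} [IsFibredOverLine n π] {k : ℕ} {hk : 1 ≤ k} {L : Jet n π k → ℝ}
  {e e' : OpenPartialHomeomorph E (ℝ × (Fin n → ℝ))} (he : IsAdapted n π e)
  (he' : IsAdapted n π e')

theorem hasFDerivAt_legendreCoord (hL : ContMDiff 𝓘(ℝ, JetCoord n k) 𝓘(ℝ, ℝ) ∞ L)
    {z : JetCoord n (2 * k - 1)} (hz : z ∈ jetDomain (2 * k - 1) e) :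
    HasFDerivAt (legendreCoord hk L he) (fderiv ℝ (legendreCoord hk L he) z) z :=
  (((contDiffOn_legendreCoord he hL).contDiffAt
    ((isOpen_jetDomain _ e).mem_nhds hz)).differentiableAt (by simp)).hasFDerivAt

theorem hasFDerivAt_momentum (hL : ContMDiff 𝓘(ℝ, JetCoord n k) 𝓘(ℝ, ℝ) ∞ L)
    {z : JetCoord n (2 * k - 1)} (hz : z ∈ jetDomain (2 * k - 1) e) (r : ℕ) (A : Fin n) :
    HasFDerivAt (momentum hk L he r A) (fderiv ℝ (momentum hk L he r A) z) z :=
  (((contDiffOn_momentum he hL r A).contDiffAt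
    ((isOpen_jetDomain _ e).mem_nhds hz)).differentiableAt (by simp)).hasFDerivAt

theorem hasFDerivAt_localLagrangian (hL : ContMDiff 𝓘(ℝ, JetCoord n k) 𝓘(ℝ, ℝ) ∞ L)
    {z : JetCoord n (2 * k - 1)} (hz : z ∈ jetDomain (2 * k - 1) e) :
    HasFDerivAt (localLagrangian hk L he) (fderiv ℝ (localLagrangian hk L he) z) z :=
  (((contDiffOn_localLagrangian he hL).contDiffAt
    ((isOpen_jetDomain _ e).mem_nhds hz)).differentiableAt (by simp)).hasFDerivAt

/-- This is the derivative of `legendreCoord_holonomicVector` along w. It expresses that TW_1 is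
contained in TW_o. -/
theorem fderiv_legendreCoord_add (hk : 1 ≤ k) {L : Jet n π k → ℝ}
    (hL : ContMDiff 𝓘(ℝ, JetCoord n k) 𝓘(ℝ, ℝ) ∞ L)
    {z : JetCoord n (2 * k - 1)} (hz : z ∈ jetDomain (2 * k - 1) e) (w : JetCoord n (2 * k - 1)) :
    fderiv ℝ (legendreCoord hk L he) z w (halfTrunc n k (holonomicVector z))
      + legendreCoord hk L he z (halfTrunc n k (jetShift w))
      = fderiv ℝ (localLagrangian hk L he) z w := by
  have h1 := (hasFDerivAt_legendreCoord (hk := hk) he hL hz).clm_apply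
    ((halfTrunc n k).hasFDerivAt.comp z (hasFDerivAt_holonomicVector z))
  have h2 : (fun z => legendreCoord hk L he z (halfTrunc n k (holonomicVector z)))
      = localLagrangian hk L he := funext fun z => legendreCoord_holonomicVector he z
  have h0 := hasFDerivAt_localLagrangian (hk := hk) he hL hz
  rw [← h2] at h0
  have h3 := congrArg (fun φ => φ w) (h1.unique h0)
  rw [h2] at h3
  simpa [add_comm] using h3

theorem halfTrunc_vertical (v : ℕ → Fin n → ℝ) :
    halfTrunc n k (0, fun i => v i) = ((0, fun i => v i) : JetCoord n (k - 1)) := rfl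

theorem halfTrunc_jetShift_vertical (hk : 1 ≤ k) (v : ℕ → Fin n → ℝ) :
    halfTrunc n k (jetShift (0, fun i => v i)) = ((0, fun i => v (i + 1)) : JetCoord n (k - 1)) := by
  rw [jetShift_apply]
  refine Prod.ext rfl (funext fun i => ?_)
  simp only [halfTrunc, jetTrunc_apply, Fin.val_castLE]
  rw [dif_pos (by omega)]

/-- The time derivatives of the momenta prescribed by the equations of motion:
`∂L/∂q_0^A` for `r = 0` and `d_T p̂_A^r` for `r ≥ 1`. -/
noncomputable def momentumRate (hk : 1 ≤ k) (L : Jet n π k → ℝ)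
    {e : OpenPartialHomeomorph E (ℝ × (Fin n → ℝ))} (he : IsAdapted n π e) (r : ℕ) (A : Fin n)
    (z : JetCoord n (2 * k - 1)) : ℝ :=
  if r = 0 then partialQ 0 A (localLagrangian hk L he) z else dT (momentum hk L he r A) z

theorem contDiffOn_momentumRate (hL : ContMDiff 𝓘(ℝ, JetCoord n k) 𝓘(ℝ, ℝ) ∞ L) (r : ℕ)
    (A : Fin n) : ContDiffOn ℝ ∞ (momentumRate hk L he r A) (jetDomain (2 * k - 1) e) := by
  unfold momentumRate
  split_ifs
  · exact contDiffOn_partialQ (isOpen_jetDomain _ e) (contDiffOn_localLagrangian he hL) _ _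
  · exact contDiffOn_dT (isOpen_jetDomain _ e) (contDiffOn_momentum he hL _ _)

/-- For vertical w in `fderiv_legendreCoord_add`, the contribution of `jetShift` cancels the terms
v_{r+1} p̂^r of dL. What remains are ∂L/∂q_0 and the total derivatives of the higher momenta. -/
theorem fderiv_legendreCoord_vertical (hL : ContMDiff 𝓘(ℝ, JetCoord n k) 𝓘(ℝ, ℝ) ∞ L)
    {z : JetCoord n (2 * k - 1)} (hz : z ∈ jetDomain (2 * k - 1) e) (v : ℕ → Fin n → ℝ) :
    fderiv ℝ (legendreCoord hk L he) z (0, fun i => v i) (halfTrunc n k (holonomicVector z))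
      = ∑ r ∈ Finset.range k, ∑ A, v r A * momentumRate hk L he r A z := by
  have h1 := fderiv_legendreCoord_add he hk hL hz (0, fun i => v i)
  rw [fderiv_localLagrangian_vertical he hL hz, halfTrunc_jetShift_vertical hk,
    legendreCoord_vertical he z fun i => v (i + 1)] at h1
  have h2 : ∑ r ∈ Finset.range k, ∑ A, v r A * momentumRate hk L he r A z
      = ∑ A, v 0 A * partialQ 0 A (localLagrangian hk L he) z
        + ∑ r ∈ Finset.range k, ∑ A, v (r + 1) A * dT (momentum hk L he (r + 1) A) z := by
    -- Because p̂^k = 0, the sum can be extended to r = k and then reindexed.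
    have h3 : ∑ A, v k A * momentumRate hk L he k A z = 0 := by
      refine Finset.sum_eq_zero fun A _ => ?_
      rw [momentumRate, if_neg (by omega), momentum_eq_zero he le_rfl, dT_eq]
      simp
    rw [← add_zero (∑ r ∈ Finset.range k, ∑ A, v r A * momentumRate hk L he r A z), ← h3,
      ← Finset.sum_range_succ (fun r => ∑ A, v r A * momentumRate hk L he r A z),
      Finset.sum_range_succ', add_comm]
    congr 1
  rw [h2]
  simp only [mul_add, Finset.sum_add_distrib, mul_comm (v _ _) (momentum _ _ _ _ _ _)] at h1
  linarith

theorem fderiv_legendreCoord_apply_vertical (hL : ContMDiff 𝓘(ℝ, JetCoord n k) 𝓘(ℝ, ℝ) ∞ L)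
    {z : JetCoord n (2 * k - 1)} (hz : z ∈ jetDomain (2 * k - 1) e) (w : JetCoord n (2 * k - 1))
    (v : ℕ → Fin n → ℝ) :
    fderiv ℝ (legendreCoord hk L he) z w (0, fun i => v i)
      = ∑ r ∈ Finset.range k, ∑ A, v r A * fderiv ℝ (momentum hk L he r A) z w := by
  have h1 := (hasFDerivAt_legendreCoord (hk := hk) he hL hz).clm_apply
    (hasFDerivAt_const ((0, fun i => v i) : JetCoord n (k - 1)) z)
  have h2 : HasFDerivAt (fun z => ∑ r ∈ Finset.range k, ∑ A, momentum hk L he r A z * v r A)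
      (∑ r ∈ Finset.range k, ∑ A, v r A • fderiv ℝ (momentum hk L he r A) z) z :=
    HasFDerivAt.fun_sum fun r _ => HasFDerivAt.fun_sum fun A _ =>
      (hasFDerivAt_momentum he hL hz r A).mul_const _
  have h3 : (fun z => legendreCoord hk L he z (0, fun i => v i))
      = fun z => ∑ r ∈ Finset.range k, ∑ A, momentum hk L he r A z * v r A :=
    funext fun z => legendreCoord_vertical he z v
  have h4 := congrArg (fun φ => φ w) (h1.unique (h3 ▸ h2))
  simpa using h4

/-- The vector `v` is a value at `z` of a solution of the equations of motion in natural
coordinates: it is holonomic up to order `k - 1` and annihilates the exterior derivative of the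
Cartan form `p̂ dt + p̂_A^r dq_r^A`. -/
def IsDynamical (hk : 1 ≤ k) (L : Jet n π k → ℝ) {e : OpenPartialHomeomorph E (ℝ × (Fin n → ℝ))}
    (he : IsAdapted n π e) (z v : JetCoord n (2 * k - 1)) : Prop :=
  halfTrunc n k v = halfTrunc n k (holonomicVector z) ∧
    ∀ w, fderiv ℝ (legendreCoord hk L he) z v (halfTrunc n k w)
      = fderiv ℝ (legendreCoord hk L he) z w (halfTrunc n k v)

/-- The value prescribed by the equations of motion for the derivative of the restricted
Legendre-Ostrogradsky map along a solution. -/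
noncomputable def legendreRate (hk : 1 ≤ k) (L : Jet n π k → ℝ)
    {e : OpenPartialHomeomorph E (ℝ × (Fin n → ℝ))}
    (he : IsAdapted n π e) (z : JetCoord n (2 * k - 1)) :
    JetCoord n (k - 1) × (Fin (k - 1 + 1) → Fin n → ℝ) :=
  (halfTrunc n k (holonomicVector z), fun r A => momentumRate hk L he r A z)

theorem hasFDerivAt_restrictedLegendreCoord (hL : ContMDiff 𝓘(ℝ, JetCoord n k) 𝓘(ℝ, ℝ) ∞ L)
    {z : JetCoord n (2 * k - 1)} (hz : z ∈ jetDomain (2 * k - 1) e) :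
    HasFDerivAt (restrictedLegendreCoord hk L he) ((halfTrunc n k).prod
      (ContinuousLinearMap.pi fun r : Fin (k - 1 + 1) => ContinuousLinearMap.pi fun A =>
        fderiv ℝ (momentum hk L he r A) z)) z :=
  (halfTrunc n k).hasFDerivAt.prodMk (hasFDerivAt_pi.2 fun r => hasFDerivAt_pi.2 fun A =>
    hasFDerivAt_momentum he hL hz r A)

theorem fderiv_restrictedLegendreCoord_apply (hL : ContMDiff 𝓘(ℝ, JetCoord n k) 𝓘(ℝ, ℝ) ∞ L)
    {z : JetCoord n (2 * k - 1)} (hz : z ∈ jetDomain (2 * k - 1) e) (v : JetCoord n (2 * k - 1)) :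
    fderiv ℝ (restrictedLegendreCoord hk L he) z v
      = (halfTrunc n k v, fun r : Fin (k - 1 + 1) => fun A =>
          fderiv ℝ (momentum hk L he r A) z v) := by
  rw [(hasFDerivAt_restrictedLegendreCoord he hL hz).fderiv]
  rfl

theorem halfTrunc_fst (v : JetCoord n (2 * k - 1)) : (halfTrunc n k v).1 = v.1 := rfl

/-- Testing dλ(v, w) = 0 on vertical w gives exactly the equations for the rates of the momenta.
Nothing is lost: the equation is trivial for w = v, and v is transverse to the vertical vectors
because its time component is 1. -/
theorem isDynamical_iff (hL : ContMDiff 𝓘(ℝ, JetCoord n k) 𝓘(ℝ, ℝ) ∞ L)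
    {z : JetCoord n (2 * k - 1)} (hz : z ∈ jetDomain (2 * k - 1) e) (v : JetCoord n (2 * k - 1)) :
    IsDynamical hk L he z v
      ↔ fderiv ℝ (restrictedLegendreCoord hk L he) z v = legendreRate hk L he z := by
  rw [fderiv_restrictedLegendreCoord_apply he hL hz, legendreRate, Prod.mk.injEq]
  refine and_congr_right fun hv => ?_
  have hvert : ∀ w : ℕ → Fin n → ℝ,
      (fderiv ℝ (legendreCoord hk L he) z v (halfTrunc n k (0, fun i => w i))
        = fderiv ℝ (legendreCoord hk L he) z (0, fun i => w i) (halfTrunc n k v))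
      ↔ ∑ r ∈ Finset.range k, ∑ A, w r A * fderiv ℝ (momentum hk L he r A) z v
        = ∑ r ∈ Finset.range k, ∑ A, w r A * momentumRate hk L he r A z := by
    intro w
    rw [halfTrunc_vertical, fderiv_legendreCoord_apply_vertical he hL hz, hv,
      fderiv_legendreCoord_vertical he hL hz]
  constructor
  · intro h
    funext r A
    have h1 := (hvert fun i => if i = r then Pi.single A 1 else 0).1 (h _)
    have h2 : ∀ f : ℕ → Fin n → ℝ, ∑ i ∈ Finset.range k, ∑ B,
        (if i = (r : ℕ) then (Pi.single A 1 : Fin n → ℝ) else 0) B * f i B = f r A := by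
      intro f
      rw [Finset.sum_eq_single (r : ℕ)]
      · simp [Pi.single_apply]
      · intro i _ hi
        simp [hi]
      · intro hr
        exact absurd (Finset.mem_range.2 (by omega)) hr
    rwa [h2 fun r A => fderiv ℝ (momentum hk L he r A) z v,
      h2 fun r A => momentumRate hk L he r A z] at h1
  · intro h
    have hz1 : v.1 = 1 := by
      have := congrArg Prod.fst hv
      rwa [halfTrunc_fst, halfTrunc_fst] at this
    have hvert' : ∀ w : Fin (2 * k - 1 + 1) → Fin n → ℝ,
        fderiv ℝ (legendreCoord hk L he) z v (halfTrunc n k (0, w))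
          = fderiv ℝ (legendreCoord hk L he) z (0, w) (halfTrunc n k v) := by
      intro w
      obtain ⟨w', rfl⟩ := exists_nat_extension w
      refine (hvert w').2 (Finset.sum_congr rfl fun r hr => Finset.sum_congr rfl fun A _ => ?_)
      have hr' := Finset.mem_range.1 hr
      rw [congrFun (congrFun h ⟨r, by omega⟩) A]
    intro w
    have hw : w = w.1 • v + (0, (w - w.1 • v).2) := by
      refine Prod.ext ?_ ?_
      · simp [hz1]
      · simp
    rw [hw]
    simp only [map_add, map_smul, add_apply, smul_apply,
      hvert']

theorem isInvertible_fderiv_restrictedLegendreCoord (hreg : IsRegularLagrangian hk L)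
    {z : JetCoord n (2 * k - 1)} (hz : z ∈ jetDomain (2 * k - 1) e) :
    (fderiv ℝ (restrictedLegendreCoord hk L he) z).IsInvertible := by
  have hb : (jetOfCoord he z).base ∈ e.source := by
    rw [base_jetOfCoord he hz]; exact e.map_target hz
  have h1 := hreg e he (jetOfCoord he z) hb
  rw [jetCoord_jetOfCoord_self he hz] at h1
  refine ⟨h1.mfderivToContinuousLinearEquiv (by simp), ?_⟩
  exact (h1.mfderivToContinuousLinearEquiv_coe (by simp)).trans mfderiv_eq_fderiv

/-- The solution of the equations of motion in natural coordinates. -/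
noncomputable def dynamicalField (hk : 1 ≤ k) (L : Jet n π k → ℝ)
    {e : OpenPartialHomeomorph E (ℝ × (Fin n → ℝ))}
    (he : IsAdapted n π e) (z : JetCoord n (2 * k - 1)) : JetCoord n (2 * k - 1) :=
  (fderiv ℝ (restrictedLegendreCoord hk L he) z).inverse (legendreRate hk L he z)

/-- This is where regularity gives existence and uniqueness: the equations are a linear system with
invertible matrix. -/
theorem isDynamical_iff_eq (hL : ContMDiff 𝓘(ℝ, JetCoord n k) 𝓘(ℝ, ℝ) ∞ L)
    (hreg : IsRegularLagrangian hk L)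
    {z : JetCoord n (2 * k - 1)} (hz : z ∈ jetDomain (2 * k - 1) e) (v : JetCoord n (2 * k - 1)) :
    IsDynamical hk L he z v ↔ v = dynamicalField hk L he z := by
  rw [isDynamical_iff he hL hz, dynamicalField]
  obtain ⟨Φ, hΦ⟩ := isInvertible_fderiv_restrictedLegendreCoord he hreg hz
  rw [← hΦ, ContinuousLinearMap.inverse_equiv]
  exact Φ.eq_symm_apply.symm

theorem contDiffOn_dynamicalField (hL : ContMDiff 𝓘(ℝ, JetCoord n k) 𝓘(ℝ, ℝ) ∞ L)
    (hreg : IsRegularLagrangian hk L) :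
    ContDiffOn ℝ ∞ (dynamicalField hk L he) (jetDomain (2 * k - 1) e) := by
  have hU := isOpen_jetDomain (2 * k - 1) e
  have h1 : ContDiffOn ℝ ∞ (restrictedLegendreCoord hk L he) (jetDomain (2 * k - 1) e) :=
    (halfTrunc n k).contDiff.contDiffOn.prodMk (contDiffOn_pi.2 fun r => contDiffOn_pi.2 fun A =>
      contDiffOn_momentum he hL r A)
  have h2 : ContDiffOn ℝ ∞ (legendreRate hk L he) (jetDomain (2 * k - 1) e) :=
    ((halfTrunc n k).contDiff.comp contDiff_holonomicVector).contDiffOn.prodMk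
      (contDiffOn_pi.2 fun r => contDiffOn_pi.2 fun A => contDiffOn_momentumRate he hL r A)
  have h3 := h1.fderiv_of_isOpen hU (m := ∞) (by simp)
  intro z hz
  refine ContDiffWithinAt.clm_apply ?_ (h2 z hz)
  obtain ⟨Φ, hΦ⟩ := isInvertible_fderiv_restrictedLegendreCoord he hreg hz
  have h4 : ContDiffAt ℝ ∞ ContinuousLinearMap.inverse
      (fderiv ℝ (restrictedLegendreCoord hk L he) z) := by
    rw [← hΦ]; exact contDiffAt_map_inverse Φ
  exact h4.comp_contDiffWithinAt z (h3 z hz)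

/-- The solution of the equations of motion is holonomic up to the last component. -/
theorem dynamicalField_holonomic (hL : ContMDiff 𝓘(ℝ, JetCoord n k) 𝓘(ℝ, ℝ) ∞ L)
    (hreg : IsRegularLagrangian hk L)
    {z : JetCoord n (2 * k - 1)} (hz : z ∈ jetDomain (2 * k - 1) e) :
    AgreeUpTo (2 * k - 2) (dynamicalField hk L he z) (holonomicVector z) := by
  set v := dynamicalField hk L he z
  have h1 := (isDynamical_iff he hL hz v).1 ((isDynamical_iff_eq he hL hreg hz v).2 rfl)
  rw [fderiv_restrictedLegendreCoord_apply he hL hz, legendreRate, Prod.mk.injEq] at h1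
  have hinj : Function.Injective (fderiv ℝ (restrictedLegendreCoord hk L he) z) := by
    obtain ⟨Φ, hΦ⟩ := isInvertible_fderiv_restrictedLegendreCoord he hreg hz
    rw [← hΦ]; exact Φ.injective
  -- The inclusion of the top slot q_{2k-1}. The truncation and the differentials of p̂^r with r ≥ 1
  -- annihilate its image.
  let ι : (Fin n → ℝ) →L[ℝ] JetCoord n (2 * k - 1) :=
    (ContinuousLinearMap.inr ℝ ℝ _).comp (ContinuousLinearMap.single ℝ (fun _ => Fin n → ℝ) (Fin.last (2 * k - 1)))
  have hι : ∀ a, (ι a).1 = 0 ∧ ∀ i : Fin (2 * k - 1 + 1), (i : ℕ) ≤ 2 * k - 2 → (ι a).2 i = 0 := by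
    refine fun a => ⟨rfl, fun i hi => ?_⟩
    have : i ≠ Fin.last (2 * k - 1) := fun h => by rw [h, Fin.val_last] at hi; omega
    exact Pi.single_eq_of_ne (M := fun _ => Fin n → ℝ) this a
  have hιtrunc : ∀ a, halfTrunc n k (ι a) = 0 := fun a => Prod.ext rfl (funext fun i =>
    (hι a).2 _ (by rw [Fin.val_castLE]; omega))
  have hιmom : ∀ a (r : ℕ) (A : Fin n), r ≠ 0 → fderiv ℝ (momentum hk L he r A) z (ι a) = 0 := by
    intro a r A hr
    rw [(dependsUpTo_momentum he r A).fderiv_apply_eq z (v' := 0), map_zero]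
    exact ⟨rfl, fun i hi => (hι a).2 i (by omega)⟩
  -- The block ∂p̂^0/∂q_{2k-1}. It is injective because on the image of ι it is all that is left of
  -- the derivative of the Legendre map; being square, it is bijective.
  let g : (Fin n → ℝ) →ₗ[ℝ] (Fin n → ℝ) :=
    LinearMap.pi fun A => (fderiv ℝ (momentum hk L he 0 A) z).toLinearMap ∘ₗ ι.toLinearMap
  have hg : Function.Injective g := by
    rw [injective_iff_map_eq_zero]
    intro a ha
    have h2 : ι a = 0 := by
      refine hinj ?_
      rw [map_zero, fderiv_restrictedLegendreCoord_apply he hL hz, hιtrunc]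
      refine Prod.ext rfl (funext fun r => funext fun A => ?_)
      by_cases hr : (r : ℕ) = 0
      · simp only [hr]; exact congrFun ha A
      · exact hιmom a r A hr
    have h3 := congrFun (congrArg Prod.snd h2) (Fin.last (2 * k - 1))
    change Pi.single (M := fun _ => Fin n → ℝ) (Fin.last (2 * k - 1)) a (Fin.last (2 * k - 1)) = 0
      at h3
    rwa [Pi.single_eq_same] at h3
  obtain ⟨a, ha⟩ := LinearMap.injective_iff_surjective.1 hg
    (fun A => fderiv ℝ (momentum hk L he 0 A) z (v - holonomicVector z))
  -- Both sides have the same image under the injective derivative: for r ≥ 1 the prescribed rate is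
  -- d_T p̂^r, the value of dp̂^r on the total derivative, and for r = 0 the vector a was chosen to
  -- match.
  have h4 : v - holonomicVector z = ι a := by
    refine hinj ?_
    rw [fderiv_restrictedLegendreCoord_apply he hL hz, fderiv_restrictedLegendreCoord_apply he hL hz,
      hιtrunc, map_sub, h1.1, sub_self]
    refine Prod.ext rfl (funext fun r => funext fun A => ?_)
    by_cases hr : (r : ℕ) = 0
    · simp only [hr]; exact (congrFun ha A).symm
    · change fderiv ℝ (momentum hk L he r A) z _ = fderiv ℝ (momentum hk L he r A) z (ι a)
      rw [hιmom a r A hr, map_sub]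
      have h5 := congrFun (congrFun h1.2 r) A
      simp only [momentumRate, if_neg hr] at h5
      rw [h5, dT_eq, sub_self]
  have h5 : v = holonomicVector z + ι a := by rw [← h4]; abel
  rw [h5]
  exact ⟨by simp [(hι a).1], fun i hi => by simp [(hι a).2 i hi]⟩

/-- The equations of motion in Hamiltonian form: `v` annihilates the canonical form on the kernel
of the differential of the constraint. -/
theorem isDynamical_iff_constraint (hL : ContMDiff 𝓘(ℝ, JetCoord n k) 𝓘(ℝ, ℝ) ∞ L)
    {z : JetCoord n (2 * k - 1)} (hz : z ∈ jetDomain (2 * k - 1) e) {v : JetCoord n (2 * k - 1)}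
    (hv : v.1 = 1) :
    IsDynamical hk L he z v ↔ ∀ (w : JetCoord n (2 * k - 1)) (β : JetCoord n (k - 1) →L[ℝ] ℝ),
      β (halfTrunc n k (holonomicVector z)) + legendreCoord hk L he z (halfTrunc n k (jetShift w))
        - fderiv ℝ (localLagrangian hk L he) z w = 0 →
      β (halfTrunc n k v) - fderiv ℝ (legendreCoord hk L he) z v (halfTrunc n k w) = 0 := by
  have hid := fderiv_legendreCoord_add he hk hL hz
  constructor
  · rintro ⟨h1, h2⟩ w β hβ
    have h3 := hid w
    rw [h2 w, h1]
    linarith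
  · intro h
    have h1 : halfTrunc n k v = halfTrunc n k (holonomicVector z) := by
      have hφ : ∀ φ : JetCoord n (k - 1) →L[ℝ] ℝ,
          φ (halfTrunc n k v) = φ (halfTrunc n k (holonomicVector z)) := by
        intro φ
        -- With w = 0 the constraint says that β kills the total derivative. Any φ is corrected by a
        -- multiple of dt to achieve this, and v.1 = 1 then turns β(v) = 0 into equality of the
        -- values of φ.
        have h2 := h 0 (φ - φ (halfTrunc n k (holonomicVector z)) •
          ContinuousLinearMap.fst ℝ ℝ _) (by simp [halfTrunc_fst, holonomicVector])
        simp only [map_zero, sub_zero, sub_apply,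
          smul_apply, ContinuousLinearMap.coe_fst', halfTrunc_fst, hv,
          smul_eq_mul, mul_one] at h2
        linarith
      refine Prod.ext (hφ (ContinuousLinearMap.fst ℝ ℝ _)) (funext fun i => funext fun A => ?_)
      exact hφ ((ContinuousLinearMap.proj (φ := fun _ : Fin n => ℝ) A).comp
        ((ContinuousLinearMap.proj (φ := fun _ : Fin (k - 1 + 1) => Fin n → ℝ) i).comp
          (ContinuousLinearMap.snd ℝ ℝ _)))
    refine ⟨h1, fun w => ?_⟩
    have h3 := hid w
    -- For arbitrary w, a multiple of dt serves as β: its coefficient is dictated by the constraint,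
    -- as dt takes the value 1 on the total derivative.
    have h2 := h w ((fderiv ℝ (localLagrangian hk L he) z w
      - legendreCoord hk L he z (halfTrunc n k (jetShift w))) • ContinuousLinearMap.fst ℝ ℝ _)
      (by simp [halfTrunc_fst, holonomicVector])
    simp only [smul_apply, ContinuousLinearMap.coe_fst', halfTrunc_fst, hv,
      smul_eq_mul, mul_one] at h2
    rw [h1]
    linarith


theorem jetTransition_mem_jetOverlap (he' : IsAdapted n π e') {m : ℕ} {z : JetCoord n m}
    (hz : z ∈ jetOverlap m e e') :
    jetTransition m he e' z ∈ jetOverlap m e' e := by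
  have h1 := jetTransition_mem he he' hz
  refine ⟨h1, ?_⟩
  rw [← base_jetOfCoord he' h1, jetOfCoord_jetTransition he he' hz, base_jetOfCoord he hz.1]
  exact e.map_target hz.1

theorem jetTransition_jetTransition {m : ℕ} {z : JetCoord n m} (hz : z ∈ jetOverlap m e e') :
    jetTransition m he' e (jetTransition m he e' z) = z := by
  rw [jetTransition, jetOfCoord_jetTransition he he' hz, jetCoord_jetOfCoord_self he hz.1]

theorem differentiableAt_jetTransition (he' : IsAdapted n π e') {m : ℕ} {z : JetCoord n m}
    (hz : z ∈ jetOverlap m e e') :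
    DifferentiableAt ℝ (jetTransition m he e') z :=
  ((contDiffOn_jetTransition he he').contDiffAt
    ((isOpen_jetOverlap m e e').mem_nhds hz)).differentiableAt (by simp)

theorem fderiv_jetTransition_fderiv_jetTransition {m : ℕ} {z : JetCoord n m}
    (hz : z ∈ jetOverlap m e e') (v : JetCoord n m) :
    fderiv ℝ (jetTransition m he' e) (jetTransition m he e' z)
      (fderiv ℝ (jetTransition m he e') z v) = v := by
  have h1 := (differentiableAt_jetTransition he' he
    (jetTransition_mem_jetOverlap he he' hz)).hasFDerivAt.comp z
    (differentiableAt_jetTransition he he' hz).hasFDerivAt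
  have h2 := (hasFDerivAt_id (𝕜 := ℝ) z).congr_of_eventuallyEq
    (((isOpen_jetOverlap m e e').eventually_mem hz).mono
      fun x hx => jetTransition_jetTransition he he' hx)
  exact congrArg (fun φ => φ v) (h1.unique h2)

theorem jetTrunc_fderiv_jetTransition (he' : IsAdapted n π e') {m r : ℕ} (hr : r ≤ m)
    {z : JetCoord n m}
    (hz : z ∈ jetOverlap m e e') (v : JetCoord n m) :
    jetTrunc hr (fderiv ℝ (jetTransition m he e') z v)
      = fderiv ℝ (jetTransition r he e') (jetTrunc hr z) (jetTrunc hr v) := by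
  have h1 := (jetTrunc (n := n) hr).hasFDerivAt.comp z
    (differentiableAt_jetTransition he he' hz).hasFDerivAt
  have hz' : jetTrunc hr z ∈ jetOverlap r e e' := hz
  have h2 := (differentiableAt_jetTransition he he' hz').hasFDerivAt.comp z
    (jetTrunc hr).hasFDerivAt
  have h3 := h2.congr_of_eventuallyEq (((isOpen_jetOverlap m e e').eventually_mem hz).mono
      fun x hx => jetTrunc_jetTransition he he' hr hx)
  exact congrArg (fun φ => φ v) (h1.unique h3)

/-- The exterior derivative of one-forms on vector spaces commutes with pull-back. -/
theorem fderiv_pullback_sub {V W : Type*} [NormedAddCommGroup V] [NormedSpace ℝ V]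
    [NormedAddCommGroup W] [NormedSpace ℝ W] {θ : V → V →L[ℝ] ℝ} {θ' : W → W →L[ℝ] ℝ} {Φ : V → W}
    {z : V} (hΦ : ContDiffAt ℝ ∞ Φ z) (hθ' : DifferentiableAt ℝ θ' (Φ z))
    (h : ∀ᶠ x in 𝓝 z, θ x = (θ' (Φ x)).comp (fderiv ℝ Φ x)) (v w : V) :
    fderiv ℝ θ z v w - fderiv ℝ θ z w v
      = fderiv ℝ θ' (Φ z) (fderiv ℝ Φ z v) (fderiv ℝ Φ z w)
        - fderiv ℝ θ' (Φ z) (fderiv ℝ Φ z w) (fderiv ℝ Φ z v) := by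
  have hd : DifferentiableAt ℝ (fderiv ℝ Φ) z :=
    (hΦ.fderiv_right (m := ∞) (by simp)).differentiableAt (by simp)
  have h1 := (hθ'.hasFDerivAt.comp z (hΦ.differentiableAt (by simp)).hasFDerivAt).clm_comp
    hd.hasFDerivAt
  have h2 := (h1.congr_of_eventuallyEq h).fderiv
  have hsymm : fderiv ℝ (fderiv ℝ Φ) z v w = fderiv ℝ (fderiv ℝ Φ) z w v :=
    (hΦ.isSymmSndFDerivAt (by
      simp only [minSmoothness_of_isRCLikeNormedField]; exact ENat.LEInfty.out)).eq v w
  rw [h2]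
  simp [hsymm]

/-- Both conditions are invariant: coordinate changes preserve the total derivative, and the forms λ
of the two charts are pull-backs of each other, hence so are their exterior derivatives. -/
theorem IsDynamical.map_jetTransition (hL : ContMDiff 𝓘(ℝ, JetCoord n k) 𝓘(ℝ, ℝ) ∞ L)
    {z v : JetCoord n (2 * k - 1)} (hz : z ∈ jetOverlap (2 * k - 1) e e')
    (h : IsDynamical hk L he z v) :
    IsDynamical hk L he' (jetTransition _ he e' z) (fderiv ℝ (jetTransition _ he e') z v) := by
  have hkk : k - 1 < 2 * k - 1 := by omega
  have htr : ∀ x ∈ jetOverlap (2 * k - 1) e e', ∀ v,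
      halfTrunc n k (fderiv ℝ (jetTransition _ he e') x v)
        = fderiv ℝ (jetTransition (k - 1) he e') (halfTrunc n k x) (halfTrunc n k v) :=
    fun x hx v => jetTrunc_fderiv_jetTransition he he' hkk.le hx v
  refine ⟨?_, fun w' => ?_⟩
  · rw [htr z hz, h.1]
    exact fderiv_jetTransition_holonomicVector he he' hkk hz
  · have hz' := jetTransition_mem_jetOverlap he he' hz
    -- The inverse coordinate change makes the derivative surjective, so every test vector comes
    -- from the first chart.
    obtain ⟨w, rfl⟩ : ∃ w, fderiv ℝ (jetTransition _ he e') z w = w' := by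
      refine ⟨fderiv ℝ (jetTransition _ he' e) (jetTransition _ he e' z) w', ?_⟩
      have := fderiv_jetTransition_fderiv_jetTransition he' he hz' w'
      rwa [jetTransition_jetTransition he he' hz] at this
    have hform : ∀ {e₁ : OpenPartialHomeomorph E (ℝ × (Fin n → ℝ))} (he₁ : IsAdapted n π e₁)
        {x : JetCoord n (2 * k - 1)}, x ∈ jetDomain (2 * k - 1) e₁ →
        HasFDerivAt (fun x => (legendreCoord hk L he₁ x).comp (halfTrunc n k)) _ x :=
      fun he₁ x hx => (hasFDerivAt_legendreCoord (hk := hk) he₁ hL hx).clm_comp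
        (hasFDerivAt_const (halfTrunc n k) x)
    have h1 := fderiv_pullback_sub
      (θ := fun x => (legendreCoord hk L he x).comp (halfTrunc n k))
      (θ' := fun x => (legendreCoord hk L he' x).comp (halfTrunc n k))
      (Φ := jetTransition (2 * k - 1) he e') (z := z)
      ((contDiffOn_jetTransition he he').contDiffAt ((isOpen_jetOverlap _ e e').mem_nhds hz))
      (hform he' hz'.1).differentiableAt
      (((isOpen_jetOverlap _ e e').eventually_mem hz).mono fun x hx => by
        refine ContinuousLinearMap.ext fun u => ?_
        simp only [ContinuousLinearMap.comp_apply, htr x hx]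
        rw [← legendreCoord_jetTransition he he' hL hx]
        rfl) v w
    rw [(hform he hz.1).fderiv, (hform he' hz'.1).fderiv] at h1
    simp only [ContinuousLinearMap.comp_zero, zero_add, ContinuousLinearMap.comp_apply,
      ContinuousLinearMap.compL_apply, ContinuousLinearMap.flip_apply] at h1
    have h2 := h.2 w
    linarith

/-- The transported solution solves the transported equations, whose solution is unique. The local
solutions therefore glue. -/
theorem dynamicalField_jetTransition (hL : ContMDiff 𝓘(ℝ, JetCoord n k) 𝓘(ℝ, ℝ) ∞ L)
    (hreg : IsRegularLagrangian hk L)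
    {z : JetCoord n (2 * k - 1)} (hz : z ∈ jetOverlap (2 * k - 1) e e') :
    fderiv ℝ (jetTransition _ he e') z (dynamicalField hk L he z)
      = dynamicalField hk L he' (jetTransition _ he e' z) :=
  (isDynamical_iff_eq he' hL hreg (jetTransition_mem he he' hz) _).1
    (((isDynamical_iff_eq he hL hreg hz.1 _).2 rfl).map_jetTransition he he' hL hz)

end LocalDynamics

/-! ### Derivatives in charts -/

section Charts

variable {F H M : Type*} [NormedAddCommGroup F] [NormedSpace ℝ F] [TopologicalSpace H]
  {I : ModelWithCorners ℝ F H} [I.Boundaryless] [TopologicalSpace M] [ChartedSpace H M]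
  {F' H' M' : Type*} [NormedAddCommGroup F'] [NormedSpace ℝ F'] [TopologicalSpace H']
  {I' : ModelWithCorners ℝ F' H'} [TopologicalSpace M'] [ChartedSpace H' M']

/-- Tangent spaces are copies of the model space, identified through the preferred chart at the
point. The manifold derivative is thus the derivative of the local expression in the preferred
charts at x and f x, which is how all derivatives below are computed. -/
theorem hasMFDerivAt_of_eventuallyEq {f : M → M'} {x : M} {g : F → F'} {g' : F →L[ℝ] F'}
    (hc : ContinuousAt f x)
    (hfg : ∀ᶠ y in 𝓝 x, extChartAt I' (f x) (f y) = g (extChartAt I x y))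
    (hg : HasFDerivAt g g' (extChartAt I x x)) : HasMFDerivAt I I' f x g' := by
  refine ⟨hc, HasFDerivAt.hasFDerivWithinAt (hg.congr_of_eventuallyEq ?_)⟩
  have h1 : ∀ᶠ z in 𝓝 (extChartAt I x x), z ∈ (extChartAt I x).target :=
    extChartAt_target_mem_nhds x
  have h2 : Tendsto (extChartAt I x).symm (𝓝 (extChartAt I x x)) (𝓝 x) := by
    have := continuousAt_extChartAt_symm (I := I) x
    rwa [ContinuousAt, extChartAt_to_inv] at this
  filter_upwards [h1, h2.eventually hfg] with z hz hz'
  rw [writtenInExtChartAt, Function.comp_apply, Function.comp_apply, hz',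
    (extChartAt I x).right_inv hz]

theorem hasMFDerivAt_extChartAt_self (x : M) :
    HasMFDerivAt I 𝓘(ℝ, F) (extChartAt I x) x (ContinuousLinearMap.id ℝ F) :=
  hasMFDerivAt_of_eventuallyEq (g := id) (continuousAt_extChartAt x)
    (Eventually.of_forall fun _ => rfl) (hasFDerivAt_id _)

end Charts

/-! ### Canonical form of a cotangent bundle in a chart -/

section CotangentChart

variable {F M : Type*} [NormedAddCommGroup F] [NormedSpace ℝ F] [TopologicalSpace M]
  [ChartedSpace F M] [IsManifold 𝓘(ℝ, F) ∞ M]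

/-- The trivialization of the bundle of covectors composes with the inverse of the tangent
trivialization, which is the derivative of the inverse base chart. -/
theorem extChartAt_cotangentBundle (α₀ α : CotangentBundle F M)
    (h : α.1 ∈ (chartAt F α₀.1).source) :
    extChartAt (𝓘(ℝ, F).prod 𝓘(ℝ, F →L[ℝ] ℝ)) α₀ α
      = (extChartAt 𝓘(ℝ, F) α₀.1 α.1, ContinuousLinearMap.comp (M₁ := F) α.2
        (mfderiv 𝓘(ℝ, F) 𝓘(ℝ, F) (extChartAt 𝓘(ℝ, F) α₀.1).symm
          (extChartAt 𝓘(ℝ, F) α₀.1 α.1))) := by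
  have : IsManifold 𝓘(ℝ, F) 1 M := IsManifold.of_le (n := ∞) (by simp)
  rw [FiberBundle.extChartAt]
  refine Prod.ext rfl ?_
  have h2 := TangentBundle.symmL_trivializationAt (I := 𝓘(ℝ, F)) h
  rw [modelWithCornersSelf_coe, range_id, mfderivWithin_univ] at h2
  change ((trivializationAt ℝ (Bundle.Trivial M ℝ) α₀.1).continuousLinearMapAt ℝ α.1).comp
    (ContinuousLinearMap.comp (M₁ := F) α.2
      ((trivializationAt F (fun x : M => TangentSpace 𝓘(ℝ, F) x) α₀.1).symmL ℝ α.1)) = _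
  rw [h2]
  ext v
  simp
  rfl

/-- In the chart induced by a chart of the base, the canonical form is `dq ∧ dp`. -/
theorem canonicalSymplecticForm_eq (α₀ : CotangentBundle F M) (u v : F × (F →L[ℝ] ℝ)) :
    canonicalSymplecticForm F M α₀ u v = v.2 u.1 - u.2 v.1 := by
  set J := 𝓘(ℝ, F).prod 𝓘(ℝ, F →L[ℝ] ℝ) with hJ
  set θc : F × (F →L[ℝ] ℝ) → F × (F →L[ℝ] ℝ) →L[ℝ] ℝ := fun z =>
    ContinuousLinearMap.comp (M₁ := F × (F →L[ℝ] ℝ))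
      (tautologicalForm F M ((extChartAt J α₀).symm z))
      (mfderiv 𝓘(ℝ, F × (F →L[ℝ] ℝ)) J (extChartAt J α₀).symm z) with hθc
  set p := extChartAt J α₀ α₀
  have htarget : ∀ᶠ z in 𝓝 p, z ∈ (extChartAt J α₀).target := extChartAt_target_mem_nhds α₀
  -- Near the point the tautological form reads p dq in the chart.
  have hθ : ∀ᶠ z in 𝓝 p, θc z = z.2.comp (ContinuousLinearMap.fst ℝ F (F →L[ℝ] ℝ)) := by
    have hmem : ∀ z ∈ (extChartAt J α₀).target,
        ((extChartAt J α₀).symm z).1 ∈ (chartAt F α₀.1).source := by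
      intro z hz
      have := (extChartAt J α₀).map_target hz
      rw [extChartAt_source, FiberBundle.chartedSpace_chartAt] at this
      simp only [mfld_simps] at this
      exact this.1.1
    have hz_eq : ∀ z ∈ (extChartAt J α₀).target, z
        = (extChartAt 𝓘(ℝ, F) α₀.1 ((extChartAt J α₀).symm z).1,
          ContinuousLinearMap.comp (M₁ := F) ((extChartAt J α₀).symm z).2
          (mfderiv 𝓘(ℝ, F) 𝓘(ℝ, F) (extChartAt 𝓘(ℝ, F) α₀.1).symm
          (extChartAt 𝓘(ℝ, F) α₀.1 ((extChartAt J α₀).symm z).1))) := by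
      intro z hz
      conv_lhs => rw [← (extChartAt J α₀).right_inv hz]
      exact extChartAt_cotangentBundle α₀ _ (hmem z hz)
    have hopen : IsOpen (extChartAt J α₀).target := isOpen_extChartAt_target α₀
    filter_upwards [htarget] with z hz
    have hz1 := congrArg Prod.fst (hz_eq z hz)
    have hz2 := congrArg Prod.snd (hz_eq z hz)
    simp only at hz1 hz2
    have hzt : z.1 ∈ (extChartAt 𝓘(ℝ, F) α₀.1).target := by
      rw [hz1]
      refine (extChartAt 𝓘(ℝ, F) α₀.1).map_source ?_
      rw [extChartAt_source]; exact hmem z hz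
    have hsymm : MDifferentiableAt 𝓘(ℝ, F × (F →L[ℝ] ℝ)) J (extChartAt J α₀).symm z :=
      ((contMDiffOn_extChartAt_symm (n := 1) α₀).contMDiffAt (hopen.mem_nhds hz)).mdifferentiableAt
        (by simp)
    have hproj : MDifferentiableAt J 𝓘(ℝ, F)
        (Bundle.TotalSpace.proj : CotangentBundle F M → M) ((extChartAt J α₀).symm z) :=
      (Bundle.contMDiff_proj (n := 1) _).contMDiffAt.mdifferentiableAt (by simp)
    have hsymm₀ : MDifferentiableAt 𝓘(ℝ, F) 𝓘(ℝ, F) (extChartAt 𝓘(ℝ, F) α₀.1).symm z.1 :=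
      ((contMDiffOn_extChartAt_symm (n := 1) α₀.1).contMDiffAt
        ((isOpen_extChartAt_target α₀.1).mem_nhds hzt)).mdifferentiableAt (by simp)
    have hfst : HasMFDerivAt 𝓘(ℝ, F × (F →L[ℝ] ℝ)) 𝓘(ℝ, F)
        (Prod.fst : F × (F →L[ℝ] ℝ) → F) z (ContinuousLinearMap.fst ℝ F (F →L[ℝ] ℝ)) :=
      hasFDerivAt_fst.hasMFDerivAt
    -- The bundle projection after the inverse chart of the total space is the inverse base chart
    -- after the first projection.
    have h1 := (hsymm₀.hasMFDerivAt.comp z hfst).congr_of_eventuallyEq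
      (f₁ := Bundle.TotalSpace.proj ∘ (extChartAt J α₀).symm) (by
        filter_upwards [hopen.mem_nhds hz] with x hx
        have hx1 := congrArg Prod.fst (hz_eq x hx)
        simp only at hx1
        rw [Function.comp_apply, Function.comp_apply, hx1, (extChartAt 𝓘(ℝ, F) α₀.1).left_inv]
        rw [extChartAt_source]; exact hmem x hx)
    have h2 := hasMFDerivAt_unique (hproj.hasMFDerivAt.comp z hsymm.hasMFDerivAt) h1
    refine ContinuousLinearMap.ext fun a => ?_
    have h3 := congrArg (fun φ => φ a) h2
    change ((extChartAt J α₀).symm z).2 (mfderiv J 𝓘(ℝ, F) Bundle.TotalSpace.proj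
      ((extChartAt J α₀).symm z)
      (mfderiv 𝓘(ℝ, F × (F →L[ℝ] ℝ)) J (extChartAt J α₀).symm z a)) = z.2 a.1
    rw [hz2, ← hz1]
    exact congrArg ((extChartAt J α₀).symm z).2 h3
  have hder : HasFDerivAt (fun z : F × (F →L[ℝ] ℝ) =>
      z.2.comp (ContinuousLinearMap.fst ℝ F (F →L[ℝ] ℝ))) _ p :=
    hasFDerivAt_snd.clm_comp (hasFDerivAt_const (ContinuousLinearMap.fst ℝ F (F →L[ℝ] ℝ)) p)
  have hfd : ∀ a b : F × (F →L[ℝ] ℝ), fderiv ℝ θc p a b = a.2 b.1 := by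
    intro a b
    rw [Filter.EventuallyEq.fderiv_eq hθ, hder.fderiv]
    simp
  have hdc := (hasMFDerivAt_extChartAt_self (I := J) α₀).mfderiv
  change -(fderiv ℝ θc p (mfderiv J 𝓘(ℝ, F × (F →L[ℝ] ℝ)) (extChartAt J α₀) α₀ u)
      (mfderiv J 𝓘(ℝ, F × (F →L[ℝ] ℝ)) (extChartAt J α₀) α₀ v)
    - fderiv ℝ θc p (mfderiv J 𝓘(ℝ, F × (F →L[ℝ] ℝ)) (extChartAt J α₀) α₀ v)
      (mfderiv J 𝓘(ℝ, F × (F →L[ℝ] ℝ)) (extChartAt J α₀) α₀ u)) = _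
  rw [hdc]
  change -(fderiv ℝ θc p u v - fderiv ℝ θc p v u) = _
  rw [hfd, hfd]
  simp

end CotangentChart

/-! ### Natural charts of jet spaces and the total derivative -/

section JetCharts

variable {n : ℕ} {E : Type*} [TopologicalSpace E] [ChartedSpace (EuclideanSpace ℝ (Fin (n + 1))) E]
  {π : E → ℝ} [IsFibredOverLine n π] {m : ℕ}

/-- The chosen adapted coordinates around the base point of a jet. -/
noncomputable abbrev baseChart (y : Jet n π m) : OpenPartialHomeomorph E (ℝ × (Fin n → ℝ)) :=
  adaptedChartAt n π y.base

theorem isAdapted_baseChart (y : Jet n π m) : IsAdapted n π (baseChart y) :=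
  isAdapted_adaptedChartAt n π y.base

theorem base_mem_baseChart (y : Jet n π m) : y.base ∈ (baseChart y).source :=
  mem_adaptedChartAt_source n π y.base

theorem isOpen_base_mem {e : OpenPartialHomeomorph E (ℝ × (Fin n → ℝ))} (he : IsAdapted n π e) :
    IsOpen {y : Jet n π m | y.base ∈ e.source} := (jetChart m he).open_source

theorem eventually_base_mem {e : OpenPartialHomeomorph E (ℝ × (Fin n → ℝ))} (he : IsAdapted n π e)
    {y : Jet n π m} (hy : y.base ∈ e.source) : ∀ᶠ y' in 𝓝 y, y'.base ∈ e.source :=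
  (isOpen_base_mem he).eventually_mem hy

theorem contMDiffOn_jetCoord {e : OpenPartialHomeomorph E (ℝ × (Fin n → ℝ))}
    (he : IsAdapted n π e) : ContMDiffOn 𝓘(ℝ, JetCoord n m) 𝓘(ℝ, JetCoord n m) ∞
      (jetCoord e : Jet n π m → JetCoord n m) {y | y.base ∈ e.source} :=
  contMDiffOn_of_mem_maximalAtlas (I := 𝓘(ℝ, JetCoord n m)) (n := ∞)
    (IsManifold.subset_maximalAtlas (jetChart_mem_atlas (m := m) he))

theorem mdifferentiableAt_jetCoord {e : OpenPartialHomeomorph E (ℝ × (Fin n → ℝ))}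
    (he : IsAdapted n π e) {y : Jet n π m} (hy : y.base ∈ e.source) :
    MDifferentiableAt 𝓘(ℝ, JetCoord n m) 𝓘(ℝ, JetCoord n m) (jetCoord e) y :=
  ((contMDiffOn_jetCoord he).contMDiffAt ((isOpen_base_mem he).mem_nhds hy)).mdifferentiableAt
    (by simp)

theorem mdifferentiableAt_jetOfCoord {e : OpenPartialHomeomorph E (ℝ × (Fin n → ℝ))}
    (he : IsAdapted n π e) {z : JetCoord n m} (hz : z ∈ jetDomain m e) :
    MDifferentiableAt 𝓘(ℝ, JetCoord n m) 𝓘(ℝ, JetCoord n m)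
      (jetOfCoord he : JetCoord n m → Jet n π m) z :=
  ((contMDiffOn_jetOfCoord he).contMDiffAt ((isOpen_jetDomain m e).mem_nhds hz)).mdifferentiableAt
    (by simp)

theorem jetCoord_mem_jetOverlap {e e' : OpenPartialHomeomorph E (ℝ × (Fin n → ℝ))}
    (he : IsAdapted n π e) {y : Jet n π m} (hy : y.base ∈ e.source) (hy' : y.base ∈ e'.source) :
    jetCoord e y ∈ jetOverlap m e e' := by
  have h := jetCoord_mem_jetDomain he hy
  refine ⟨h, ?_⟩
  rw [← base_jetOfCoord he h, jetOfCoord_jetCoord he hy]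
  exact hy'

theorem jetTransition_jetCoord {e e' : OpenPartialHomeomorph E (ℝ × (Fin n → ℝ))}
    (he : IsAdapted n π e) {y : Jet n π m} (hy : y.base ∈ e.source) :
    jetTransition m he e' (jetCoord e y) = jetCoord e' y := by
  rw [jetTransition, jetOfCoord_jetCoord he hy]

/-- The derivative of natural coordinates in the preferred chart at the point. -/
theorem hasMFDerivAt_jetCoord {e : OpenPartialHomeomorph E (ℝ × (Fin n → ℝ))}
    (he : IsAdapted n π e) {y : Jet n π m} (hy : y.base ∈ e.source) :
    HasMFDerivAt 𝓘(ℝ, JetCoord n m) 𝓘(ℝ, JetCoord n m) (jetCoord e) y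
      (fderiv ℝ (jetTransition m (isAdapted_baseChart y) e) (jetCoord (baseChart y) y)) := by
  have hov := jetCoord_mem_jetOverlap (isAdapted_baseChart y) (base_mem_baseChart y) hy
  refine hasMFDerivAt_of_eventuallyEq
    (mdifferentiableAt_jetCoord he hy).continuousAt ?_
    (differentiableAt_jetTransition (isAdapted_baseChart y) he hov).hasFDerivAt
  filter_upwards [eventually_base_mem (isAdapted_baseChart y) (base_mem_baseChart y)] with y' hy'
  exact (jetTransition_jetCoord (isAdapted_baseChart y) hy').symm

/-- The derivative of the inverse of a natural chart, composed with other natural coordinates. -/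
theorem mfderiv_jetCoord_comp_mfderiv_jetOfCoord {e e' : OpenPartialHomeomorph E (ℝ × (Fin n → ℝ))}
    (he : IsAdapted n π e) (he' : IsAdapted n π e') {z : JetCoord n m}
    (hz : z ∈ jetOverlap m e e') (v : JetCoord n m) :
    mfderiv 𝓘(ℝ, JetCoord n m) 𝓘(ℝ, JetCoord n m) (jetCoord e' : Jet n π m → JetCoord n m)
      (jetOfCoord he z) (mfderiv 𝓘(ℝ, JetCoord n m) 𝓘(ℝ, JetCoord n m)
        (jetOfCoord he : JetCoord n m → Jet n π m) z v)
      = fderiv ℝ (jetTransition m he e') z v := by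
  have h1 := (mdifferentiableAt_jetCoord he' (base_jetOfCoord_mem he hz)).hasMFDerivAt.comp z
    (mdifferentiableAt_jetOfCoord he hz.1).hasMFDerivAt
  have h2 : HasMFDerivAt 𝓘(ℝ, JetCoord n m) 𝓘(ℝ, JetCoord n m) (jetTransition m he e') z _ :=
    (differentiableAt_jetTransition he he' hz).hasFDerivAt.hasMFDerivAt
  exact congrArg (fun φ => φ v) (hasMFDerivAt_unique h1 h2)

/-- The total time derivative in natural coordinates. -/
theorem totalDerivative_eq {r : ℕ} (hr : r < m) {e : OpenPartialHomeomorph E (ℝ × (Fin n → ℝ))}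
    (he : IsAdapted n π e) {y : Jet n π m} (hy : y.base ∈ e.source) :
    totalDerivative hr.le y = mfderiv 𝓘(ℝ, JetCoord n r) 𝓘(ℝ, JetCoord n r)
      (jetOfCoord he : JetCoord n r → Jet n π r) (jetTrunc hr.le (jetCoord e y))
      (jetTrunc hr.le (holonomicVector (jetCoord e y))) := by
  set q : ℝ → Fin n → ℝ := fun s => (e (y.rep s)).2
  have hloc := y.rep_isLocalSection
  have hrep : y.rep y.time ∈ e.source := by
    have := congrArg Jet.base y.mk_rep
    rw [Jet.base_mk] at this
    rw [this]; exact hy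
  have hq : ContDiffAt ℝ ∞ q y.time := hloc.contDiffAt_coord he hrep
  have hz : jetTrunc hr.le (jetCoord e y) ∈ jetDomain r e := jetCoord_mem_jetDomain he hy
  -- Near y.time the representative is still a section with values in the domain of e, so the dummy
  -- value of `jetLift` is never taken.
  have hlift : jetLift r y.rep (y.proj hr.le) =ᶠ[𝓝 y.time] jetOfCoord he ∘ jetCurve r q := by
    have h1 : ∀ᶠ s in 𝓝 y.time, y.rep s ∈ e.source :=
      hloc.contMDiffAt.continuousAt.eventually (e.open_source.mem_nhds hrep)
    filter_upwards [h1, hloc.eventually_nhds] with s hs hs'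
    have hsec : IsLocalSection n π y.rep s := hs'
    rw [jetLift, dif_pos hsec, Function.comp_apply]
    have h2 := jetCoord_mk (m := r) hsec he hs
    have h3 : jetCurve r q s = jetCoord e (Jet.mk r y.rep s hsec) := h2.symm
    rw [h3, jetOfCoord_jetCoord he]
    exact hs
  have hc : HasMFDerivAt 𝓘(ℝ, ℝ) 𝓘(ℝ, JetCoord n r) (jetCurve r q) y.time _ :=
    (hasDerivAt_jetCurve (m := r) hq).hasFDerivAt.hasMFDerivAt
  have ho := (mdifferentiableAt_jetOfCoord he (z := jetCurve r q y.time) hz).hasMFDerivAt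
  have h4 := ((ho.comp y.time hc).congr_of_eventuallyEq hlift).mfderiv
  rw [totalDerivative, h4, jetTrunc_holonomicVector hr]
  change mfderiv 𝓘(ℝ, JetCoord n r) 𝓘(ℝ, JetCoord n r)
    (jetOfCoord he : JetCoord n r → Jet n π r) (jetTrunc hr.le (jetCoord e y))
    ((1 : ℝ) • ((1, fun i => iteratedDeriv (i + 1) q y.time) : JetCoord n r)) = _
  rw [one_smul]
  rfl

end JetCharts

/-! ### The unified space, its two-form and its constraint in charts -/

section UnifiedCharts

variable {n : ℕ} {E : Type*} [TopologicalSpace E] [ChartedSpace (EuclideanSpace ℝ (Fin (n + 1))) E]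
  {π : E → ℝ} [IsFibredOverLine n π] {k : ℕ} {hk : 1 ≤ k} {L : Jet n π k → ℝ}

/-- Preferred charts of all jet spaces are induced from a chart chosen at the point of E alone, so a
jet and its projections use the same coordinates. -/
theorem baseChart_proj {m r : ℕ} (hr : r ≤ m) (y : Jet n π m) :
    baseChart (y.proj hr) = baseChart y := by
  rw [baseChart, Jet.base_proj]

theorem jetCoord_jetProjMap {e : OpenPartialHomeomorph E (ℝ × (Fin n → ℝ))}
    (he : IsAdapted n π e) {y : Jet n π (2 * k - 1)} (hy : y.base ∈ e.source) :
    jetCoord e (jetProjMap n π k y) = halfTrunc n k (jetCoord e y) :=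
  jetCoord_proj (by omega) he hy

theorem base_jetProjMap (y : Jet n π (2 * k - 1)) : (jetProjMap n π k y).base = y.base :=
  Jet.base_proj (by omega) y

/-- The chart is a variable e with an equation, so that `baseChart_proj` can be used without
rewriting inside terms that depend on the chart. -/
theorem extChartAt_cotangentBundle_jet {e : OpenPartialHomeomorph E (ℝ × (Fin n → ℝ))}
    (he : IsAdapted n π e)
    {α₀ α : CotangentBundle (JetCoord n (k - 1)) (Jet n π (k - 1))} (he₀ : e = baseChart α₀.1)
    (h : α.1.base ∈ e.source) :
    extChartAt (𝓘(ℝ, JetCoord n (k - 1)).prod 𝓘(ℝ, JetCoord n (k - 1) →L[ℝ] ℝ)) α₀ α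
      = (jetCoord e α.1, ContinuousLinearMap.comp (M₁ := JetCoord n (k - 1)) α.2
        (mfderiv 𝓘(ℝ, JetCoord n (k - 1)) 𝓘(ℝ, JetCoord n (k - 1))
          (jetOfCoord he : JetCoord n (k - 1) → Jet n π (k - 1)) (jetCoord e α.1))) := by
  subst he₀
  exact extChartAt_cotangentBundle α₀ α h

/-- The chart of `W` at `w₀`. -/
theorem extChartAt_unified (w₀ w : Unified n π k) (h : w.1.base ∈ (baseChart w₀.1).source) :
    extChartAt (unifiedModel n k) w₀ w
      = (jetCoord (baseChart w₀.1) w.1, ContinuousLinearMap.comp (M₁ := JetCoord n (k - 1)) (covector w)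
        (mfderiv 𝓘(ℝ, JetCoord n (k - 1)) 𝓘(ℝ, JetCoord n (k - 1))
          (jetOfCoord (isAdapted_baseChart w₀.1) : JetCoord n (k - 1) → Jet n π (k - 1))
          (halfTrunc n k (jetCoord (baseChart w₀.1) w.1)))) := by
  have h1 := extChartAt_cotangentBundle_jet (isAdapted_baseChart w₀.1) (α₀ := rho2 w₀)
    (α := rho2 w) (baseChart_proj (by omega) w₀.1).symm (by
      change (jetProjMap n π k w.1).base ∈ _
      rw [base_jetProjMap]; exact h)
  refine Prod.ext rfl ?_
  have h2 : (extChartAt (unifiedModel n k) w₀ w).2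
    = (extChartAt (𝓘(ℝ, JetCoord n (k - 1)).prod 𝓘(ℝ, JetCoord n (k - 1) →L[ℝ] ℝ))
        (rho2 w₀) (rho2 w)).2 := rfl
  rw [h2, h1, ← jetCoord_jetProjMap (isAdapted_baseChart w₀.1) h]
  rfl

theorem eventually_base_mem_unified (w₀ : Unified n π k) :
    ∀ᶠ w in 𝓝 w₀, w.1.base ∈ (baseChart w₀.1).source := by
  have h : ContinuousAt (Bundle.TotalSpace.proj : Unified n π k → Jet n π (2 * k - 1)) w₀ :=
    (FiberBundle.continuous_proj _ _).continuousAt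
  exact h.eventually (eventually_base_mem (isAdapted_baseChart w₀.1) (base_mem_baseChart w₀.1))

theorem hasMFDerivAt_rho2 (w₀ : Unified n π k) :
    HasMFDerivAt (unifiedModel n k)
      (𝓘(ℝ, JetCoord n (k - 1)).prod 𝓘(ℝ, JetCoord n (k - 1) →L[ℝ] ℝ)) rho2 w₀
      ((halfTrunc n k).prodMap (ContinuousLinearMap.id ℝ (JetCoord n (k - 1) →L[ℝ] ℝ))) := by
  refine hasMFDerivAt_of_eventuallyEq (g := ((halfTrunc n k).prodMap
      (ContinuousLinearMap.id ℝ (JetCoord n (k - 1) →L[ℝ] ℝ)))) ?_ ?_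
      (ContinuousLinearMap.hasFDerivAt _)
  · exact (Pullback.continuous_lift _ _ (jetProjMap n π k) : _).continuousAt
  · filter_upwards [eventually_base_mem_unified w₀] with w hw
    rw [extChartAt_unified w₀ w hw, extChartAt_cotangentBundle_jet (isAdapted_baseChart w₀.1)
      (α₀ := rho2 w₀) (α := rho2 w) (baseChart_proj (by omega) w₀.1).symm (by
      change (jetProjMap n π k w.1).base ∈ _
      rw [base_jetProjMap]; exact hw)]
    have h := jetCoord_jetProjMap (isAdapted_baseChart w₀.1) hw
    change (jetCoord (baseChart w₀.1) (jetProjMap n π k w.1),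
      ContinuousLinearMap.comp (M₁ := JetCoord n (k - 1)) (covector w)
        (mfderiv 𝓘(ℝ, JetCoord n (k - 1)) 𝓘(ℝ, JetCoord n (k - 1))
          (jetOfCoord (isAdapted_baseChart w₀.1) : JetCoord n (k - 1) → Jet n π (k - 1))
          (jetCoord (baseChart w₀.1) (jetProjMap n π k w.1)))) = _
    rw [h]
    rfl

/-- The canonical form of `W` in the chart at the point. -/
theorem unifiedForm_eq (w₀ : Unified n π k)
    (u v : JetCoord n (2 * k - 1) × (JetCoord n (k - 1) →L[ℝ] ℝ)) :
    unifiedForm w₀ u v = v.2 (halfTrunc n k u.1) - u.2 (halfTrunc n k v.1) := by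
  change canonicalSymplecticForm _ _ (rho2 w₀) (mfderiv (unifiedModel n k)
      (𝓘(ℝ, JetCoord n (k - 1)).prod 𝓘(ℝ, JetCoord n (k - 1) →L[ℝ] ℝ)) rho2 w₀ u)
    (mfderiv (unifiedModel n k)
      (𝓘(ℝ, JetCoord n (k - 1)).prod 𝓘(ℝ, JetCoord n (k - 1) →L[ℝ] ℝ)) rho2 w₀ v) = _
  rw [(hasMFDerivAt_rho2 w₀).mfderiv]
  exact canonicalSymplecticForm_eq (rho2 w₀) (halfTrunc n k u.1, u.2) (halfTrunc n k v.1, v.2)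

theorem jetCoord_fst {m : ℕ} (e : OpenPartialHomeomorph E (ℝ × (Fin n → ℝ))) (y : Jet n π m) :
    (jetCoord e y).1 = y.time := rfl

theorem continuous_time {m : ℕ} : Continuous (Jet.time : Jet n π m → ℝ) := by
  refine continuous_iff_continuousAt.2 fun y => ?_
  exact continuous_fst.continuousAt.comp
    (mdifferentiableAt_jetCoord (isAdapted_baseChart y) (base_mem_baseChart y)).continuousAt

theorem hasMFDerivAt_rhoR (w₀ : Unified n π k) :
    HasMFDerivAt (unifiedModel n k) 𝓘(ℝ, ℝ) rhoR w₀
      ((ContinuousLinearMap.fst ℝ ℝ _).comp (ContinuousLinearMap.fst ℝ (JetCoord n (2 * k - 1))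
        (JetCoord n (k - 1) →L[ℝ] ℝ))) := by
  refine hasMFDerivAt_of_eventuallyEq (g := ((ContinuousLinearMap.fst ℝ ℝ _).comp
    (ContinuousLinearMap.fst ℝ (JetCoord n (2 * k - 1)) (JetCoord n (k - 1) →L[ℝ] ℝ)))) ?_ ?_
      (ContinuousLinearMap.hasFDerivAt _)
  · exact (continuous_time.comp (FiberBundle.continuous_proj _ _)).continuousAt
  · filter_upwards [eventually_base_mem_unified w₀] with w hw
    rw [extChartAt_unified w₀ w hw]
    rfl

/-- The constraint function in the chart of `W`. -/
theorem constraint_eq (w₀ w : Unified n π k) (hw : w.1.base ∈ (baseChart w₀.1).source) :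
    constraint hk L w
      = (extChartAt (unifiedModel n k) w₀ w).2
          (halfTrunc n k (holonomicVector (extChartAt (unifiedModel n k) w₀ w).1))
        - localLagrangian hk L (isAdapted_baseChart w₀.1)
          (extChartAt (unifiedModel n k) w₀ w).1 := by
  rw [extChartAt_unified w₀ w hw, constraint, couplingFunction,
    totalDerivative_eq (by omega : k - 1 < 2 * k - 1) (isAdapted_baseChart w₀.1) hw,
    localLagrangian, jetOfCoord_jetCoord (isAdapted_baseChart w₀.1) hw]
  rfl

/-- In the chart of W the constraint is β(h(z)) - L(z), with h affine of linear part `jetShift`. -/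
theorem hasMFDerivAt_constraint (hL : ContMDiff 𝓘(ℝ, JetCoord n k) 𝓘(ℝ, ℝ) ∞ L)
    (w₀ : Unified n π k) :
    ∃ D : JetCoord n (2 * k - 1) × (JetCoord n (k - 1) →L[ℝ] ℝ) →L[ℝ] ℝ,
      HasMFDerivAt (unifiedModel n k) 𝓘(ℝ, ℝ) (constraint hk L) w₀ D ∧
      ∀ w β, D (w, β)
        = β (halfTrunc n k (holonomicVector (jetCoord (baseChart w₀.1) w₀.1)))
          + (extChartAt (unifiedModel n k) w₀ w₀).2 (halfTrunc n k (jetShift w))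
          - fderiv ℝ (localLagrangian hk L (isAdapted_baseChart w₀.1))
            (jetCoord (baseChart w₀.1) w₀.1) w := by
  let he := isAdapted_baseChart w₀.1
  let g : JetCoord n (2 * k - 1) × (JetCoord n (k - 1) →L[ℝ] ℝ) → ℝ := fun x =>
    x.2 (halfTrunc n k (holonomicVector x.1)) - localLagrangian hk L he x.1
  have key : ∀ p : JetCoord n (2 * k - 1) × (JetCoord n (k - 1) →L[ℝ] ℝ),
      p.1 ∈ jetDomain (2 * k - 1) (baseChart w₀.1) →
      ∃ D : JetCoord n (2 * k - 1) × (JetCoord n (k - 1) →L[ℝ] ℝ) →L[ℝ] ℝ,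
        HasFDerivAt g D p ∧ ∀ w β, D (w, β) = β (halfTrunc n k (holonomicVector p.1))
          + p.2 (halfTrunc n k (jetShift w)) - fderiv ℝ (localLagrangian hk L he) p.1 w := by
    intro p hz
    have hfst : HasFDerivAt (fun x : JetCoord n (2 * k - 1) × (JetCoord n (k - 1) →L[ℝ] ℝ) => x.1)
      (ContinuousLinearMap.fst ℝ _ _) p := hasFDerivAt_fst
    refine ⟨_, ((hasFDerivAt_snd (p := p)).clm_apply (((halfTrunc n k).hasFDerivAt.comp _
      (hasFDerivAt_holonomicVector p.1)).comp p hfst)).sub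
      ((hasFDerivAt_localLagrangian (hk := hk) he hL hz).comp p hfst), fun w β => ?_⟩
    rw [add_comm (β _)]
    rfl
  have hp := congrArg Prod.fst (extChartAt_unified w₀ w₀ (base_mem_baseChart w₀.1))
  have hev : ∀ᶠ w in 𝓝 w₀, constraint hk L w = g (extChartAt (unifiedModel n k) w₀ w) :=
    (eventually_base_mem_unified w₀).mono fun w hw => constraint_eq w₀ w hw
  obtain ⟨D, hD, hD'⟩ := key (extChartAt (unifiedModel n k) w₀ w₀) (by
    rw [hp]; exact jetCoord_mem_jetDomain he (base_mem_baseChart w₀.1))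
  rw [hp] at hD'
  refine ⟨D, hasMFDerivAt_of_eventuallyEq ?_ hev hD, hD'⟩
  exact (ContinuousAt.comp (g := g) hD.continuousAt
    (continuousAt_extChartAt (I := unifiedModel n k) w₀)).congr (hev.mono fun w hw => hw.symm)

end UnifiedCharts

theorem hasDerivAt_of_hasMFDerivAt {F : Type*} [NormedAddCommGroup F] [NormedSpace ℝ F] {f : ℝ → F}
    {f' : ℝ →L[ℝ] F} {s : ℝ} (h : HasMFDerivAt 𝓘(ℝ, ℝ) 𝓘(ℝ, F) f s f') : HasDerivAt f (f' 1) s := by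
  have h1 : HasFDerivAt f f' s := hasMFDerivAt_iff_hasFDerivAt.1 h
  exact h1.hasDerivAt

/-! ### The submanifold W_1 and the solution along it -/

section LegendreGraph

variable {n : ℕ} {E : Type*} [TopologicalSpace E] [ChartedSpace (EuclideanSpace ℝ (Fin (n + 1))) E]
  {π : E → ℝ} [IsFibredOverLine n π] {k : ℕ} {hk : 1 ≤ k} {L : Jet n π k → ℝ}

theorem base_jetProjMap_mem (y : Jet n π (2 * k - 1)) :
    (jetProjMap n π k y).base ∈ (baseChart y).source := by
  rw [base_jetProjMap]; exact base_mem_baseChart y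

theorem legendre_apply (y : Jet n π (2 * k - 1))
    (v : TangentSpace 𝓘(ℝ, JetCoord n (k - 1)) (jetProjMap n π k y)) :
    legendre hk L y v = legendreCoord hk L (isAdapted_baseChart y) (jetCoord (baseChart y) y)
      (mfderiv 𝓘(ℝ, JetCoord n (k - 1)) 𝓘(ℝ, JetCoord n (k - 1))
        (jetCoord (baseChart y) : Jet n π (k - 1) → JetCoord n (k - 1))
            (jetProjMap n π k y) v) := by
  have hd := (mdifferentiableAt_jetCoord (isAdapted_baseChart y) (base_jetProjMap_mem y)).hasMFDerivAt
  have h1 : ∀ φ : JetCoord n (k - 1) →L[ℝ] ℝ, mfderiv 𝓘(ℝ, JetCoord n (k - 1)) 𝓘(ℝ, ℝ)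
      (fun x : Jet n π (k - 1) => φ (jetCoord (baseChart y) x)) (jetProjMap n π k y) v
      = φ (mfderiv 𝓘(ℝ, JetCoord n (k - 1)) 𝓘(ℝ, JetCoord n (k - 1))
        (jetCoord (baseChart y) : Jet n π (k - 1) → JetCoord n (k - 1))
            (jetProjMap n π k y) v) := by
    intro φ
    have h2 : HasMFDerivAt 𝓘(ℝ, JetCoord n (k - 1)) 𝓘(ℝ, ℝ) φ
        (jetCoord (baseChart y) (jetProjMap n π k y)) φ := φ.hasFDerivAt.hasMFDerivAt
    exact congrArg (fun ψ => ψ v) (h2.comp (jetProjMap n π k y) hd).mfderiv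
  refine Eq.trans ?_ (legendreCoord_apply _ _ _).symm
  have ht := h1 (ContinuousLinearMap.fst ℝ ℝ _)
  have hq := fun (r : Fin (k - 1 + 1)) (A : Fin n) => h1 ((ContinuousLinearMap.proj A).comp
    ((ContinuousLinearMap.proj r).comp
      (ContinuousLinearMap.snd ℝ ℝ (Fin (k - 1 + 1) → Fin n → ℝ))))
  rw [legendre, add_apply, sum_apply]
  refine congrArg₂ (· + ·) (congrArg _ ht) (Finset.sum_congr rfl fun r _ => ?_)
  rw [sum_apply]
  exact Finset.sum_congr rfl fun A _ => congrArg _ (hq r A)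

/-- The extended Legendre-Ostrogradsky map in arbitrary natural coordinates. -/
theorem legendre_mfderiv_jetOfCoord (hL : ContMDiff 𝓘(ℝ, JetCoord n k) 𝓘(ℝ, ℝ) ∞ L)
    {e : OpenPartialHomeomorph E (ℝ × (Fin n → ℝ))} (he : IsAdapted n π e)
    {y : Jet n π (2 * k - 1)} (hy : y.base ∈ e.source) (a : JetCoord n (k - 1)) :
    legendre hk L y (mfderiv 𝓘(ℝ, JetCoord n (k - 1)) 𝓘(ℝ, JetCoord n (k - 1))
      (jetOfCoord he : JetCoord n (k - 1) → Jet n π (k - 1)) (halfTrunc n k (jetCoord e y)) a)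
      = legendreCoord hk L he (jetCoord e y) a := by
  have hov := jetCoord_mem_jetOverlap he hy (base_mem_baseChart y)
  have hov' : halfTrunc n k (jetCoord e y) ∈ jetOverlap (k - 1) e (baseChart y) := hov
  have hp : jetProjMap n π k y = jetOfCoord he (halfTrunc n k (jetCoord e y)) := by
    rw [← jetCoord_jetProjMap he hy, jetOfCoord_jetCoord he]
    rw [base_jetProjMap]; exact hy
  have h1 := mfderiv_jetCoord_comp_mfderiv_jetOfCoord he (isAdapted_baseChart y) hov' a
  rw [← hp] at h1
  have h2 := legendreCoord_jetTransition (hk := hk) he (isAdapted_baseChart y) hL hov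
  rw [jetTransition_jetCoord he hy] at h2
  refine (legendre_apply y _).trans ((congrArg _ h1).trans ?_)
  exact congrArg (fun φ => φ a) h2

/-- `legendre` at y is defined through the chart chosen at y. Coordinate independence lets it be
read in the fixed chart at y₀, where W_1 becomes the graph of the smooth map `legendreCoord`. -/
theorem extChartAt_legendreGraph (hL : ContMDiff 𝓘(ℝ, JetCoord n k) 𝓘(ℝ, ℝ) ∞ L)
    (y₀ y : Jet n π (2 * k - 1)) (hy : y.base ∈ (baseChart y₀).source) :
    extChartAt (unifiedModel n k) (legendreGraph hk L y₀) (legendreGraph hk L y)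
      = (jetCoord (baseChart y₀) y,
        legendreCoord hk L (isAdapted_baseChart y₀) (jetCoord (baseChart y₀) y)) := by
  rw [extChartAt_unified _ _ hy]
  refine Prod.ext rfl (ContinuousLinearMap.ext fun a => ?_)
  exact legendre_mfderiv_jetOfCoord hL (isAdapted_baseChart y₀) hy a

theorem contMDiff_legendreGraph (hL : ContMDiff 𝓘(ℝ, JetCoord n k) 𝓘(ℝ, ℝ) ∞ L) :
    ContMDiff 𝓘(ℝ, JetCoord n (2 * k - 1)) (unifiedModel n k) ∞ (legendreGraph hk L) := by
  intro y₀
  have he := isAdapted_baseChart y₀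
  have hy₀ := base_mem_baseChart y₀
  refine Bundle.contMDiffAt_totalSpace.2 ⟨contMDiffAt_id, ?_⟩
  have h1 : ContMDiffAt 𝓘(ℝ, JetCoord n (2 * k - 1)) 𝓘(ℝ, JetCoord n (k - 1) →L[ℝ] ℝ) ∞
      (fun y => legendreCoord hk L he (jetCoord (baseChart y₀) y)) y₀ :=
    ContMDiffAt.comp y₀ ((contDiffOn_legendreCoord he hL).contDiffAt
      ((isOpen_jetDomain _ _).mem_nhds (jetCoord_mem_jetDomain he hy₀))).contMDiffAt
      ((contMDiffOn_jetCoord he).contMDiffAt ((isOpen_base_mem he).mem_nhds hy₀))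
  refine h1.congr_of_eventuallyEq ((eventually_base_mem he hy₀).mono fun y hy => ?_)
  have h2 := congrArg Prod.snd (extChartAt_legendreGraph (hk := hk) hL y₀ y hy)
  rw [FiberBundle.extChartAt] at h2
  exact h2

theorem hasMFDerivAt_legendreGraph (hL : ContMDiff 𝓘(ℝ, JetCoord n k) 𝓘(ℝ, ℝ) ∞ L)
    (y : Jet n π (2 * k - 1)) :
    HasMFDerivAt 𝓘(ℝ, JetCoord n (2 * k - 1)) (unifiedModel n k) (legendreGraph hk L) y
      ((ContinuousLinearMap.id ℝ (JetCoord n (2 * k - 1))).prod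
        (fderiv ℝ (legendreCoord hk L (isAdapted_baseChart y)) (jetCoord (baseChart y) y))) := by
  refine hasMFDerivAt_of_eventuallyEq
    (g := fun z => (z, legendreCoord hk L (isAdapted_baseChart y) z))
    (contMDiff_legendreGraph hL).continuous.continuousAt ?_
    ((hasFDerivAt_id _).prodMk (hasFDerivAt_legendreCoord (isAdapted_baseChart y) hL
      (jetCoord_mem_jetDomain (isAdapted_baseChart y) (base_mem_baseChart y))))
  filter_upwards [eventually_base_mem (isAdapted_baseChart y) (base_mem_baseChart y)] with y' hy'
  exact extChartAt_legendreGraph hL y y' hy'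

/-- The vector field on `J^{2k-1} π` defined by the equations of motion. -/
noncomputable def motionField (hk : 1 ≤ k) (L : Jet n π k → ℝ) (y : Jet n π (2 * k - 1)) :
    TangentSpace 𝓘(ℝ, JetCoord n (2 * k - 1)) y :=
  dynamicalField hk L (isAdapted_baseChart y) (jetCoord (baseChart y) y)

/-- `motionField` at y is expressed in the chart at y, which varies with y. In any fixed chart it is
the smooth `dynamicalField`, which gives both its smoothness and its behaviour along curves. -/
theorem fderiv_jetTransition_motionField (hL : ContMDiff 𝓘(ℝ, JetCoord n k) 𝓘(ℝ, ℝ) ∞ L)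
    (hreg : IsRegularLagrangian hk L) {e : OpenPartialHomeomorph E (ℝ × (Fin n → ℝ))}
    (he : IsAdapted n π e) {y : Jet n π (2 * k - 1)} (hy : y.base ∈ e.source) :
    fderiv ℝ (jetTransition (2 * k - 1) (isAdapted_baseChart y) e) (jetCoord (baseChart y) y)
      (motionField hk L y) = dynamicalField hk L he (jetCoord e y) := by
  have h := dynamicalField_jetTransition (isAdapted_baseChart y) he hL hreg
    (jetCoord_mem_jetOverlap (isAdapted_baseChart y) (base_mem_baseChart y) hy)
  rw [jetTransition_jetCoord (isAdapted_baseChart y) (base_mem_baseChart y)] at h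
  exact h

theorem mfderiv_jetCoord_motionField (hL : ContMDiff 𝓘(ℝ, JetCoord n k) 𝓘(ℝ, ℝ) ∞ L)
    (hreg : IsRegularLagrangian hk L) {e : OpenPartialHomeomorph E (ℝ × (Fin n → ℝ))}
    (he : IsAdapted n π e) {y : Jet n π (2 * k - 1)} (hy : y.base ∈ e.source) :
    mfderiv 𝓘(ℝ, JetCoord n (2 * k - 1)) 𝓘(ℝ, JetCoord n (2 * k - 1)) (jetCoord e) y
      (motionField hk L y) = dynamicalField hk L he (jetCoord e y) :=
  (congrArg (fun φ => φ (motionField hk L y)) (hasMFDerivAt_jetCoord he hy).mfderiv).trans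
    (fderiv_jetTransition_motionField hL hreg he hy)

theorem contMDiff_motionField (hL : ContMDiff 𝓘(ℝ, JetCoord n k) 𝓘(ℝ, ℝ) ∞ L)
    (hreg : IsRegularLagrangian hk L) :
    ContMDiff 𝓘(ℝ, JetCoord n (2 * k - 1)) 𝓘(ℝ, JetCoord n (2 * k - 1)).tangent ∞
      (fun y => (⟨y, motionField hk L y⟩ :
        TangentBundle 𝓘(ℝ, JetCoord n (2 * k - 1)) (Jet n π (2 * k - 1)))) := by
  intro y₀
  have he := isAdapted_baseChart y₀
  have hy₀ := base_mem_baseChart y₀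
  refine (Bundle.contMDiffAt_section y₀).2 ?_
  have h1 : ContMDiffAt 𝓘(ℝ, JetCoord n (2 * k - 1)) 𝓘(ℝ, JetCoord n (2 * k - 1)) ∞
      (fun y => dynamicalField hk L he (jetCoord (baseChart y₀) y)) y₀ :=
    ContMDiffAt.comp y₀ ((contDiffOn_dynamicalField he hL hreg).contDiffAt
      ((isOpen_jetDomain _ _).mem_nhds (jetCoord_mem_jetDomain he hy₀))).contMDiffAt
      ((contMDiffOn_jetCoord he).contMDiffAt ((isOpen_base_mem he).mem_nhds hy₀))
  refine h1.congr_of_eventuallyEq ((eventually_base_mem he hy₀).mono fun y hy => ?_)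
  refine Eq.trans ?_ (fderiv_jetTransition_motionField hL hreg he hy)
  refine (congrArg Prod.snd (TangentBundle.trivializationAt_apply y₀ ⟨y, motionField hk L y⟩)).trans ?_
  have h2 : ∀ (f : JetCoord n (2 * k - 1) → JetCoord n (2 * k - 1)) x,
      fderivWithin ℝ f (range 𝓘(ℝ, JetCoord n (2 * k - 1))) x = fderiv ℝ f x := fun f x => by
    rw [modelWithCornersSelf_coe, range_id, fderivWithin_univ]
  exact congrArg (fun φ => φ (motionField hk L y : JetCoord n (2 * k - 1))) (h2 _ _)

theorem motionField_fst (hL : ContMDiff 𝓘(ℝ, JetCoord n k) 𝓘(ℝ, ℝ) ∞ L)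
    (hreg : IsRegularLagrangian hk L) (y : Jet n π (2 * k - 1)) :
    (motionField hk L y : JetCoord n (2 * k - 1)).1 = 1 :=
  (dynamicalField_holonomic (isAdapted_baseChart y) hL hreg
    (jetCoord_mem_jetDomain (isAdapted_baseChart y) (base_mem_baseChart y))).1

theorem mem_tangentWo_legendreGraph_iff (hL : ContMDiff 𝓘(ℝ, JetCoord n k) 𝓘(ℝ, ℝ) ∞ L)
    (y : Jet n π (2 * k - 1)) (w : JetCoord n (2 * k - 1)) (β : JetCoord n (k - 1) →L[ℝ] ℝ) :
    ((w, β) : JetCoord n (2 * k - 1) × (JetCoord n (k - 1) →L[ℝ] ℝ))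
        ∈ tangentWo hk L (legendreGraph hk L y) ↔
      β (halfTrunc n k (holonomicVector (jetCoord (baseChart y) y)))
        + legendreCoord hk L (isAdapted_baseChart y) (jetCoord (baseChart y) y)
          (halfTrunc n k (jetShift w))
        - fderiv ℝ (localLagrangian hk L (isAdapted_baseChart y))
            (jetCoord (baseChart y) y) w = 0 := by
  obtain ⟨D, hD, hD'⟩ := hasMFDerivAt_constraint (hk := hk) hL (legendreGraph hk L y)
  rw [extChartAt_legendreGraph hL y y (base_mem_baseChart y)] at hD'
  have h : mfderiv (unifiedModel n k) 𝓘(ℝ, ℝ) (constraint hk L) (legendreGraph hk L y) (w, β)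
    = D (w, β) := congrArg (fun φ => φ (w, β)) hD.mfderiv
  have h' := h.trans (hD' w β)
  exact ⟨fun hm => h'.symm.trans hm, fun hm => h'.trans hm⟩

theorem mfderiv_legendreGraph_apply (hL : ContMDiff 𝓘(ℝ, JetCoord n k) 𝓘(ℝ, ℝ) ∞ L)
    (y : Jet n π (2 * k - 1)) (v : JetCoord n (2 * k - 1)) :
    mfderiv 𝓘(ℝ, JetCoord n (2 * k - 1)) (unifiedModel n k) (legendreGraph hk L) y v
      = (v, fderiv ℝ (legendreCoord hk L (isAdapted_baseChart y)) (jetCoord (baseChart y) y) v) :=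
  congrArg (fun φ : JetCoord n (2 * k - 1) →L[ℝ]
    JetCoord n (2 * k - 1) × (JetCoord n (k - 1) →L[ℝ] ℝ) => φ v)
    (hasMFDerivAt_legendreGraph hL y).mfderiv

/-- Ĉ - L̂ vanishes on W_1; infinitesimally this is `fderiv_legendreCoord_add`. -/
theorem mfderiv_legendreGraph_mem_tangentWo (hL : ContMDiff 𝓘(ℝ, JetCoord n k) 𝓘(ℝ, ℝ) ∞ L)
    (y : Jet n π (2 * k - 1)) (v : JetCoord n (2 * k - 1)) :
    mfderiv 𝓘(ℝ, JetCoord n (2 * k - 1)) (unifiedModel n k) (legendreGraph hk L) y v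
      ∈ tangentWo hk L (legendreGraph hk L y) := by
  rw [mfderiv_legendreGraph_apply hL y v]
  refine (mem_tangentWo_legendreGraph_iff hL y _ _).2 ?_
  rw [sub_eq_zero]
  exact fderiv_legendreCoord_add (isAdapted_baseChart y) hk hL
    (jetCoord_mem_jetDomain (isAdapted_baseChart y) (base_mem_baseChart y)) v

/-- Among the vectors tangent to `W_1`, the dynamical equations single out one. -/
theorem unifiedForm_legendreGraph_eq_zero_iff (hL : ContMDiff 𝓘(ℝ, JetCoord n k) 𝓘(ℝ, ℝ) ∞ L)
    (hreg : IsRegularLagrangian hk L) (y : Jet n π (2 * k - 1)) {v : JetCoord n (2 * k - 1)}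
    (hv : v.1 = 1) :
    (∀ u ∈ tangentWo hk L (legendreGraph hk L y), unifiedForm (legendreGraph hk L y)
      (mfderiv 𝓘(ℝ, JetCoord n (2 * k - 1)) (unifiedModel n k) (legendreGraph hk L) y v) u = 0)
      ↔ v = motionField hk L y := by
  have hz := jetCoord_mem_jetDomain (isAdapted_baseChart y) (base_mem_baseChart y)
  refine Iff.trans ?_ ((isDynamical_iff_constraint (isAdapted_baseChart y) hL hz hv).symm.trans
    (isDynamical_iff_eq (isAdapted_baseChart y) hL hreg hz v))
  have hform : ∀ (w : JetCoord n (2 * k - 1)) (β : JetCoord n (k - 1) →L[ℝ] ℝ),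
      unifiedForm (legendreGraph hk L y)
        (mfderiv 𝓘(ℝ, JetCoord n (2 * k - 1)) (unifiedModel n k) (legendreGraph hk L) y v) (w, β)
      = β (halfTrunc n k v) - fderiv ℝ (legendreCoord hk L (isAdapted_baseChart y))
          (jetCoord (baseChart y) y) v (halfTrunc n k w) := by
    intro w β
    rw [mfderiv_legendreGraph_apply hL y v]
    exact unifiedForm_eq (legendreGraph hk L y) (v, _) (w, β)
  constructor
  · intro h w β hw
    exact (hform w β).symm.trans (h _ ((mem_tangentWo_legendreGraph_iff hL y w β).2 hw))
  · rintro h ⟨w, β⟩ hu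
    exact (hform w β).trans (h w β ((mem_tangentWo_legendreGraph_iff hL y w β).1 hu))

theorem mfderiv_rhoR_mfderiv_legendreGraph (hL : ContMDiff 𝓘(ℝ, JetCoord n k) 𝓘(ℝ, ℝ) ∞ L)
    (y : Jet n π (2 * k - 1)) (v : JetCoord n (2 * k - 1)) :
    mfderiv (unifiedModel n k) 𝓘(ℝ, ℝ) rhoR (legendreGraph hk L y)
      (mfderiv 𝓘(ℝ, JetCoord n (2 * k - 1)) (unifiedModel n k) (legendreGraph hk L) y v) = v.1 := by
  rw [mfderiv_legendreGraph_apply hL y v]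
  exact congrArg (fun φ : JetCoord n (2 * k - 1) × (JetCoord n (k - 1) →L[ℝ] ℝ) →L[ℝ] ℝ =>
    φ (v, _)) (hasMFDerivAt_rhoR (legendreGraph hk L y)).mfderiv

/-- The solution of the dynamical equations along `W_1`. -/
noncomputable def unifiedField (hk : 1 ≤ k) (L : Jet n π k → ℝ) : FieldAlongW1 hk L := fun w =>
  mfderiv 𝓘(ℝ, JetCoord n (2 * k - 1)) (unifiedModel n k) (legendreGraph hk L) w.1.1
    (motionField hk L w.1.1)

theorem isSmooth_unifiedField (hL : ContMDiff 𝓘(ℝ, JetCoord n k) 𝓘(ℝ, ℝ) ∞ L)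
    (hreg : IsRegularLagrangian hk L) : (unifiedField hk L).IsSmooth :=
  ((contMDiff_legendreGraph hL).contMDiff_tangentMap (m := ∞) (by simp)).comp
    (contMDiff_motionField hL hreg)

/-- The velocity of the projection to `J^{2k-1} π` of an integral curve. -/
theorem hasMFDerivAt_proj_integralSection (hL : ContMDiff 𝓘(ℝ, JetCoord n k) 𝓘(ℝ, ℝ) ∞ L)
    {ψ : ℝ → Unified n π k} {s : ℝ}
    (hψ : MDifferentiableAt 𝓘(ℝ, ℝ) (unifiedModel n k) ψ s) (hs : ψ s ∈ W1 hk L)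
    (h : mfderiv 𝓘(ℝ, ℝ) (unifiedModel n k) ψ s (1 : ℝ) = unifiedField hk L ⟨ψ s, hs⟩) :
    MDifferentiableAt 𝓘(ℝ, ℝ) 𝓘(ℝ, JetCoord n (2 * k - 1)) (fun s => (ψ s).1) s ∧
    mfderiv 𝓘(ℝ, ℝ) 𝓘(ℝ, JetCoord n (2 * k - 1)) (fun s => (ψ s).1) s (1 : ℝ)
      = motionField hk L (ψ s).1 := by
  have hp : ∀ w : Unified n π k, MDifferentiableAt (unifiedModel n k) 𝓘(ℝ, JetCoord n (2 * k - 1))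
      (Bundle.TotalSpace.proj : Unified n π k → Jet n π (2 * k - 1)) w := fun w =>
    (Bundle.contMDiff_proj (n := 1) _).contMDiffAt.mdifferentiableAt (by simp)
  have h1 := (hp (ψ s)).hasMFDerivAt.comp s hψ.hasMFDerivAt
  refine ⟨h1.mdifferentiableAt, ?_⟩
  -- The projection W → J^{2k-1}π is a left inverse of the graph map, so it recovers v from its
  -- push-forward.
  have h2 : ∀ (y : Jet n π (2 * k - 1)) (v : TangentSpace 𝓘(ℝ, JetCoord n (2 * k - 1)) y),
      mfderiv (unifiedModel n k) 𝓘(ℝ, JetCoord n (2 * k - 1))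
      (Bundle.TotalSpace.proj : Unified n π k → Jet n π (2 * k - 1)) (legendreGraph hk L y)
      (mfderiv 𝓘(ℝ, JetCoord n (2 * k - 1)) (unifiedModel n k) (legendreGraph hk L) y v) = v := by
    intro y v
    have h3 := (hp (legendreGraph hk L y)).hasMFDerivAt.comp y
      ((hasMFDerivAt_legendreGraph hL y).mdifferentiableAt).hasMFDerivAt
    exact congrArg (fun φ => φ v) (hasMFDerivAt_unique h3 (hasMFDerivAt_id y))
  refine (congrArg (fun φ => φ (1 : ℝ)) h1.mfderiv).trans ?_
  refine (congrArg (mfderiv (unifiedModel n k) 𝓘(ℝ, JetCoord n (2 * k - 1))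
      (Bundle.TotalSpace.proj : Unified n π k → Jet n π (2 * k - 1)) (ψ s)) h).trans ?_
  generalize ψ s = w at hs
  obtain ⟨y, rfl⟩ := hs
  exact h2 y _

end LegendreGraph

/-! ### Holonomy of integral sections and the main theorem -/

section Holonomy

variable {n : ℕ} {E : Type*} [TopologicalSpace E] [ChartedSpace (EuclideanSpace ℝ (Fin (n + 1))) E]
  {π : E → ℝ} [IsFibredOverLine n π] {k : ℕ} {hk : 1 ≤ k} {L : Jet n π k → ℝ}

/-- A curve in `J^m π` which is a section over `ℝ` and whose coordinates satisfy `q_i' = q_{i+1}`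
for `i < m` is the lift of its projection to `E`. -/
theorem exists_eq_mk_of_hasDerivAt {m : ℕ} {c : ℝ → Jet n π m} {V : Set ℝ} (hV : IsOpen V)
    (hc : ContMDiffOn 𝓘(ℝ, ℝ) 𝓘(ℝ, JetCoord n m) ∞ c V) (htime : ∀ s ∈ V, (c s).time = s)
    {e : OpenPartialHomeomorph E (ℝ × (Fin n → ℝ))} (he : IsAdapted n π e)
    (hsrc : ∀ s ∈ V, (c s).base ∈ e.source)
    (hder : ∀ s ∈ V, ∃ c' : JetCoord n m, HasDerivAt (fun s => jetCoord e (c s)) c' s ∧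
      AgreeUpTo (m - 1) c' (holonomicVector (jetCoord e (c s)))) {t : ℝ} (ht : t ∈ V) :
    ∃ h : IsLocalSection n π (fun s => (c s).base) t,
      c t = Jet.mk m (fun s => (c s).base) t h := by
  have hsm : ContMDiffOn 𝓘(ℝ, ℝ) 𝓘(ℝ, JetCoord n m) ∞ (fun s => jetCoord e (c s)) V :=
    (contMDiffOn_jetCoord he).comp hc hsrc
  have hsm' : ContDiffOn ℝ ∞ (fun s => (s, (jetCoord e (c s)).2 0)) V := by
    have h1 : ContDiff ℝ ∞ (fun z : JetCoord n m => z.2 0) := by fun_prop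
    exact contDiffOn_id.prodMk (h1.comp_contDiffOn hsm.contDiffOn)
  have hdom : ∀ s ∈ V, jetCoord e (c s) ∈ jetDomain m e := fun s hs =>
    jetCoord_mem_jetDomain he (hsrc s hs)
  have htgt : ∀ s ∈ V, (s, (jetCoord e (c s)).2 0) ∈ e.target := fun s hs => by
    have := hdom s hs
    rw [jetDomain, mem_ofPred_eq, jetCoord_fst, htime s hs] at this
    exact this
  have hbase : ∀ s ∈ V, (c s).base = e.symm (s, (jetCoord e (c s)).2 0) := fun s hs => by
    have := base_jetOfCoord he (hdom s hs)
    rwa [jetOfCoord_jetCoord he (hsrc s hs), jetCoord_fst, htime s hs] at this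
  have hcoord : ∀ s ∈ V, e (c s).base = (s, (jetCoord e (c s)).2 0) := fun s hs => by
    rw [hbase s hs, e.right_inv (htgt s hs)]
  have hφ : ContMDiffOn 𝓘(ℝ, ℝ) (𝓡 (n + 1)) ∞ (fun s => (c s).base) V :=
    (he.contMDiffOn_symm.comp hsm'.contMDiffOn htgt).congr hbase
  have hloc : IsLocalSection n π (fun s => (c s).base) t := by
    filter_upwards [hV.mem_nhds ht] with s hs
    refine ⟨?_, hφ.contMDiffAt (hV.mem_nhds hs)⟩
    rw [← he.fst_eq _ (hsrc s hs), hcoord s hs]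
  refine ⟨hloc, jetCoord_injOn he (hsrc t ht) (hsrc t ht) ?_⟩
  rw [jetCoord_mk hloc he (hsrc t ht)]
  -- Each equation q_i' = q_{i+1} identifies the next coordinate with the next derivative of q_0.
  -- The claim is made on the whole open set V so that it can be differentiated.
  have hiter : ∀ i (hi : i < m + 1), ∀ s ∈ V,
      iteratedDeriv i (fun s => (e (c s).base).2) s = (jetCoord e (c s)).2 ⟨i, hi⟩ := by
    intro i
    induction i with
    | zero =>
      intro hi s hs
      rw [iteratedDeriv_zero, hcoord s hs]
      rfl
    | succ i ih =>
      intro hi s hs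
      obtain ⟨c', hc', hagree⟩ := hder s hs
      have h1 : HasDerivAt (fun s => (jetCoord e (c s)).2 ⟨i, by omega⟩) (c'.2 ⟨i, by omega⟩) s :=
        hasDerivAt_pi.1 (hasFDerivAt_snd.comp_hasDerivAt s hc') ⟨i, by omega⟩
      have h2 : iteratedDeriv i (fun s => (e (c s).base).2)
          =ᶠ[𝓝 s] fun s => (jetCoord e (c s)).2 ⟨i, by omega⟩ := by
        filter_upwards [hV.mem_nhds hs] with s' hs'
        exact ih (by omega) s' hs'
      rw [iteratedDeriv_succ, h2.deriv_eq, h1.deriv, hagree.2 ⟨i, by omega⟩ (by simp; omega),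
        holonomicVector]
      exact dif_pos hi
  exact Prod.ext (htime t ht) (funext fun i => (hiter i i.2 t ht).symm)

theorem isSemisprayOfTypeOne_unifiedField (hL : ContMDiff 𝓘(ℝ, JetCoord n k) 𝓘(ℝ, ℝ) ∞ L)
    (hreg : IsRegularLagrangian hk L) : (unifiedField hk L).IsSemisprayOfTypeOne := by
  rintro ψ U hU ⟨hψ, hsec, hint⟩ t ht
  have he := isAdapted_baseChart (ψ t).1
  have hc : ContMDiffOn 𝓘(ℝ, ℝ) 𝓘(ℝ, JetCoord n (2 * k - 1)) ∞ (fun s => (ψ s).1) U :=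
    (Bundle.contMDiff_proj _).comp_contMDiffOn hψ
  -- Holonomy is local in time: around t the curve stays in one natural chart.
  have hV : IsOpen (U ∩ (fun s => (ψ s).1) ⁻¹' {y | y.base ∈ (baseChart (ψ t).1).source}) :=
    hc.continuousOn.isOpen_inter_preimage hU (isOpen_base_mem he)
  refine exists_eq_mk_of_hasDerivAt hV (hc.mono inter_subset_left) (fun s hs => hsec s hs.1) he
    (fun s hs => hs.2) (fun s hs => ?_) ⟨ht, base_mem_baseChart _⟩
  obtain ⟨hs1, hs2⟩ := hint s hs.1
  obtain ⟨h1, h2⟩ := hasMFDerivAt_proj_integralSection hL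
    ((hψ.contMDiffAt (hU.mem_nhds hs.1)).mdifferentiableAt (by simp)) hs1 hs2
  refine ⟨dynamicalField hk L he (jetCoord (baseChart (ψ t).1) (ψ s).1), ?_, ?_⟩
  · have h3 := (mdifferentiableAt_jetCoord he hs.2).hasMFDerivAt.comp s h1.hasMFDerivAt
    refine (hasDerivAt_of_hasMFDerivAt h3).congr_deriv ?_
    refine Eq.trans ?_ (mfderiv_jetCoord_motionField hL hreg he hs.2)
    exact congrArg (mfderiv 𝓘(ℝ, JetCoord n (2 * k - 1)) 𝓘(ℝ, JetCoord n (2 * k - 1))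
      (jetCoord (baseChart (ψ t).1)) (ψ s).1) h2
  · have h6 := dynamicalField_holonomic (hk := hk) he hL hreg
      (jetCoord_mem_jetDomain (y := (ψ s).1) he hs.2)
    rw [show 2 * k - 2 = 2 * k - 1 - 1 by omega] at h6
    exact h6

end Holonomy

theorem mainTheorem6 {n : ℕ} {E : Type*} [TopologicalSpace E]
    [ChartedSpace (EuclideanSpace ℝ (Fin (n + 1))) E] [IsManifold (𝓡 (n + 1)) ∞ E]
    (π : E → ℝ) [IsFibredOverLine n π] {k : ℕ} (hk : 1 ≤ k)
    (L : Jet n π k → ℝ) (hL : ContMDiff 𝓘(ℝ, JetCoord n k) 𝓘(ℝ, ℝ) ∞ L)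
    (hreg : IsRegularLagrangian hk L) :
    ∃ X : FieldAlongW1 hk L,
      X.IsSmooth ∧ X.IsFieldOnWo ∧ X.SolvesDynamicalEquations ∧ X.IsTangentToW1 ∧
      X.IsSemisprayOfTypeOne ∧
      ∀ Y : FieldAlongW1 hk L,
        Y.IsFieldOnWo → Y.SolvesDynamicalEquations → Y.IsTangentToW1 → Y = X := by
  refine ⟨unifiedField hk L, isSmooth_unifiedField hL hreg, ?_, ⟨?_, ?_⟩, fun y => ⟨_, rfl⟩,
    isSemisprayOfTypeOne_unifiedField hL hreg, fun Y _ hY hYtan => ?_⟩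
  · rintro ⟨_, y, rfl⟩
    exact mfderiv_legendreGraph_mem_tangentWo hL y _
  · rintro ⟨_, y, rfl⟩
    exact (unifiedForm_legendreGraph_eq_zero_iff hL hreg y (motionField_fst hL hreg y)).2 rfl
  · rintro ⟨_, y, rfl⟩
    exact (mfderiv_rhoR_mfderiv_legendreGraph hL y _).trans (motionField_fst hL hreg y)
  · funext w
    obtain ⟨_, y, rfl⟩ := w
    -- Tangency writes Y at this point as the push-forward of some v. The time equation gives v.1 =
    -- 1, and the form equation then determines v.
    obtain ⟨v, hv⟩ := hYtan y
    have h1 := hY.2 ⟨legendreGraph hk L y, mem_range_self y⟩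
    have h2 := hY.1 ⟨legendreGraph hk L y, mem_range_self y⟩
    rw [← hv] at h1 h2
    have h3 := (mfderiv_rhoR_mfderiv_legendreGraph hL y v).symm.trans h1
    have h4 := (unifiedForm_legendreGraph_eq_zero_iff hL hreg y h3).1 h2
    exact hv.symm.trans (congrArg (mfderiv 𝓘(ℝ, JetCoord n (2 * k - 1)) (unifiedModel n k)
      (legendreGraph hk L) y) h4)
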